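/- **Setting.** Consider $x_{k+1}=f(x_k,u_k)$, $y_k=h(x_k)$ with $x_k\in\mathbb R^n$, $u_k,y_k\in\mathbb R^m$ ($m\ge 1$), $f,h$ analytic, $f(0,0)=0$, $h(0)=0$. Each output $y_i$ has a globally well-defined relative degree $d_i\ge 1$: with $f_O(x)=f(x,0)$, $h_i(f_O^{j-1}(f(x,u)))$ does not depend on $u$ for $1\le j<d_i$, while $v_i=\tilde\Phi_i(u,x):=h_i(f_O^{d_i-1}(f(x,u)))$ does, for every $x$. Let $\sum_i d_i=n$ and $d_{\max}=\max_i d_i$. The system is full-state feedback linearizable: $T(x)=(h_i(f_O^j(x)))_{1\le i\le m,\,0\le j<d_i}$ is bijective with locally Lipschitz inverse, and there is a locally Lipschitz $\gamma(x,v)$ such that $\gamma(x,\cdot)$ is the inverse of $\tilde\Phi(\cdot,x)$ for every $x$. Write $\Xi_k=T(x_k)=(y_{i,k+j})_{1\le i\le m,\,0\le j<d_i}$ and $\Phi(u,\Xi)=\tilde\Phi(u,T^{-1}(\Xi))$. For a signal $w$ put $\omega_k=(w_{i,k+j})_{i,\,0\le j<d_i}$. Norms $\|\cdot\|_\infty$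 of matrices are the induced ones, $\|v\|_P^2=v^\top Pv$. Fix a horizon $L\ge d_{\max}$, a data length $N$, matrices $Q,R\succ0$, and a compact input set $\mathcal U$ with $0$ in its interior. Let $V_{ROA}>0$, let $\rho_0<\rho$ be such that $\|y\|_Q^2\le V_{ROA}$ implies $\|y\|_\infty<\rho$, and let $\Omega\subset\mathbb R^m\times\mathbb R^n$ be a compact set that contains $\mathcal U\times\{\|\Xi\|_\infty\le\rho\}$. Let $r\in\mathbb N$ and $B\ge0$. *Basis functions with error $\varepsilon^*$.* $\Psi:\mathbb R^m\times\mathbb R^n\to\mathbb R^r$ has locally Lipschitz, linearly independent components and $\Psi(0,0)=0$; $\mathcal G\in\mathbb R^{m\times r}$ minimizes $G\mapsto\int_\Omega\|\Phi-G\Psi\|_2^2$ and has full row rank, $\mathcal G^\dagger=\mathcal G^\top(\mathcal G\mathcal G^\top)^{-1}$; $\epsilon=\Phi-\mathcal G\Psi$ satisfies $\|\epsilon\|_\infty\le\varepsilon^*$ on $\Omega$. $K_\Psi$ is a Lipschitz constant of $\Psi$ with respect to $\Xi$ on $\Omega$. $K_w$ is a constant with $\|\delta\|_\infty\le K_w\|\omega\|_\infty$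 whenever $(u,\Xi),(u,\Xi+\omega)\in\Omega$, where $\delta=\mathcal G\Psi(u,\Xi)+\epsilon(u,\Xi)-\mathcal G\Psi(u,\Xi+\omega)-\epsilon(u,\Xi+\omega)$, and $K_w$ is chosen so large that $K_w\|\mathcal G^\dagger\|_\infty\ge1$. The Lipschitz constant of $\Psi$ on $\Omega$ and $\|\mathcal G\|_\infty,\|\mathcal G^\dagger\|_\infty,K_\Psi,K_w$ are at most $B$. *Data with noise level $w^*$ and excitation constant $c_{pe}$.* A trajectory $u^d_0,\dots,u^d_{N-1}$, $x^d_0,\dots,x^d_N$ of the system and noise $w^d$, $\|w^d_k\|_\infty\le w^*$, such that with $\Xi^d_k=T(x^d_k)$, $\tilde\Xi^d_k=\Xi^d_k+\omega^d_k$ both $(u^d_k,\Xi^d_k)$ and $(u^d_k,\tilde\Xi^d_k)$ lie in $\Omega$ for $0\le k<N$. The sequence $\hat\Psi^d_k=\Psi(u^d_k,\tilde\Xi^d_k)$, $0\le k<N$, is persistently exciting of order $L+d_{\max}+n$, i.e. the block Hankel matrix $H=H_{L+d_{\max}+n}(\hat\Psi^d)$ has full row rank, and $\|H^\top(HH^\top)^{-1}\|_2^2\le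 c_{pe}$. *Optimal control problem at time $t$,* given the past inputs $u$ and measured outputs $\tilde y_k=y_k+w_k$ and weights $\lambda_\alpha,\lambda_\sigma>0$: let $J^*_t$ be the minimum ($\infty$ if infeasible) over $\bar u_k$ $(-d_{\max}\le k<L)$, $\bar y_{i,k}$ $(-d_{\max}\le k<L+d_i)$, $\alpha$, $\sigma=(\sigma_\Psi,\sigma_\Xi)$ of $$\sum_{k=0}^{L-1}\big(\|\bar u_k\|_R^2+\|\bar y_k\|_Q^2\big)+\lambda_\alpha\max\{\varepsilon^*,w^*\}\|\alpha\|_2^2+\lambda_\sigma\|\sigma\|_2^2$$ subject to, with $\bar\Xi_k=(\bar y_{i,k+j})_{i,\,0\le j<d_i}$, $$\begin{bmatrix}(\Psi(\bar u_k,\bar\Xi_k))_{k=-d_{\max}}^{L-1}\\ (\bar\Xi_k)_{k=-d_{\max}}^{L}\end{bmatrix}+\sigma=\begin{bmatrix}H_{L+d_{\max}}(\hat\Psi^d)\\ H_{L+d_{\max}+1}(\tilde\Xi^d)\end{bmatrix}\alpha,$$ $\bar u_k=u_{t+k}$ and $\bar y_k=\tilde y_{t+k}$ for $-d_{\max}\le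 k\le-1$; $\bar y_{i,L+j}=0$ for $0\le j<d_i$; $\bar u_k\in\mathcal U$ for $-d_{\max}\le k<L$; and, for every $k$, $\|\sigma_k\|_\infty\le K_\Psi w^*+(\varepsilon^*+K_ww^*)\|\mathcal G^\dagger\|_\infty(1+\|\alpha\|_1)$. *Closed loop.* A trajectory $(x_k,u_k)_{k\ge-d_{\max}}$ of the system with noise $\|w_k\|_\infty\le w^*$ such that at each $t\in\{0,d_{\max},2d_{\max},\dots\}$ the inputs $u_t,\dots,u_{t+d_{\max}-1}$ are the first $d_{\max}$ inputs $\bar u^*_{[0,d_{\max}-1]}$ of an optimal solution at time $t$, if one exists. **Theorem.** There are $0<\underline\lambda_\alpha<\bar\lambda_\alpha$ and $0<\underline\lambda_\sigma<\bar\lambda_\sigma$ such that for all $\lambda_\alpha\in[\underline\lambda_\alpha,\bar\lambda_\alpha]$, $\lambda_\sigma\in[\underline\lambda_\sigma,\bar\lambda_\sigma]$ there exist $\bar\varepsilon,\bar w,\bar c_{pe}>0$, a continuous, strictly increasing function $\beta:[0,\bar\varepsilon]\times[0,\bar w]\to[0,V_{ROA}]$ with $\beta(0,0)=0$, and constants $M>0$,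 $\kappa\in(0,1)$, such that for all $\varepsilon^*>0$, $w^*\ge0$ and $c_{pe}$ with $\varepsilon^*\le\bar\varepsilon$, $w^*\le\bar w$, $c_{pe}\max\{\varepsilon^*,w^*\}\le\bar c_{pe}$ there are $c>0$ and $P\succ0$ with the following property. For all basis functions and data as above, put $V_t=J^*_t+c\|\Xi_t\|_P^2$. Then every closed loop with $V_0\le V_{ROA}$ and past outputs $\|y_k\|_\infty\le\rho_0$, $-d_{\max}\le k\le -1$, satisfies, for all $j\in\mathbb N$ and $t=jd_{\max}$: 1. (recursive feasibility) the optimal control problem at time $t$ has an optimal solution; 2. (invariance) $V_t\le V_{ROA}$; 3. $(u_k,\Xi_k)\in\Omega$ for all $k\ge-d_{\max}$; 4. (exponential convergence) $V_t\le M\kappa^tV_0+\beta(\varepsilon^*,w^*)$; 5. (practical exponential stability) for all $s\in\mathbb N$, $\|\Xi_s\|_\infty^2\le M\big(\kappa^s\big(\|\Xi_0\|_\infty^2+\sum_{k=-d_{\max}}^{-1}(\|u_k\|_\infty^2+\|y_k\|_\infty^2)\big)+\beta(\varepsilon^*,w^*)\big)$. -/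

import Mathlib

open Set
open scoped NNReal ENNReal Matrix

noncomputable section

/-- Square nonlinear system `x⁺ = f(x,u)`, `y = h(x)` with `m` inputs and outputs and `n` states,
full-state feedback linearizable with globally well-defined relative degrees `d i`.
`fun x => f x 0` is the undriven dynamics. -/
structure FLSystem (m n : ℕ) where
  f : (Fin n → ℝ) → (Fin m → ℝ) → (Fin n → ℝ)
  h : (Fin n → ℝ) → (Fin m → ℝ)
  /-- relative degrees -/
  d : Fin m → ℕ
  /-- inverse of the coordinate transformation `Ξ = T(x)` -/
  Tinv : ((Σ i : Fin m, Fin (d i)) → ℝ) → (Fin n → ℝ)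
  /-- linearizing control law `u = γ(x,v)` -/
  γ : (Fin n → ℝ) → (Fin m → ℝ) → (Fin m → ℝ)
  m_pos : 0 < m
  f_analytic : ∀ p, AnalyticAt ℝ (fun p : (Fin n → ℝ) × (Fin m → ℝ) => f p.1 p.2) p
  h_analytic : ∀ x, AnalyticAt ℝ h x
  f_zero : f 0 0 = 0
  h_zero : h 0 = 0
  d_pos : ∀ i, 0 < d i
  /-- before `d i` steps the input does not influence output `i` -/
  relDeg_lt : ∀ i j, j + 1 < d i → ∀ x u,
    h ((fun x => f x 0)^[j] (f x u)) i = h ((fun x => f x 0)^[j + 1] x) i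
  /-- after `d i` steps it does -/
  relDeg_eq : ∀ i x, ∃ u u',
    h ((fun x => f x 0)^[d i - 1] (f x u)) i ≠ h ((fun x => f x 0)^[d i - 1] (f x u')) i
  sum_d : ∑ i, d i = n
  Tinv_left : ∀ x, Tinv (fun p => h ((fun x => f x 0)^[(p.2 : ℕ)] x) p.1) = x
  Tinv_right : ∀ ξ p, h ((fun x => f x 0)^[(p.2 : ℕ)] (Tinv ξ)) p.1 = ξ p
  Tinv_lipschitz : LocallyLipschitz Tinv
  γ_right : ∀ x v i, h ((fun x => f x 0)^[d i - 1] (f x (γ x v))) i = v i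
  γ_left : ∀ x u, γ x (fun i => h ((fun x => f x 0)^[d i - 1] (f x u)) i) = u
  γ_lipschitz : LocallyLipschitz (fun p : (Fin n → ℝ) × (Fin m → ℝ) => γ p.1 p.2)

namespace FLSystem

variable {m n : ℕ} (S : FLSystem m n)

/-- Index set of the transformed state `Ξ = (y_{1,[k,k+d₁-1]}, …, y_{m,[k,k+d_m-1]})`. -/
abbrev Idx : Type := Σ i : Fin m, Fin (S.d i)

/-- Maximal relative degree. -/
def dmax : ℕ := Finset.univ.sup S.d

/-- `T(x)`: the outputs `y_{i,k}, …, y_{i,k+dᵢ-1}` produced from the state `x` at time `k`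
(they do not depend on the inputs). -/
def T (x : Fin n → ℝ) : S.Idx → ℝ := fun p => S.h ((fun x => S.f x 0)^[(p.2 : ℕ)] x) p.1

/-- The synthetic input `v = Φ̃(u,x)`, `v_i = y_{i,k+dᵢ}`. -/
def PhiT (u : Fin m → ℝ) (x : Fin n → ℝ) : Fin m → ℝ :=
  fun i => S.h ((fun x => S.f x 0)^[S.d i - 1] (S.f x u)) i

/-- `Φ(u,Ξ) = Φ̃(u,T⁻¹(Ξ))`. -/
def Phi (u : Fin m → ℝ) (ξ : S.Idx → ℝ) : Fin m → ℝ := S.PhiT u (S.Tinv ξ)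

/-- `(y_{1,[k,k+d₁-1]}, …, y_{m,[k,k+d_m-1]})` for a signal `y` in discrete time. -/
def stack {τ : Type} [Add τ] [NatCast τ] (y : τ → Fin m → ℝ) (k : τ) : S.Idx → ℝ :=
  fun p => y (k + ((p.2 : ℕ) : τ)) p.1

end FLSystem

/-- The right inverse `M† = Mᵀ (M Mᵀ)⁻¹` of a matrix of full row rank. -/
def rightInv {a b : Type*} [Fintype a] [Fintype b] [DecidableEq a]
    (M : Matrix a b ℝ) : Matrix b a ℝ := Mᵀ * (M * Mᵀ)⁻¹

/-- Matrix norm induced by the `∞`-norm. -/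
def matNormInf {a b : Type*} [Fintype a] [Fintype b] (M : Matrix a b ℝ) : ℝ :=
  (Matrix.linftyOpNormedAddCommGroup (m := a) (n := b) (α := ℝ)).toNorm.norm M

/-- Matrix norm induced by the Euclidean norm. -/
def matNormTwo {a b : Type*} [Fintype a] [Fintype b] [DecidableEq b] (M : Matrix a b ℝ) : ℝ :=
  (Matrix.instL2OpNormedAddCommGroup (m := a) (n := b) (𝕜 := ℝ)).toNorm.norm M

/-- The weighted norm `‖v‖_P² = vᵀ P v`. -/
def wsq {a : Type*} [Fintype a] (P : Matrix a a ℝ) (v : a → ℝ) : ℝ := v ⬝ᵥ (P *ᵥ v)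

/-- Block Hankel matrix of depth `L` with `q` columns; block `(k,j)` is `z_{k+j}`.
For a sequence of `N` samples one has `q = N + 1 - L`. -/
def hankel {ι : Type*} (L q : ℕ) (z : ℕ → ι → ℝ) : Matrix (Fin L × ι) (Fin q) ℝ :=
  fun p j => z ((p.1 : ℕ) + (j : ℕ)) p.2

/-- `z_0, …, z_{N-1}` is persistently exciting of order `L`. -/
def PersistentlyExciting {ι : Type*} [Fintype ι] (N L : ℕ) (z : ℕ → ι → ℝ) : Prop :=
  (hankel L (N + 1 - L) z).rank = Fintype.card ι * L

/-- Design parameters of the controller: horizon `L`, number `N` of data samples, weights `Q`, `R`,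
compact input constraint set `U` with the set point `0` in its interior. -/
structure Controller {m n : ℕ} (S : FLSystem m n) where
  L : ℕ
  N : ℕ
  Q : Matrix (Fin m) (Fin m) ℝ
  R : Matrix (Fin m) (Fin m) ℝ
  U : Set (Fin m → ℝ)
  Q_posDef : Q.PosDef
  R_posDef : R.PosDef
  U_compact : IsCompact U
  U_zero : (0 : Fin m → ℝ) ∈ interior U
  horizon : S.dmax ≤ L

/-- Basis functions `Ψ`, coefficient matrix `G`, and the constants `K_Ψ`, `K_w` which the controller
uses. -/
structure Basis {m n : ℕ} (S : FLSystem m n) (r : ℕ) where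
  Psi : (Fin m → ℝ) × (S.Idx → ℝ) → Fin r → ℝ
  G : Matrix (Fin m) (Fin r) ℝ
  KPsi : ℝ
  Kw : ℝ

namespace Basis

variable {m n r : ℕ} {S : FLSystem m n} (b : Basis S r)

/-- The approximation error `ε(u,Ξ) = Φ(u,Ξ) - G Ψ(u,Ξ)`. -/
def err (u : Fin m → ℝ) (ξ : S.Idx → ℝ) : Fin m → ℝ := S.Phi u ξ - b.G *ᵥ b.Psi (u, ξ)

/-- The effect `δ(ω)` of replacing `Ξ` by `Ξ + ω` in the basis function expansion. -/
def delta (u : Fin m → ℝ) (ξ ω : S.Idx → ℝ) : Fin m → ℝ :=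
  b.G *ᵥ b.Psi (u, ξ) + b.err u ξ - b.G *ᵥ b.Psi (u, ξ + ω) - b.err u (ξ + ω)

/-- Assumptions on the basis functions on the set `Ω`, with approximation error at most `εs`.
The number `B` bounds all constants of the expansion. -/
structure Admissible (Ω : Set ((Fin m → ℝ) × (S.Idx → ℝ))) (B : ℝ≥0) (εs : ℝ) : Prop where
  loc_lipschitz : LocallyLipschitz b.Psi
  lin_indep : LinearIndependent ℝ (fun (j : Fin r) (p : (Fin m → ℝ) × (S.Idx → ℝ)) => b.Psi p j)
  /-- the basis functions vanish at the equilibrium -/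
  psi_zero : b.Psi (0, 0) = 0
  /-- `G` is a least squares fit of `Φ` on `Ω` -/
  G_argmin : ∀ G' : Matrix (Fin m) (Fin r) ℝ,
    ∫ p in Ω, (S.Phi p.1 p.2 - b.G *ᵥ b.Psi p) ⬝ᵥ (S.Phi p.1 p.2 - b.G *ᵥ b.Psi p) ≤
      ∫ p in Ω, (S.Phi p.1 p.2 - G' *ᵥ b.Psi p) ⬝ᵥ (S.Phi p.1 p.2 - G' *ᵥ b.Psi p)
  G_rank : b.G.rank = m
  err_le : ∀ u ξ, (u, ξ) ∈ Ω → ‖b.err u ξ‖ ≤ εs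
  /-- `K_Ψ` is a Lipschitz constant of `Ψ` in its second argument on `Ω` -/
  KPsi_lip : ∀ u ξ ξ', (u, ξ) ∈ Ω → (u, ξ') ∈ Ω →
    ‖b.Psi (u, ξ) - b.Psi (u, ξ')‖ ≤ b.KPsi * ‖ξ - ξ'‖
  /-- `K_w` bounds the effect of the noise on `Ω` -/
  Kw_le : ∀ u ξ ω, (u, ξ) ∈ Ω → (u, ξ + ω) ∈ Ω → ‖b.delta u ξ ω‖ ≤ b.Kw * ‖ω‖
  /-- `K_w` is taken large enough that the slack bound leaves room for the output noise itself -/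
  Kw_large : 1 ≤ b.Kw * matNormInf (rightInv b.G)
  bound_lip : LipschitzOnWith B b.Psi Ω
  bound_G : matNormInf b.G ≤ B
  bound_Ginv : matNormInf (rightInv b.G) ≤ B
  bound_KPsi : b.KPsi ≤ B
  bound_Kw : b.Kw ≤ B

end Basis

/-- Offline data: inputs, states (not measured) and output noise. -/
structure Data (m n : ℕ) where
  ud : ℕ → Fin m → ℝ
  xd : ℕ → Fin n → ℝ
  wd : ℕ → Fin m → ℝ

namespace Data

variable {m n r : ℕ} (D : Data m n) {S : FLSystem m n}

/-- The noisy transformed state `Ξ̃ᵈ_k = Ξᵈ_k + ωᵈ_k`, made of the noisy outputs. -/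
def xiNoisy (S : FLSystem m n) (k : ℕ) : S.Idx → ℝ := S.T (D.xd k) + S.stack D.wd k

/-- The sequence `Ψ(uᵈ_k, Ξ̃ᵈ_k)`. -/
def psi (b : Basis S r) (k : ℕ) : Fin r → ℝ := b.Psi (D.ud k, D.xiNoisy S k)

/-- The data are a trajectory of the system in `Ω` with noise at most `ws`; the noisy basis function
data are persistently exciting of order `L + dmax + n`, and the squared norm of the right inverse of
the corresponding Hankel matrix is at most `cpe`. -/
structure Admissible (C : Controller S) (b : Basis S r) (Ω : Set ((Fin m → ℝ) × (S.Idx → ℝ)))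
    (ws cpe : ℝ) : Prop where
  dyn : ∀ k < C.N, D.xd (k + 1) = S.f (D.xd k) (D.ud k)
  noise : ∀ k, ‖D.wd k‖ ≤ ws
  mem : ∀ k < C.N, (D.ud k, S.T (D.xd k)) ∈ Ω
  mem_noisy : ∀ k < C.N, (D.ud k, D.xiNoisy S k) ∈ Ω
  pe : PersistentlyExciting C.N (C.L + S.dmax + n) (D.psi b)
  cpe_le : matNormTwo (rightInv (hankel (C.L + S.dmax + n) (C.N + 1 - (C.L + S.dmax + n))
    (D.psi b))) ^ 2 ≤ cpe

end Data

/-- Everything that specifies the optimal control problem except the measurements. -/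
structure Problem {m n : ℕ} (S : FLSystem m n) (r : ℕ) where
  C : Controller S
  b : Basis S r
  D : Data m n
  εs : ℝ
  ws : ℝ
  lamA : ℝ
  lamS : ℝ

/-- Decision variables. `u` and `y` are indexed by the prediction time; only `u_k` for
`-dmax ≤ k < L` and `y_{i,k}` for `-dmax ≤ k < L + dᵢ` play a role. Row `k` of the slack variables
belongs to the prediction time `k - dmax`. -/
structure Decision {m n : ℕ} (S : FLSystem m n) (r : ℕ) (C : Controller S) where
  u : ℤ → Fin m → ℝ
  y : ℤ → Fin m → ℝ
  α : Fin (C.N + 1 - (C.L + S.dmax)) → ℝ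
  σΨ : Fin (C.L + S.dmax) → Fin r → ℝ
  σΞ : Fin (C.L + S.dmax + 1) → S.Idx → ℝ

namespace Problem

variable {m n r : ℕ} {S : FLSystem m n} (p : Problem S r)

/-- The cost of the optimal control problem. -/
def cost (z : Decision S r p.C) : ℝ :=
  ∑ k ∈ Finset.range p.C.L, (wsq p.C.R (z.u k) + wsq p.C.Q (z.y k)) +
    p.lamA * max p.εs p.ws * ∑ j, z.α j ^ 2 +
    p.lamS * (∑ k, ∑ j, z.σΨ k j ^ 2 + ∑ k, ∑ j, z.σΞ k j ^ 2)

/-- The bound on the slack variables. -/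
def slackBound (α : Fin (p.C.N + 1 - (p.C.L + S.dmax)) → ℝ) : ℝ :=
  p.b.KPsi * p.ws +
    (p.εs + p.b.Kw * p.ws) * matNormInf (rightInv p.b.G) * (1 + ∑ j, |α j|)

/-- Feasibility at time `t`, given the applied inputs `u` and the measured outputs `yt`. -/
structure Feasible (u yt : ℤ → Fin m → ℝ) (t : ℤ) (z : Decision S r p.C) : Prop where
  hankel_psi : ∀ (k : Fin (p.C.L + S.dmax)) (j : Fin r),
    p.b.Psi (z.u ((k : ℤ) - S.dmax), S.stack z.y ((k : ℤ) - S.dmax)) j + z.σΨ k j =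
      (hankel (p.C.L + S.dmax) (p.C.N + 1 - (p.C.L + S.dmax)) (p.D.psi p.b) *ᵥ z.α) (k, j)
  hankel_xi : ∀ (k : Fin (p.C.L + S.dmax + 1)) (j : S.Idx),
    S.stack z.y ((k : ℤ) - S.dmax) j + z.σΞ k j =
      (hankel (p.C.L + S.dmax + 1) (p.C.N + 1 - (p.C.L + S.dmax)) (p.D.xiNoisy S) *ᵥ z.α) (k, j)
  init : ∀ k : ℤ, -S.dmax ≤ k → k < 0 → z.u k = u (t + k) ∧ z.y k = yt (t + k)
  terminal : ∀ i, ∀ k : ℕ, k < S.d i → z.y (p.C.L + k) i = 0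
  slack_psi : ∀ k, ‖z.σΨ k‖ ≤ p.slackBound z.α
  slack_xi : ∀ k, ‖z.σΞ k‖ ≤ p.slackBound z.α
  input : ∀ k : ℤ, -S.dmax ≤ k → k < p.C.L → z.u k ∈ p.C.U

/-- `z` solves the optimal control problem at time `t`. -/
def IsOptimal (u yt : ℤ → Fin m → ℝ) (t : ℤ) (z : Decision S r p.C) : Prop :=
  p.Feasible u yt t z ∧ ∀ z', p.Feasible u yt t z' → p.cost z ≤ p.cost z'

/-- Optimal value, `∞` if the problem is infeasible. -/
def J (u yt : ℤ → Fin m → ℝ) (t : ℤ) : ℝ≥0∞ :=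
  ⨅ (z : Decision S r p.C) (_ : p.Feasible u yt t z), ENNReal.ofReal (p.cost z)

/-- The measured outputs `y + w`. -/
def meas (S : FLSystem m n) (x : ℤ → Fin n → ℝ) (w : ℤ → Fin m → ℝ) : ℤ → Fin m → ℝ :=
  fun k => S.h (x k) + w k

/-- A trajectory of the system, from time `-dmax` on, with output noise at most `ws`, such that at
the times `t = 0, dmax, 2 dmax, …` the first `dmax` inputs of an optimal solution are applied, as
long as there is one. -/
structure ClosedLoop (x : ℤ → Fin n → ℝ) (u w : ℤ → Fin m → ℝ) : Prop where
  dyn : ∀ k : ℤ, -S.dmax ≤ k → x (k + 1) = S.f (x k) (u k)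
  noise : ∀ k : ℤ, -S.dmax ≤ k → ‖w k‖ ≤ p.ws
  control : ∀ j : ℕ, (∃ z, p.IsOptimal u (meas S x w) (j * S.dmax) z) →
    ∃ z, p.IsOptimal u (meas S x w) (j * S.dmax) z ∧
      ∀ k : ℕ, k < S.dmax → u (j * S.dmax + k) = z.u k

/-- The Lyapunov function candidate `V_t = J*_t + c ‖Ξ_t‖_P²`. -/
def V (c : ℝ) (P : Matrix S.Idx S.Idx ℝ) (x : ℤ → Fin n → ℝ) (u w : ℤ → Fin m → ℝ) (t : ℤ) :
    ℝ≥0∞ :=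
  p.J u (meas S x w) t + ENNReal.ofReal (c * wsq P (S.T (x t)))

end Problem

end

/-!
In the coordinates `Ξ = T(x)` the system is, for every output, a chain of delays that is fed with the
synthetic input `v = Φ(u,Ξ)` (`FLSystem.step_of_lt`, `FLSystem.step_of_eq`), and the feedback that
makes `v = 0` steers every state to the origin in `dmax` steps without increasing `‖Ξ‖`. All estimates
below have constants that depend only on the system, the controller, the weights and `B`; the
error level is `μ = max εs ws`.

**Matching trajectories by data.** Persistency of excitation provides a right inverse of the Hankel
matrix of the basis functions. The synthetic inputs of the data differ from `G Ψ` by `O(μ)`, a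
perturbation of the Hankel equation which is harmless as `cpe μ` is small and `μ` is small
(`exists_solution_of_perturbed`). Since `n` additional samples suffice to generate the initial state
of the chains, every trajectory of length `L + dmax` is a combination of data windows, up to errors
that the slack variables may take up (`exists_coefficients`). The coefficients satisfy
`μ ‖α‖₂² = O(cpe μ)` times the energy of the trajectory, so a trajectory that ends at the origin
yields a feasible decision whose cost is nearly the cost of the trajectory
(`exists_feasible_of_trajectory`, `exists_feasible_deadbeat`).

**Prediction.** Conversely the states predicted by a feasible decision of cost `J` satisfy the system
equations up to `O(μ (1 + ‖α‖₁))`, and `J` contains the term `μ ‖α‖₂²`. By Lipschitz continuity the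
prediction error `e` obeys `e² = O(μ² + μ J)` (`exists_prediction_error`).

**One period.** Let `s` be the sum of the first `dmax` stage costs of an optimal decision at time `t`.
At time `t + dmax` there are two candidates (`exists_one_step`). Shifting the decision and appending
deadbeat control shows `J' ≤ (1 + θ) J - s + O(μ²)` for any prescribed `θ > 0`. Starting deadbeat
control at once shows `J' = O(s + μ J + μ²)` near the origin, and the same bound holds trivially
elsewhere, because the state at time `t + dmax` satisfies `‖Ξ'‖² = O(s + μ J + μ²)`. A convex
combination of the two bounds eliminates `s` and gives `V' ≤ (1 - a) V + O(μ²)` with a fixed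
`a ∈ (0,1)`, where `P = 1` and `c` is so small that the term `c ‖Ξ'‖²` is paid for by `s`
(`exists_contraction`). Minimizers exist by compactness (`exists_isOptimal`).

**Conclusion.** Induction over the periods gives recursive feasibility, invariance, membership in `Ω`
and the geometric decay of `V`, with `β(ε,w)` proportional to `ε + w`. The bound in terms of the
initial data follows from `V₀ = O(‖Ξ₀‖² + past + μ²)`, which is again deadbeat control
(`exists_initial_bound`). The weights `λ_α` and `λ_σ` may lie in any compact range of positive numbers.
-/

/-! ### The dynamics in the coordinates of the outputs -/

namespace FLSystem

variable {m n : ℕ} (S : FLSystem m n)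

/-- The dynamics in the coordinates `Ξ = T(x)`: a chain of delays for every output, the last entry of
chain `i` being `Φ_i(u,Ξ)`. -/
noncomputable def step (u : Fin m → ℝ) (ξ : S.Idx → ℝ) : S.Idx → ℝ := S.T (S.f (S.Tinv ξ) u)

/-- The feedback that makes every synthetic input zero. -/
noncomputable def fb (ξ : S.Idx → ℝ) : Fin m → ℝ := S.γ (S.Tinv ξ) 0

/-- The closed loop under `S.fb`. It shifts zeros into the chains and reaches the origin after `dmax`
steps. -/
noncomputable def dead (ξ : S.Idx → ℝ) : S.Idx → ℝ := S.step (S.fb ξ) ξ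

/-- The output as a function of the transformed state: the first entry of every chain. -/
def out (ξ : S.Idx → ℝ) : Fin m → ℝ := fun i => ξ ⟨i, ⟨0, S.d_pos i⟩⟩

lemma Tinv_T (x : Fin n → ℝ) : S.Tinv (S.T x) = x := S.Tinv_left x

lemma T_f (x : Fin n → ℝ) (u : Fin m → ℝ) : S.T (S.f x u) = S.step u (S.T x) := by
  simp only [step, Tinv_T]

lemma out_T (x : Fin n → ℝ) : S.out (S.T x) = S.h x := rfl

lemma step_of_lt (u : Fin m → ℝ) (ξ : S.Idx → ℝ) (i : Fin m) (j : ℕ) (hj : j + 1 < S.d i) :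
    S.step u ξ ⟨i, ⟨j, by omega⟩⟩ = ξ ⟨i, ⟨j + 1, hj⟩⟩ := by
  have h := S.relDeg_lt i j hj (S.Tinv ξ) u
  have h2 := S.Tinv_right ξ ⟨i, ⟨j + 1, hj⟩⟩
  exact h.trans h2

lemma step_of_eq (u : Fin m → ℝ) (ξ : S.Idx → ℝ) (i : Fin m) (j : ℕ) (hj : j + 1 = S.d i) :
    S.step u ξ ⟨i, ⟨j, by omega⟩⟩ = S.Phi u ξ i := by
  have : j = S.d i - 1 := by omega
  subst this
  rfl

lemma undriven_zero (k : ℕ) : (fun x => S.f x 0)^[k] 0 = 0 :=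
  Function.iterate_fixed (f := fun x => S.f x 0) S.f_zero k

lemma T_zero : S.T 0 = 0 := by
  funext p
  simp only [T, undriven_zero, S.h_zero, Pi.zero_apply]

lemma Tinv_zero : S.Tinv 0 = 0 := by
  rw [← S.T_zero, Tinv_T]

lemma Phi_zero : S.Phi 0 0 = 0 := by
  funext i
  simp only [Phi, PhiT, Tinv_zero, S.f_zero, undriven_zero, S.h_zero, Pi.zero_apply]

lemma step_zero : S.step 0 0 = 0 := by
  simp only [step, Tinv_zero, S.f_zero, T_zero]

lemma Phi_fb (ξ : S.Idx → ℝ) : S.Phi (S.fb ξ) ξ = 0 :=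
  funext fun i => S.γ_right (S.Tinv ξ) 0 i

lemma fb_zero : S.fb 0 = 0 := by
  have h := S.γ_left 0 0
  have h0 : (fun i => S.h ((fun x => S.f x 0)^[S.d i - 1] (S.f 0 0)) i) = 0 := by
    have h1 := S.Phi_zero
    rw [Phi, Tinv_zero] at h1
    exact h1
  rw [h0] at h
  simpa only [fb, Tinv_zero] using h

lemma norm_out_le (ξ : S.Idx → ℝ) : ‖S.out ξ‖ ≤ ‖ξ‖ :=
  (pi_norm_le_iff_of_nonneg (norm_nonneg _)).2 fun _ => norm_le_pi_norm ξ _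

lemma d_le_dmax (i : Fin m) : S.d i ≤ S.dmax := Finset.le_sup (f := S.d) (Finset.mem_univ i)

lemma d_le_n (i : Fin m) : S.d i ≤ n := by
  have h := Finset.single_le_sum (f := S.d) (fun _ _ => Nat.zero_le _) (Finset.mem_univ i)
  rwa [S.sum_d] at h

lemma dmax_pos : 0 < S.dmax := lt_of_lt_of_le (S.d_pos ⟨0, S.m_pos⟩) (S.d_le_dmax _)

lemma card_Idx : Fintype.card S.Idx = n := by
  simp [Idx, S.sum_d]

/-! ### Lipschitz bounds on compact sets -/

lemma undriven_contDiff (k : ℕ) : ContDiff ℝ 1 (fun x => S.f x 0)^[k] := by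
  have h0 : ContDiff ℝ 1 (fun x => S.f x 0) :=
    (contDiff_iff_contDiffAt.2 fun p => (S.f_analytic p).contDiffAt).comp
      (contDiff_id.prodMk contDiff_const)
  induction k with
  | zero => exact contDiff_id
  | succ k ih => exact ih.comp h0

lemma locallyLipschitz_Phi :
    LocallyLipschitz (fun p : (Fin m → ℝ) × (S.Idx → ℝ) => S.Phi p.1 p.2) := by
  have hf : ContDiff ℝ 1 (fun p : (Fin n → ℝ) × (Fin m → ℝ) => S.f p.1 p.2) :=
    contDiff_iff_contDiffAt.2 fun p => (S.f_analytic p).contDiffAt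
  have hh : ContDiff ℝ 1 S.h := contDiff_iff_contDiffAt.2 fun p => (S.h_analytic p).contDiffAt
  have h1 : ContDiff ℝ 1 (fun p : (Fin n → ℝ) × (Fin m → ℝ) => S.PhiT p.2 p.1) := by
    rw [contDiff_pi]
    intro i
    exact (contDiff_pi.1 hh i).comp ((S.undriven_contDiff (S.d i - 1)).comp hf)
  have h2 : LocallyLipschitz (fun p : (Fin m → ℝ) × (S.Idx → ℝ) => (S.Tinv p.2, p.1)) :=
    (S.Tinv_lipschitz.comp LipschitzWith.prod_snd.locallyLipschitz).prodMk
      LipschitzWith.prod_fst.locallyLipschitz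
  have h3 : LocallyLipschitz (fun p : (Fin n → ℝ) × (Fin m → ℝ) => S.PhiT p.2 p.1) :=
    h1.locallyLipschitz
  have h4 := h3.comp h2
  simp only [Function.comp_def] at h4
  unfold Phi
  exact h4

lemma locallyLipschitz_fb : LocallyLipschitz S.fb :=
  S.γ_lipschitz.comp (S.Tinv_lipschitz.prodMk (LocallyLipschitz.const 0))

lemma exists_lipschitz_Phi {U : Set (Fin m → ℝ)} (hU : IsCompact U) (R : ℝ) :
    ∃ K : ℝ, 1 ≤ K ∧ ∀ u ∈ U, ∀ u' ∈ U, ∀ ξ ξ', ‖ξ‖ ≤ R → ‖ξ'‖ ≤ R →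
      ‖S.Phi u ξ - S.Phi u' ξ'‖ ≤ K * max ‖u - u'‖ ‖ξ - ξ'‖ := by
  obtain ⟨K, hK⟩ := LocallyLipschitzOn.exists_lipschitzOnWith_of_compact
    (hU.prod (isCompact_closedBall (0 : S.Idx → ℝ) R)) (S.locallyLipschitz_Phi.locallyLipschitzOn)
  refine ⟨max 1 K, le_max_left _ _, fun u hu u' hu' ξ ξ' h h' => ?_⟩
  have := hK.norm_sub_le (x := (u, ξ)) (y := (u', ξ')) ⟨hu, by simpa using h⟩ ⟨hu', by simpa using h'⟩
  refine this.trans ?_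
  rw [Prod.norm_def]
  exact mul_le_mul_of_nonneg_right (le_max_right _ _) (le_max_of_le_left (norm_nonneg _))

lemma exists_bound_fb (R : ℝ) : ∃ K : ℝ, 1 ≤ K ∧ ∀ ξ, ‖ξ‖ ≤ R → ‖S.fb ξ‖ ≤ K * ‖ξ‖ := by
  obtain ⟨K, hK⟩ := LocallyLipschitzOn.exists_lipschitzOnWith_of_compact
    (isCompact_closedBall (0 : S.Idx → ℝ) R) (S.locallyLipschitz_fb.locallyLipschitzOn)
  refine ⟨max 1 K, le_max_left _ _, fun ξ h => ?_⟩
  have h0 : (0 : S.Idx → ℝ) ∈ Metric.closedBall (0 : S.Idx → ℝ) R :=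
    Metric.mem_closedBall_self ((norm_nonneg _).trans h)
  have := hK.norm_sub_le (x := ξ) (y := 0) (by simpa using h) h0
  rw [fb_zero, sub_zero, sub_zero] at this
  exact this.trans (mul_le_mul_of_nonneg_right (le_max_right _ _) (norm_nonneg _))

/-- All entries but the last of each chain are only moved, so one step is as Lipschitz as `Φ` is. -/
lemma norm_step_sub_le {u u' : Fin m → ℝ} {ξ ξ' : S.Idx → ℝ} {c : ℝ} (h : ‖ξ - ξ'‖ ≤ c)
    (h' : ‖S.Phi u ξ - S.Phi u' ξ'‖ ≤ c) : ‖S.step u ξ - S.step u' ξ'‖ ≤ c := by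
  refine (pi_norm_le_iff_of_nonneg ((norm_nonneg _).trans h)).2 ?_
  rintro ⟨i, j, hj⟩
  rw [Pi.sub_apply]
  by_cases hj' : j + 1 < S.d i
  · rw [S.step_of_lt _ _ i j hj', S.step_of_lt _ _ i j hj']
    exact (norm_le_pi_norm (ξ - ξ') ⟨i, ⟨j + 1, hj'⟩⟩).trans h
  · rw [S.step_of_eq _ _ i j (by omega), S.step_of_eq _ _ i j (by omega)]
    exact (norm_le_pi_norm (S.Phi u ξ - S.Phi u' ξ') i).trans h'

/-! ### Deadbeat control -/

lemma dead_iterate_apply (ξ : S.Idx → ℝ) (k : ℕ) (i : Fin m) (j : ℕ) (hj : j < S.d i) :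
    S.dead^[k] ξ ⟨i, ⟨j, hj⟩⟩ = if h : j + k < S.d i then ξ ⟨i, ⟨j + k, h⟩⟩ else 0 := by
  induction k generalizing j with
  | zero => simp [hj]
  | succ k ih =>
    rw [Function.iterate_succ_apply', dead]
    by_cases hj' : j + 1 < S.d i
    · rw [S.step_of_lt _ _ i j hj', ih]
      simp only [show j + 1 + k = j + (k + 1) by ring]
    · rw [S.step_of_eq _ _ i j (by omega), Phi_fb, dif_neg (by omega)]
      rfl

lemma norm_dead_iterate_le (ξ : S.Idx → ℝ) (k : ℕ) : ‖S.dead^[k] ξ‖ ≤ ‖ξ‖ := by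
  refine (pi_norm_le_iff_of_nonneg (norm_nonneg _)).2 ?_
  rintro ⟨i, j, hj⟩
  rw [dead_iterate_apply]
  split_ifs
  · exact norm_le_pi_norm ξ _
  · simp

lemma dead_iterate_eq_zero (ξ : S.Idx → ℝ) (k : ℕ) (hk : S.dmax ≤ k) : S.dead^[k] ξ = 0 := by
  funext ⟨i, j, hj⟩
  have := S.d_le_dmax i
  rw [dead_iterate_apply, dif_neg (by omega), Pi.zero_apply]

/-! ### Trajectories as chains of delays -/

section Trajectory

variable {S} {Ξ : ℕ → S.Idx → ℝ} {U : ℕ → Fin m → ℝ} {W : ℕ}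

lemma traj_shift (h : ∀ k < W, Ξ (k + 1) = S.step (U k) (Ξ k)) (k l : ℕ) (hkl : k + l ≤ W)
    (i : Fin m) (j : ℕ) (hj : j + l < S.d i) :
    Ξ (k + l) ⟨i, ⟨j, by omega⟩⟩ = Ξ k ⟨i, ⟨j + l, hj⟩⟩ := by
  induction l generalizing j with
  | zero => rfl
  | succ l ih =>
    rw [← add_assoc, h _ (by omega), S.step_of_lt _ _ i j (by omega), ih (by omega) (j + 1) (by omega)]
    simp only [show j + 1 + l = j + (l + 1) by ring]

/-- Every entry of the state is a synthetic input applied earlier, provided that it has entered the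
chain since time `0`. -/
lemma traj_Phi (h : ∀ k < W, Ξ (k + 1) = S.step (U k) (Ξ k)) (k k' : ℕ) (hk : k ≤ W)
    (i : Fin m) (j : ℕ) (hj : j < S.d i) (hk' : k' + S.d i = k + j) :
    Ξ k ⟨i, ⟨j, hj⟩⟩ = S.Phi (U k') (Ξ k') i := by
  have hd := S.d_pos i
  obtain ⟨l, rfl⟩ : ∃ l, k = k' + 1 + l := ⟨k - (k' + 1), by omega⟩
  rw [traj_shift h (k' + 1) l hk i j (by omega), h k' (by omega),
    S.step_of_eq _ _ i (j + l) (by omega)]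

end Trajectory

end FLSystem

/-! ### Norms and perturbed linear equations -/

section LinearAlgebra

variable {a b : Type*} [Fintype a] [Fintype b]

lemma sum_sq_mulVec_le [DecidableEq b] (M : Matrix a b ℝ) (x : b → ℝ) :
    ∑ i, (M *ᵥ x) i ^ 2 ≤ matNormTwo M ^ 2 * ∑ j, x j ^ 2 := by
  have h := Matrix.l2_opNorm_mulVec M (WithLp.toLp 2 x)
  have h2 := pow_le_pow_left₀ (norm_nonneg _) h 2
  rw [mul_pow, EuclideanSpace.norm_sq_eq, EuclideanSpace.norm_sq_eq] at h2
  simpa [matNormTwo] using h2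

lemma matNormInf_nonneg (M : Matrix a b ℝ) : 0 ≤ matNormInf M :=
  letI := Matrix.linftyOpNormedAddCommGroup (m := a) (n := b) (α := ℝ)
  norm_nonneg M

lemma norm_mulVec_le (M : Matrix a b ℝ) (x : b → ℝ) : ‖M *ᵥ x‖ ≤ matNormInf M * ‖x‖ :=
  Matrix.linfty_opNorm_mulVec M x

lemma norm_mulVec_le_of_le {M : Matrix a b ℝ} {x : b → ℝ} {K c : ℝ} (hM : matNormInf M ≤ K)
    (hx : ‖x‖ ≤ c) : ‖M *ᵥ x‖ ≤ K * c :=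
  (norm_mulVec_le M x).trans (mul_le_mul hM hx (norm_nonneg _) ((matNormInf_nonneg M).trans hM))

lemma mul_rightInv [DecidableEq a] {M : Matrix a b ℝ} (h : M.rank = Fintype.card a) :
    M * rightInv M = 1 := by
  have h1 : (M * Mᵀ).rank = Fintype.card a := by rw [Matrix.rank_self_mul_transpose, h]
  have h2 : IsUnit (M * Mᵀ) := by
    rw [← Matrix.mulVec_surjective_iff_isUnit]
    have h3 : LinearMap.range (M * Mᵀ).mulVecLin = ⊤ := by
      apply Submodule.eq_top_of_finrank_eq
      rw [Module.finrank_fintype_fun_eq_card]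
      exact h1
    exact LinearMap.range_eq_top.1 h3
  rw [rightInv, ← Matrix.mul_assoc, Matrix.mul_nonsing_inv _ ((Matrix.isUnit_iff_isUnit_det _).1 h2)]

lemma sum_sq_le_card_mul (x : a → ℝ) : ∑ i, x i ^ 2 ≤ Fintype.card a * ‖x‖ ^ 2 := by
  refine (Finset.sum_le_card_nsmul _ _ (‖x‖ ^ 2) fun i _ => ?_).trans ?_
  · rw [← sq_abs]
    exact pow_le_pow_left₀ (abs_nonneg _) (norm_le_pi_norm x i) 2
  · simp [Finset.card_univ]

lemma norm_sq_le_sum_sq (x : a → ℝ) : ‖x‖ ^ 2 ≤ ∑ i, x i ^ 2 := by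
  have h : ‖x‖ ≤ √(∑ i, x i ^ 2) := by
    refine (pi_norm_le_iff_of_nonneg (Real.sqrt_nonneg _)).2 fun i => ?_
    rw [Real.norm_eq_abs, ← Real.sqrt_sq_eq_abs]
    exact Real.sqrt_le_sqrt (Finset.single_le_sum (f := fun i => x i ^ 2)
      (fun _ _ => sq_nonneg _) (Finset.mem_univ i))
  calc ‖x‖ ^ 2 ≤ √(∑ i, x i ^ 2) ^ 2 := pow_le_pow_left₀ (norm_nonneg _) h 2
    _ = _ := Real.sq_sqrt (Finset.sum_nonneg fun _ _ => sq_nonneg _)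

lemma sum_abs_sq_le (x : a → ℝ) : (∑ i, |x i|) ^ 2 ≤ Fintype.card a * ∑ i, x i ^ 2 := by
  have h := sq_sum_le_card_mul_sum_sq (s := Finset.univ) (f := fun i => |x i|)
  simpa [sq_abs] using h

lemma abs_sum_mul_le {g : a → ℝ} {c : ℝ} (hg : ∀ i, |g i| ≤ c) (x : a → ℝ) :
    |∑ i, g i * x i| ≤ c * ∑ i, |x i| := by
  rw [Finset.mul_sum]
  refine (Finset.abs_sum_le_sum_abs _ _).trans (Finset.sum_le_sum fun i _ => ?_)
  rw [abs_mul]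
  exact mul_le_mul_of_nonneg_right (hg i) (abs_nonneg _)

/-- A right inverse of `H` with small enough norm yields bounded solutions of a perturbed equation:
the square matrix `1 + E H†` is injective, hence surjective. -/
lemma exists_solution_of_perturbed [DecidableEq a] [DecidableEq b] {H E : Matrix a b ℝ}
    {Hi : Matrix b a ℝ} {c e : ℝ} (hH : H * Hi = 1) (hHi : matNormTwo Hi ^ 2 ≤ c)
    (hE : ∀ i j, |E i j| ≤ e)
    (hsmall : Fintype.card a * Fintype.card b * (e ^ 2 * c) ≤ 1 / 4) (τ : a → ℝ) :
    ∃ α : b → ℝ, (H + E) *ᵥ α = τ ∧ ∑ j, α j ^ 2 ≤ 4 * c * ∑ i, τ i ^ 2 := by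
  have hHi' : ∀ x : a → ℝ, ∑ j, (Hi *ᵥ x) j ^ 2 ≤ c * ∑ i, x i ^ 2 := fun x =>
    (sum_sq_mulVec_le Hi x).trans
      (mul_le_mul_of_nonneg_right hHi (Finset.sum_nonneg fun _ _ => sq_nonneg _))
  have hEv : ∀ v : b → ℝ, ∑ i, (E *ᵥ v) i ^ 2
      ≤ Fintype.card a * Fintype.card b * e ^ 2 * ∑ j, v j ^ 2 := by
    intro v
    have h1 : ∀ i, (E *ᵥ v) i ^ 2 ≤ e ^ 2 * (Fintype.card b * ∑ j, v j ^ 2) := by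
      intro i
      have h2 : |(E *ᵥ v) i| ≤ e * ∑ j, |v j| := abs_sum_mul_le (hE i) v
      calc (E *ᵥ v) i ^ 2 = |(E *ᵥ v) i| ^ 2 := (sq_abs _).symm
        _ ≤ (e * ∑ j, |v j|) ^ 2 := pow_le_pow_left₀ (abs_nonneg _) h2 2
        _ = e ^ 2 * (∑ j, |v j|) ^ 2 := by ring
        _ ≤ _ := mul_le_mul_of_nonneg_left (sum_abs_sq_le v) (sq_nonneg _)
    refine (Finset.sum_le_sum fun i _ => h1 i).trans (le_of_eq ?_)
    rw [Finset.sum_const, Finset.card_univ, nsmul_eq_mul]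
    ring
  -- `‖x‖² ≤ 2 ‖(1 + E H†) x‖² + 2 ‖E H† x‖²`, and the last term is at most half of `‖x‖²`.
  have key : ∀ x : a → ℝ, ∑ i, x i ^ 2 ≤ 4 * ∑ i, ((1 + E * Hi) *ᵥ x) i ^ 2 := by
    intro x
    set X := ∑ i, x i ^ 2 with hX
    have hX0 : 0 ≤ X := Finset.sum_nonneg fun _ _ => sq_nonneg _
    have h1 : ∑ i, (E *ᵥ (Hi *ᵥ x)) i ^ 2 ≤ X / 4 := by
      refine (hEv _).trans ?_
      have := mul_le_mul_of_nonneg_left (hHi' x)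
        (show (0 : ℝ) ≤ Fintype.card a * Fintype.card b * e ^ 2 by positivity)
      have h3 := mul_le_mul_of_nonneg_right hsmall hX0
      linarith
    have h2 : X ≤ ∑ i, (2 * ((1 + E * Hi) *ᵥ x) i ^ 2 + 2 * (E *ᵥ (Hi *ᵥ x)) i ^ 2) := by
      refine Finset.sum_le_sum fun i _ => ?_
      have : ((1 + E * Hi) *ᵥ x) i = x i + (E *ᵥ (Hi *ᵥ x)) i := by
        rw [Matrix.add_mulVec, Matrix.one_mulVec, Matrix.mulVec_mulVec, Pi.add_apply]
      rw [this]
      nlinarith [sq_nonneg (x i + 2 * (E *ᵥ (Hi *ᵥ x)) i)]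
    rw [Finset.sum_add_distrib, ← Finset.mul_sum, ← Finset.mul_sum] at h2
    linarith
  have hinj : Function.Injective (1 + E * Hi).mulVecLin := by
    rw [← LinearMap.ker_eq_bot, LinearMap.ker_eq_bot']
    intro x hx
    have h1 := key x
    rw [Matrix.mulVecLin_apply] at hx
    simp only [hx, Pi.zero_apply, ne_eq, OfNat.ofNat_ne_zero, not_false_eq_true, zero_pow,
      Finset.sum_const_zero, mul_zero] at h1
    funext i
    have h2 := (Finset.sum_eq_zero_iff_of_nonneg (fun i _ => sq_nonneg (x i))).1
      (le_antisymm h1 (Finset.sum_nonneg fun _ _ => sq_nonneg _)) i (Finset.mem_univ i)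
    simpa using h2
  obtain ⟨x, hx⟩ := (LinearMap.injective_iff_surjective.1 hinj) τ
  rw [Matrix.mulVecLin_apply] at hx
  refine ⟨Hi *ᵥ x, ?_, ?_⟩
  · rw [Matrix.mulVec_mulVec, Matrix.add_mul, hH, hx]
  · have hc : 0 ≤ c := (sq_nonneg _).trans hHi
    have := mul_le_mul_of_nonneg_left (key x) hc
    rw [hx] at this
    linarith [hHi' x]

end LinearAlgebra

/-! ### Positive definite quadratic forms -/

section QuadraticForm

variable {a : Type*} [Fintype a] {Q : Matrix a a ℝ}

lemma wsq_add (v w : a → ℝ) :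
    wsq Q (v + w) = wsq Q v + wsq Q w + (v ⬝ᵥ Q *ᵥ w + w ⬝ᵥ Q *ᵥ v) := by
  simp only [wsq, Matrix.mulVec_add, dotProduct_add, add_dotProduct]
  ring

lemma wsq_smul (s : ℝ) (v : a → ℝ) : wsq Q (s • v) = s ^ 2 * wsq Q v := by
  simp only [wsq, Matrix.mulVec_smul, dotProduct_smul, smul_dotProduct, smul_eq_mul]
  ring

lemma wsq_one [DecidableEq a] (v : a → ℝ) : wsq 1 v = ∑ i, v i ^ 2 := by
  simp [wsq, dotProduct, sq]

lemma continuous_wsq : Continuous (wsq Q) := by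
  unfold wsq
  fun_prop

lemma wsq_nonneg (hQ : Q.PosDef) (v : a → ℝ) : 0 ≤ wsq Q v := by
  simpa [wsq] using hQ.posSemidef.dotProduct_mulVec_nonneg v

lemma wsq_pos (hQ : Q.PosDef) {v : a → ℝ} (hv : v ≠ 0) : 0 < wsq Q v := by
  simpa [wsq] using hQ.dotProduct_mulVec_pos hv

/-- Young's inequality for a quadratic form. -/
lemma wsq_add_le (hQ : Q.PosDef) {θ : ℝ} (hθ : 0 < θ) (v w : a → ℝ) :
    wsq Q (v + w) ≤ (1 + θ) * wsq Q v + (1 + 1 / θ) * wsq Q w := by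
  have h := wsq_nonneg hQ (θ • v + (-1 : ℝ) • w)
  rw [wsq_add, wsq_smul, wsq_smul] at h
  simp only [Matrix.mulVec_smul, dotProduct_smul, smul_dotProduct, smul_eq_mul] at h
  rw [wsq_add]
  have h2 : v ⬝ᵥ Q *ᵥ w + w ⬝ᵥ Q *ᵥ v ≤ θ * wsq Q v + 1 / θ * wsq Q w := by
    have h3 : θ * (v ⬝ᵥ Q *ᵥ w + w ⬝ᵥ Q *ᵥ v) ≤ θ * (θ * wsq Q v + 1 / θ * wsq Q w) := by
      have : θ * (θ * wsq Q v + 1 / θ * wsq Q w) = θ ^ 2 * wsq Q v + wsq Q w := by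
        field_simp
      rw [this]
      nlinarith
    exact le_of_mul_le_mul_left h3 hθ
  linarith

lemma exists_wsq_lower (hQ : Q.PosDef) : ∃ c : ℝ, 0 < c ∧ ∀ v, c * ‖v‖ ^ 2 ≤ wsq Q v := by
  rcases (Metric.sphere (0 : a → ℝ) 1).eq_empty_or_nonempty with h | h
  · refine ⟨1, one_pos, fun v => ?_⟩
    have hv : v = 0 := by
      by_contra hv
      have : (‖v‖⁻¹ • v) ∈ Metric.sphere (0 : a → ℝ) 1 := by
        simp [norm_smul, norm_ne_zero_iff.2 hv]
      rw [h] at this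
      exact this
    simp [hv, wsq]
  · obtain ⟨v₀, hv₀, hmin⟩ := (isCompact_sphere (0 : a → ℝ) 1).exists_isMinOn h
      (continuous_wsq (Q := Q)).continuousOn
    have hne : v₀ ≠ 0 := by
      rintro rfl
      simp at hv₀
    refine ⟨wsq Q v₀, wsq_pos hQ hne, fun v => ?_⟩
    rcases eq_or_ne v 0 with rfl | hv
    · simp [wsq]
    have h1 : (‖v‖⁻¹ • v) ∈ Metric.sphere (0 : a → ℝ) 1 := by
      simp [norm_smul, norm_ne_zero_iff.2 hv]
    have h2 : wsq Q v₀ ≤ wsq Q (‖v‖⁻¹ • v) := hmin h1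
    have hv' : 0 < ‖v‖ := norm_pos_iff.2 hv
    rw [wsq_smul] at h2
    calc wsq Q v₀ * ‖v‖ ^ 2 ≤ (‖v‖⁻¹ ^ 2 * wsq Q v) * ‖v‖ ^ 2 :=
          mul_le_mul_of_nonneg_right h2 (sq_nonneg _)
      _ = wsq Q v := by field_simp

lemma exists_wsq_upper (Q : Matrix a a ℝ) : ∃ c : ℝ, 0 < c ∧ ∀ v, wsq Q v ≤ c * ‖v‖ ^ 2 := by
  refine ⟨Fintype.card a * matNormInf Q + 1, by positivity [matNormInf_nonneg Q], fun v => ?_⟩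
  have h1 : wsq Q v ≤ Fintype.card a * (‖v‖ * (matNormInf Q * ‖v‖)) := by
    rw [wsq, dotProduct]
    refine (Finset.sum_le_card_nsmul _ _ (‖v‖ * (matNormInf Q * ‖v‖)) fun i _ => ?_).trans ?_
    · refine (le_abs_self _).trans ?_
      rw [abs_mul]
      exact mul_le_mul (norm_le_pi_norm v i)
        ((norm_le_pi_norm (Q *ᵥ v) i).trans (norm_mulVec_le Q v)) (abs_nonneg _) (norm_nonneg _)
    · simp [Finset.card_univ]
  nlinarith [sq_nonneg ‖v‖]

end QuadraticForm

/-! ### The offline data -/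

section Data

variable {m n r : ℕ} {S : FLSystem m n}

/-- The basis functions and the data satisfy the standing assumptions, with error levels at most
`μ₀` and with excitation constant small relative to `1 / max εs ws`. -/
structure Regular (C : Controller S) (Ω : Set ((Fin m → ℝ) × (S.Idx → ℝ))) (B : ℝ≥0)
    (μ₀ cb : ℝ) (b : Basis S r) (D : Data m n) (εs ws : ℝ) : Prop where
  eps_pos : 0 < εs
  ws_nonneg : 0 ≤ ws
  small : max εs ws ≤ μ₀
  basis : b.Admissible Ω B εs
  data : ∃ cpe, D.Admissible C b Ω ws cpe ∧ cpe * max εs ws ≤ cb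

lemma Regular.mono {C : Controller S} {Ω : Set ((Fin m → ℝ) × (S.Idx → ℝ))} {B : ℝ≥0}
    {μ₀ cb μ₁ cb' : ℝ} {b : Basis S r} {D : Data m n} {εs ws : ℝ}
    (h : Regular C Ω B μ₀ cb b D εs ws) (h1 : μ₀ ≤ μ₁) (h2 : cb ≤ cb') :
    Regular C Ω B μ₁ cb' b D εs ws :=
  ⟨h.eps_pos, h.ws_nonneg, h.small.trans h1, h.basis,
    let ⟨c, hc, hc'⟩ := h.data; ⟨c, hc, hc'.trans h2⟩⟩

/-- The part of the synthetic input of the data that is not explained by the noisy basis functions. -/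
noncomputable def Data.resid (D : Data m n) (b : Basis S r) (k : ℕ) : Fin m → ℝ :=
  S.Phi (D.ud k) (S.T (D.xd k)) - b.G *ᵥ D.psi b k

namespace Basis.Admissible

variable {Ω : Set ((Fin m → ℝ) × (S.Idx → ℝ))} {B : ℝ≥0} {εs : ℝ} {b : Basis S r}

lemma Kw_nonneg (hb : b.Admissible Ω B εs) : 0 ≤ b.Kw := by
  by_contra h
  have h1 := hb.Kw_large
  nlinarith [matNormInf_nonneg (rightInv b.G)]

lemma KPsi_nonneg (hb : b.Admissible Ω B εs) {U : Set (Fin m → ℝ)} {ρ : ℝ} (hU : 0 ∈ U)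
    (hρ : 0 < ρ) (hΩ : U ×ˢ Metric.closedBall 0 ρ ⊆ Ω) : 0 ≤ b.KPsi := by
  have : Nonempty S.Idx := ⟨⟨⟨0, S.m_pos⟩, ⟨0, S.d_pos _⟩⟩⟩
  have h := hb.KPsi_lip 0 (fun _ => ρ) 0 (hΩ ⟨hU, by simp [abs_of_pos hρ]⟩)
    (hΩ ⟨hU, by simp [hρ.le]⟩)
  rw [sub_zero, pi_norm_const, Real.norm_of_nonneg hρ.le] at h
  exact nonneg_of_mul_nonneg_left ((norm_nonneg _).trans h) hρ

lemma mul_rightInv (hb : b.Admissible Ω B εs) : b.G * rightInv b.G = 1 :=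
  _root_.mul_rightInv (by rw [hb.G_rank, Fintype.card_fin])

lemma norm_psi_le (hb : b.Admissible Ω B εs) (h0 : ((0, 0) : (Fin m → ℝ) × (S.Idx → ℝ)) ∈ Ω)
    {u : Fin m → ℝ} {ξ : S.Idx → ℝ} (h : (u, ξ) ∈ Ω) : ‖b.Psi (u, ξ)‖ ≤ B * max ‖u‖ ‖ξ‖ := by
  have := hb.bound_lip.norm_sub_le h h0
  rwa [hb.psi_zero, sub_zero, Prod.norm_def, Prod.fst_sub, Prod.snd_sub, sub_zero, sub_zero] at this

end Basis.Admissible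

namespace Data.Admissible

variable {C : Controller S} {Ω : Set ((Fin m → ℝ) × (S.Idx → ℝ))} {B : ℝ≥0} {εs ws cpe : ℝ}
  {b : Basis S r} {D : Data m n}

lemma norm_stack_le (hD : D.Admissible C b Ω ws cpe) (hw : 0 ≤ ws) (k : ℕ) :
    ‖S.stack D.wd k‖ ≤ ws :=
  (pi_norm_le_iff_of_nonneg hw).2 fun p => (norm_le_pi_norm _ p.1).trans (hD.noise _)

/-- The residual of the data consists of the approximation error and of the effect of the noise. -/
lemma norm_resid_le (hb : b.Admissible Ω B εs) (hD : D.Admissible C b Ω ws cpe) (hw : 0 ≤ ws)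
    {k : ℕ} (hk : k < C.N) : ‖D.resid b k‖ ≤ εs + b.Kw * ws := by
  have h : D.resid b k = b.err (D.ud k) (D.xiNoisy S k)
      + b.delta (D.ud k) (S.T (D.xd k)) (S.stack D.wd k) := by
    simp only [resid, Basis.delta, Basis.err, Data.psi, Data.xiNoisy]
    abel
  rw [h]
  refine (norm_add_le _ _).trans (add_le_add (hb.err_le _ _ (hD.mem_noisy k hk)) ?_)
  exact (hb.Kw_le _ _ _ (hD.mem k hk) (hD.mem_noisy k hk)).trans
    (mul_le_mul_of_nonneg_left (hD.norm_stack_le hw k) hb.Kw_nonneg)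

lemma step_eq (hD : D.Admissible C b Ω ws cpe) :
    ∀ k < C.N, S.T (D.xd (k + 1)) = S.step (D.ud k) (S.T (D.xd k)) := fun k hk => by
  rw [hD.dyn k hk, S.T_f]

lemma T_eq (hD : D.Admissible C b Ω ws cpe) (k k' : ℕ) (hk : k ≤ C.N)
    (i : Fin m) (j : ℕ) (hj : j < S.d i) (hk' : k' + S.d i = k + j) :
    S.T (D.xd k) ⟨i, ⟨j, hj⟩⟩ = (b.G *ᵥ D.psi b k' + D.resid b k') i := by
  rw [FLSystem.traj_Phi (Ξ := fun k => S.T (D.xd k)) hD.step_eq k k' hk i j hj hk', resid]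
  simp

end Data.Admissible

/-- A coefficient vector for the windows that start `s` samples later: the vector is moved to the last
columns, so that sums over the columns only change by the shift `s`. -/
lemma exists_shift {q q' s : ℕ} (h : ∀ j < q', j + s < q) (α' : Fin q' → ℝ) :
    ∃ α : Fin q → ℝ, (∀ g : ℕ → ℝ, ∑ l : Fin q, g l * α l = ∑ j : Fin q', g (s + j) * α' j) ∧
      ∑ l, |α l| = ∑ j, |α' j| ∧ ∑ l, α l ^ 2 = ∑ j, α' j ^ 2 := by
  let φ : Fin q' → Fin q := fun j => ⟨j + s, h j j.2⟩
  have hφ : Function.Injective φ := fun i j hij => by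
    have := congrArg Fin.val hij
    exact Fin.ext (by simpa [φ] using this)
  refine ⟨Function.extend φ α' 0, fun g => ?_, ?_, ?_⟩ <;> symm
  · refine Fintype.sum_of_injective φ hφ _ _ (fun i hi => ?_) fun i => ?_
    · rw [Function.extend_apply' _ _ _ (by simpa using hi)]
      simp
    · rw [hφ.extend_apply]
      simp [φ, add_comm]
  · refine Fintype.sum_of_injective φ hφ _ _ (fun i hi => ?_) fun i => ?_
    · rw [Function.extend_apply' _ _ _ (by simpa using hi)]
      simp
    · rw [hφ.extend_apply]
  · refine Fintype.sum_of_injective φ hφ _ _ (fun i hi => ?_) fun i => ?_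
    · rw [Function.extend_apply' _ _ _ (by simpa using hi)]
      simp
    · rw [hφ.extend_apply]

/-! ### Trajectories as combinations of data windows -/

section Coefficients

variable {C : Controller S} {Ω : Set ((Fin m → ℝ) × (S.Idx → ℝ))} {B : ℝ≥0} {εs ws cpe : ℝ}
  {b : Basis S r} {D : Data m n}

/-- The basis function sequence of a trajectory, corrected by the approximation error such that `G`
maps it to the synthetic input, and preceded by `n` samples that generate the initial state. Sample
`n + k` belongs to time `k` of the trajectory; a sample `p < n` produces entry `p + dᵢ - n` of chain
`i` at time `0` if there is one. -/
noncomputable def target (b : Basis S r) (Ξ : ℕ → S.Idx → ℝ) (U : ℕ → Fin m → ℝ) (p : ℕ) :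
    Fin r → ℝ :=
  if n ≤ p then b.Psi (U (p - n), Ξ (p - n)) + rightInv b.G *ᵥ b.err (U (p - n)) (Ξ (p - n))
  else rightInv b.G *ᵥ fun i => if h : n ≤ p + S.d i ∧ p + S.d i - n < S.d i then
    Ξ 0 ⟨i, ⟨p + S.d i - n, h.2⟩⟩ else 0

lemma mulVec_target (hb : b.Admissible Ω B εs) {Ξ : ℕ → S.Idx → ℝ} {U : ℕ → Fin m → ℝ} {W : ℕ}
    (hΞ : ∀ k < W, Ξ (k + 1) = S.step (U k) (Ξ k)) (k p : ℕ) (hk : k ≤ W)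
    (i : Fin m) (j : ℕ) (hj : j < S.d i) (hp : p + S.d i = n + k + j) :
    (b.G *ᵥ target b Ξ U p) i = Ξ k ⟨i, ⟨j, hj⟩⟩ := by
  by_cases hnp : n ≤ p
  · rw [target, if_pos hnp, Matrix.mulVec_add, Matrix.mulVec_mulVec, hb.mul_rightInv,
      Matrix.one_mulVec, Basis.err, add_sub_cancel,
      FLSystem.traj_Phi hΞ k (p - n) hk i j hj (by omega)]
  · have hlt : k + j < S.d i := by omega
    have h1 := FLSystem.traj_shift hΞ 0 k (by omega) i j (by omega)
    rw [target, if_neg hnp, Matrix.mulVec_mulVec, hb.mul_rightInv, Matrix.one_mulVec,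
      dif_pos ⟨by omega, by omega⟩]
    rw [zero_add] at h1
    rw [h1]
    simp only [show p + S.d i - n = j + k by omega]

lemma norm_sq_target_le (hb : b.Admissible Ω B εs)
    (h0 : ((0, 0) : (Fin m → ℝ) × (S.Idx → ℝ)) ∈ Ω) {Ξ : ℕ → S.Idx → ℝ} {U : ℕ → Fin m → ℝ} {W : ℕ}
    (hΩ : ∀ k < W, (U k, Ξ k) ∈ Ω) (hW : 0 < W) (p : ℕ) (hp : p < W + n) :
    ‖target b Ξ U p‖ ^ 2 ≤
      2 * B ^ 2 * (∑ k ∈ Finset.range W, (‖U k‖ ^ 2 + ‖Ξ k‖ ^ 2) + εs ^ 2) := by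
  have hsum : ∀ k < W, ‖U k‖ ^ 2 + ‖Ξ k‖ ^ 2 ≤ ∑ k ∈ Finset.range W, (‖U k‖ ^ 2 + ‖Ξ k‖ ^ 2) :=
    fun k hk => Finset.single_le_sum (f := fun k => ‖U k‖ ^ 2 + ‖Ξ k‖ ^ 2)
      (fun _ _ => by positivity) (Finset.mem_range.2 hk)
  set T := ∑ k ∈ Finset.range W, (‖U k‖ ^ 2 + ‖Ξ k‖ ^ 2)
  have hB : (0 : ℝ) ≤ B := B.2
  by_cases hnp : n ≤ p
  · rw [target, if_pos hnp]
    set k := p - n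
    have hk : k < W := by omega
    have h1 := hb.norm_psi_le h0 (hΩ k hk)
    have h2 := norm_mulVec_le_of_le hb.bound_Ginv (hb.err_le _ _ (hΩ k hk))
    have h3 := (norm_add_le (b.Psi (U k, Ξ k)) (rightInv b.G *ᵥ b.err (U k) (Ξ k))).trans
      (add_le_add h1 h2)
    have h4 : max ‖U k‖ ‖Ξ k‖ ^ 2 ≤ ‖U k‖ ^ 2 + ‖Ξ k‖ ^ 2 := by
      rcases max_cases ‖U k‖ ‖Ξ k‖ with h | h <;> rw [h.1] <;> nlinarith [sq_nonneg ‖U k‖, sq_nonneg ‖Ξ k‖]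
    have h5 := pow_le_pow_left₀ (norm_nonneg _) h3 2
    have h6 := hsum k hk
    refine h5.trans ?_
    have h7 : (B * max ‖U k‖ ‖Ξ k‖ + B * εs) ^ 2 ≤ 2 * (B : ℝ) ^ 2 * (max ‖U k‖ ‖Ξ k‖ ^ 2 + εs ^ 2) := by
      nlinarith [mul_nonneg (sq_nonneg (B : ℝ)) (sq_nonneg (max ‖U k‖ ‖Ξ k‖ - εs))]
    refine h7.trans (mul_le_mul_of_nonneg_left ?_ (by positivity))
    linarith
  · rw [target, if_neg hnp]
    have h1 : ‖(fun i => if h : n ≤ p + S.d i ∧ p + S.d i - n < S.d i then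
        Ξ 0 ⟨i, ⟨p + S.d i - n, h.2⟩⟩ else 0 : Fin m → ℝ)‖ ≤ ‖Ξ 0‖ := by
      refine (pi_norm_le_iff_of_nonneg (norm_nonneg _)).2 fun i => ?_
      split_ifs
      · exact norm_le_pi_norm (Ξ 0) _
      · simp
    have h2 := pow_le_pow_left₀ (norm_nonneg _) (norm_mulVec_le_of_le hb.bound_Ginv h1) 2
    have h3 := hsum 0 hW
    refine h2.trans ?_
    rw [mul_pow, mul_assoc]
    nlinarith [mul_le_mul_of_nonneg_left h3 (sq_nonneg (B : ℝ)),
      mul_nonneg (sq_nonneg (B : ℝ)) (sq_nonneg εs),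
      mul_nonneg (sq_nonneg (B : ℝ)) (sq_nonneg ‖U 0‖),
      mul_nonneg (sq_nonneg (B : ℝ)) (sq_nonneg ‖Ξ 0‖)]

/-- Every trajectory is, up to errors that the slack variables can take up, a combination of the data
windows. Prescribing the basis function samples is enough: the excitation order exceeds the window
length by `n`, and `n` leading samples fill the chains of delays with the initial state, after which
the states of the window are determined by the synthetic inputs. So a right inverse of the Hankel
matrix of the basis functions, corrected for the residual of the data, gives the coefficients, and
no fundamental lemma for input-state data is required. -/
lemma exists_coefficients (hb : b.Admissible Ω B εs) (hD : D.Admissible C b Ω ws cpe)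
    (hw : 0 ≤ ws)
    (hsmall : Fintype.card (Fin (C.L + S.dmax + n) × Fin r)
      * Fintype.card (Fin (C.N + 1 - (C.L + S.dmax + n)))
      * ((B * (εs + b.Kw * ws)) ^ 2 * cpe) ≤ 1 / 4)
    {Ξ : ℕ → S.Idx → ℝ} {U : ℕ → Fin m → ℝ}
    (hΞ : ∀ k < C.L + S.dmax, Ξ (k + 1) = S.step (U k) (Ξ k)) :
    ∃ α : Fin (C.N + 1 - (C.L + S.dmax)) → ℝ,
      (∀ k < C.L + S.dmax, ∀ j, ∃ v : Fin m → ℝ, ‖v‖ ≤ (εs + b.Kw * ws) * ∑ l, |α l| ∧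
        ∑ l : Fin (C.N + 1 - (C.L + S.dmax)), D.psi b (k + l) j * α l =
          b.Psi (U k, Ξ k) j + (rightInv b.G *ᵥ (b.err (U k) (Ξ k) - v)) j) ∧
      (∀ k ≤ C.L + S.dmax, ∀ p,
        |∑ l : Fin (C.N + 1 - (C.L + S.dmax)), D.xiNoisy S (k + l) p * α l - Ξ k p|
          ≤ ws * ∑ l, |α l|) ∧
      ∑ l, α l ^ 2 ≤ 4 * cpe * ∑ p : Fin (C.L + S.dmax + n) × Fin r, target b Ξ U p.1 p.2 ^ 2 := by
  set q' := C.N + 1 - (C.L + S.dmax + n) with hq'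
  have hB : (0 : ℝ) ≤ B := B.2
  have hN : ∀ k < C.L + S.dmax + n, ∀ j < q', k + j < C.N := fun k hk j hj => by omega
  have hres : ∀ k < C.N, ‖D.resid b k‖ ≤ εs + b.Kw * ws := fun k hk =>
    Data.Admissible.norm_resid_le hb hD hw hk
  have hrank : (hankel (C.L + S.dmax + n) q' (D.psi b)).rank
      = Fintype.card (Fin (C.L + S.dmax + n) × Fin r) := by
    have := hD.pe
    rw [PersistentlyExciting] at this
    rw [this, Fintype.card_prod, mul_comm, Fintype.card_fin, Fintype.card_fin]
  -- `G` maps the blocks of `H + E` to the synthetic inputs of the data.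
  obtain ⟨α', hα', hnorm⟩ := exists_solution_of_perturbed
    (H := hankel (C.L + S.dmax + n) q' (D.psi b))
    (E := hankel (C.L + S.dmax + n) q' (fun k => rightInv b.G *ᵥ D.resid b k))
    (mul_rightInv hrank) hD.cpe_le (e := B * (εs + b.Kw * ws)) (fun i j => by
      refine (norm_le_pi_norm (rightInv b.G *ᵥ D.resid b (i.1 + j)) i.2).trans ?_
      exact norm_mulVec_le_of_le hb.bound_Ginv (hres _ (hN _ i.1.2 _ j.2)))
    hsmall (fun p => target b Ξ U p.1 p.2)
  obtain ⟨α, hα, habs, hsq⟩ := exists_shift (q := C.N + 1 - (C.L + S.dmax)) (s := n)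
    (fun j hj => by omega) α'
  have hrow : ∀ k < C.L + S.dmax + n, ∑ j : Fin q', α' j • (D.psi b (k + j)
      + rightInv b.G *ᵥ D.resid b (k + j)) = target b Ξ U k := by
    intro k hk
    funext i
    have h1 := congrFun hα' (⟨k, hk⟩, i)
    rw [← h1, Finset.sum_apply, Matrix.mulVec, dotProduct]
    refine Finset.sum_congr rfl fun j _ => ?_
    simp only [hankel, Matrix.add_apply, Pi.smul_apply, Pi.add_apply, smul_eq_mul]
    ring
  refine ⟨α, fun k hk j => ?_, fun k hk p => ?_, hsq ▸ hnorm⟩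
  · refine ⟨∑ l : Fin q', α' l • D.resid b (n + k + l), ?_, ?_⟩
    · rw [habs, Finset.mul_sum]
      refine (norm_sum_le _ _).trans (Finset.sum_le_sum fun l _ => ?_)
      rw [norm_smul, mul_comm, Real.norm_eq_abs]
      exact mul_le_mul_of_nonneg_right (hres _ (hN _ (by omega) _ l.2)) (abs_nonneg _)
    · rw [hα (fun l => D.psi b (k + l) j)]
      have h1 := hrow (n + k) (by omega)
      simp only [smul_add, Finset.sum_add_distrib] at h1
      have h2 := congrFun h1 j
      rw [target, if_pos (by omega), show n + k - n = k by omega, Pi.add_apply, Pi.add_apply,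
        Finset.sum_apply] at h2
      rw [Matrix.mulVec_sub, Matrix.mulVec_sum, Pi.sub_apply]
      simp only [Matrix.mulVec_smul]
      rw [← add_sub_assoc, ← h2, add_sub_cancel_right]
      refine Finset.sum_congr rfl fun l _ => ?_
      rw [Pi.smul_apply, smul_eq_mul, mul_comm, show k + (n + (l : ℕ)) = n + k + l by ring]
  · obtain ⟨i, j, hj⟩ := p
    have hd := S.d_le_n i
    rw [hα (fun l => D.xiNoisy S (k + l) ⟨i, ⟨j, hj⟩⟩)]
    obtain ⟨p, hp⟩ : ∃ p, p + S.d i = n + k + j := ⟨n + k + j - S.d i, by omega⟩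
    have h1 := mulVec_target hb hΞ k p hk i j hj hp
    rw [← hrow p (by omega), Matrix.mulVec_sum, Finset.sum_apply] at h1
    have h2 : ∀ l : Fin q', (b.G *ᵥ (α' l • (D.psi b (p + l) + rightInv b.G *ᵥ D.resid b (p + l)))) i
        = S.T (D.xd (k + (n + l))) ⟨i, ⟨j, hj⟩⟩ * α' l := by
      intro l
      rw [hD.T_eq (k + (n + l)) (p + l) (by have := l.2; omega) i j hj (by omega), Matrix.mulVec_smul,
        Matrix.mulVec_add, Matrix.mulVec_mulVec, hb.mul_rightInv, Matrix.one_mulVec, Pi.smul_apply,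
        smul_eq_mul, mul_comm]
    simp only [h2] at h1
    rw [← h1, ← Finset.sum_sub_distrib, habs]
    have h3 : ∀ l : Fin q', D.xiNoisy S (k + (n + l)) ⟨i, ⟨j, hj⟩⟩ * α' l
        - S.T (D.xd (k + (n + l))) ⟨i, ⟨j, hj⟩⟩ * α' l
        = S.stack D.wd (k + (n + l)) ⟨i, ⟨j, hj⟩⟩ * α' l := by
      intro l
      rw [Data.xiNoisy, Pi.add_apply]
      ring
    simp only [h3]
    exact abs_sum_mul_le (g := fun l : Fin q' => S.stack D.wd (k + (n + l)) ⟨i, ⟨j, hj⟩⟩)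
      (fun l => (norm_le_pi_norm (S.stack D.wd (k + (n + l))) _).trans (hD.norm_stack_le hw _)) α'

end Coefficients

end Data

/-! ### Feasible decisions from trajectories -/

section Candidate

variable {m n r : ℕ} {S : FLSystem m n} {C : Controller S}
  {Ω : Set ((Fin m → ℝ) × (S.Idx → ℝ))} {B : ℝ≥0} {εs ws : ℝ} {b : Basis S r} {D : Data m n}

lemma slackBound_nonneg {p : Problem S r} (hK : 0 ≤ p.b.KPsi) (hKw : 0 ≤ p.b.Kw) (hε : 0 ≤ p.εs)
    (hw : 0 ≤ p.ws) (α : Fin (p.C.N + 1 - (p.C.L + S.dmax)) → ℝ) : 0 ≤ p.slackBound α := by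
  have := matNormInf_nonneg (rightInv p.b.G)
  have h2 : 0 ≤ ∑ j, |α j| := Finset.sum_nonneg fun _ _ => abs_nonneg _
  unfold Problem.slackBound
  positivity

lemma slackBound_le (hb : b.Admissible Ω B εs) (hε : 0 ≤ εs) (hw : 0 ≤ ws) (lamA lamS : ℝ)
    (α : Fin (C.N + 1 - (C.L + S.dmax)) → ℝ) :
    (⟨C, b, D, εs, ws, lamA, lamS⟩ : Problem S r).slackBound α
      ≤ B * (2 + B) * (max εs ws * (1 + ∑ j, |α j|)) := by
  have hB : (0 : ℝ) ≤ B := B.2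
  have hG := matNormInf_nonneg (rightInv b.G)
  have h2 : 0 ≤ ∑ j, |α j| := Finset.sum_nonneg fun _ _ => abs_nonneg _
  have hμ : 0 ≤ max εs ws := le_max_of_le_left hε
  simp only [Problem.slackBound]
  set a := ∑ j, |α j|
  set μ := max εs ws
  have h3 : b.KPsi * ws ≤ B * (μ * (1 + a)) := by
    calc b.KPsi * ws ≤ B * μ := mul_le_mul hb.bound_KPsi (le_max_right _ _) hw hB
      _ ≤ B * (μ * (1 + a)) := by
        refine mul_le_mul_of_nonneg_left ?_ hB
        nlinarith
  have h4 : εs + b.Kw * ws ≤ (1 + B) * μ := by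
    have : b.Kw * ws ≤ B * μ := mul_le_mul hb.bound_Kw (le_max_right _ _) hw hB
    linarith [le_max_left εs ws]
  have h5 : 0 ≤ εs + b.Kw * ws := add_nonneg hε (mul_nonneg hb.Kw_nonneg hw)
  have h6 : (εs + b.Kw * ws) * matNormInf (rightInv b.G) * (1 + a) ≤ (1 + B) * μ * B * (1 + a) :=
    mul_le_mul_of_nonneg_right (mul_le_mul h4 hb.bound_Ginv hG (by positivity)) (by positivity)
  calc _ ≤ B * (μ * (1 + a)) + (1 + B) * μ * B * (1 + a) := add_le_add h3 h6
    _ = _ := by ring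

/-- The squared slack bound: apart from `μ²`, it is a multiple of `μ` times the regularization
`μ ‖α‖₂²` that the cost contains. -/
lemma sq_error_le {ι : Type*} [Fintype ι] (μ : ℝ) (α : ι → ℝ) :
    (μ * (1 + ∑ j, |α j|)) ^ 2 ≤ 2 * μ ^ 2 + 2 * Fintype.card ι * (μ * (μ * ∑ j, α j ^ 2)) := by
  have h := sum_abs_sq_le α
  set a := ∑ j, |α j|
  set A := ∑ j, α j ^ 2
  have h1 : (1 + a) ^ 2 ≤ 2 + 2 * (Fintype.card ι * A) := by nlinarith [sq_nonneg (1 - a)]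
  calc (μ * (1 + a)) ^ 2 = μ ^ 2 * (1 + a) ^ 2 := by ring
    _ ≤ μ ^ 2 * (2 + 2 * (Fintype.card ι * A)) := mul_le_mul_of_nonneg_left h1 (sq_nonneg _)
    _ = _ := by ring

/-- Decision that predicts the outputs of a given trajectory `Ξ` with inputs `U`; index `0` of the
trajectory is the prediction time `-dmax`. Past outputs are the measured ones, and the slack variables
are whatever the Hankel equations require. -/
noncomputable def candidate (C : Controller S) (b : Basis S r) (D : Data m n) (yt : ℤ → Fin m → ℝ)
    (t : ℤ) (Ξ : ℕ → S.Idx → ℝ) (U : ℕ → Fin m → ℝ) (α : Fin (C.N + 1 - (C.L + S.dmax)) → ℝ) :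
    Decision S r C :=
  let y : ℤ → Fin m → ℝ := fun k =>
    if k < 0 then yt (t + k) else if k < C.L then S.out (Ξ (k + S.dmax).toNat) else 0
  { u := fun k => U (k + S.dmax).toNat
    y := y
    α := α
    σΨ := fun k j => ∑ l : Fin (C.N + 1 - (C.L + S.dmax)), D.psi b (k + l) j * α l -
      b.Psi (U k, S.stack y ((k : ℤ) - S.dmax)) j
    σΞ := fun k p => ∑ l : Fin (C.N + 1 - (C.L + S.dmax)), D.xiNoisy S (k + l) p * α l -
      S.stack y ((k : ℤ) - S.dmax) p }

/-- The predicted states differ from the trajectory only by the past measurement noise. That the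
trajectory ends at the origin makes the zero outputs beyond the horizon correct. -/
lemma norm_stack_candidate_sub_le {yt : ℤ → Fin m → ℝ} {t : ℤ} {Ξ : ℕ → S.Idx → ℝ}
    {U : ℕ → Fin m → ℝ} {α : Fin (C.N + 1 - (C.L + S.dmax)) → ℝ} (hw : 0 ≤ ws)
    (hΞ : ∀ k < C.L + S.dmax, Ξ (k + 1) = S.step (U k) (Ξ k)) (hend : Ξ (C.L + S.dmax) = 0)
    (hy : ∀ k < S.dmax, ‖S.out (Ξ k) - yt (t - S.dmax + k)‖ ≤ ws) (k : ℕ)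
    (hk : k ≤ C.L + S.dmax) :
    ‖S.stack (candidate C b D yt t Ξ U α).y ((k : ℤ) - S.dmax) - Ξ k‖ ≤ ws := by
  refine (pi_norm_le_iff_of_nonneg hw).2 ?_
  rintro ⟨i, j, hj⟩
  rw [Pi.sub_apply]
  simp only [FLSystem.stack, candidate]
  have hdi := S.d_le_dmax i
  by_cases hW : k + j < C.L + S.dmax
  · have h1 := FLSystem.traj_shift hΞ k j (by omega) i 0 (by omega)
    simp only [Nat.zero_add] at h1
    by_cases hd : k + j < S.dmax
    · rw [if_pos (by omega), ← h1, norm_sub_rev]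
      have := (norm_le_pi_norm (S.out (Ξ (k + j)) - yt (t - S.dmax + (k + j : ℕ))) i).trans
        (hy (k + j) hd)
      rw [Pi.sub_apply] at this
      rw [show t + ((k : ℤ) - S.dmax + (j : ℕ)) = t - S.dmax + (k + j : ℕ) by push_cast; ring]
      exact this
    · rw [if_neg (by omega), if_pos (by omega),
        show ((k : ℤ) - S.dmax + (j : ℕ) + S.dmax).toNat = k + j by omega, ← h1]
      simp [FLSystem.out, hw]
  · rw [if_neg (by omega), if_neg (by omega)]
    obtain ⟨l, hl⟩ : ∃ l, k + l = C.L + S.dmax := ⟨C.L + S.dmax - k, by omega⟩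
    have h1 := FLSystem.traj_shift hΞ k l hl.le i (j - l) (by omega)
    rw [hl, hend] at h1
    simp only [show j - l + l = j by omega] at h1
    rw [← h1]
    simpa using hw

lemma candidate_feasible {ρ : ℝ} (hρ : 0 < ρ) (hΩρ : C.U ×ˢ Metric.closedBall 0 ρ ⊆ Ω) (lamA lamS : ℝ)
    (hε : 0 ≤ εs) (hw : 0 ≤ ws) (hb : b.Admissible Ω B εs)
    {u yt : ℤ → Fin m → ℝ} {t : ℤ} {Ξ : ℕ → S.Idx → ℝ} {U : ℕ → Fin m → ℝ}
    (hΞ : ∀ k < C.L + S.dmax, Ξ (k + 1) = S.step (U k) (Ξ k)) (hend : Ξ (C.L + S.dmax) = 0)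
    (hU : ∀ k < C.L + S.dmax, U k ∈ C.U) (hball : ∀ k ≤ C.L + S.dmax, ‖Ξ k‖ + ws ≤ ρ)
    (hu : ∀ k < S.dmax, U k = u (t - S.dmax + k))
    (hy : ∀ k < S.dmax, ‖S.out (Ξ k) - yt (t - S.dmax + k)‖ ≤ ws)
    {α : Fin (C.N + 1 - (C.L + S.dmax)) → ℝ}
    (hαΨ : ∀ k < C.L + S.dmax, ∀ j, ∃ v : Fin m → ℝ, ‖v‖ ≤ (εs + b.Kw * ws) * ∑ l, |α l| ∧
        ∑ l : Fin (C.N + 1 - (C.L + S.dmax)), D.psi b (k + l) j * α l =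
          b.Psi (U k, Ξ k) j + (rightInv b.G *ᵥ (b.err (U k) (Ξ k) - v)) j)
    (hαΞ : ∀ k ≤ C.L + S.dmax, ∀ p,
        |∑ l : Fin (C.N + 1 - (C.L + S.dmax)), D.xiNoisy S (k + l) p * α l - Ξ k p|
          ≤ ws * ∑ l, |α l|) :
    (⟨C, b, D, εs, ws, lamA, lamS⟩ : Problem S r).Feasible u yt t (candidate C b D yt t Ξ U α) := by
  have hU0 : (0 : Fin m → ℝ) ∈ C.U := interior_subset C.U_zero
  have hKPsi := hb.KPsi_nonneg hU0 hρ hΩρ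
  have hG0 := matNormInf_nonneg (rightInv b.G)
  have hΩk : ∀ k < C.L + S.dmax, (U k, Ξ k) ∈ Ω := fun k hk =>
    hΩρ ⟨hU k hk, mem_closedBall_zero_iff.2 (by linarith [hball k hk.le])⟩
  have ha0 : 0 ≤ ∑ l, |α l| := Finset.sum_nonneg fun _ _ => abs_nonneg _
  have hstack := fun k hk => norm_stack_candidate_sub_le (b := b) (D := D) (α := α) hw hΞ hend hy k hk
  have hslack0 := slackBound_nonneg (p := (⟨C, b, D, εs, ws, lamA, lamS⟩ : Problem S r))
    hKPsi hb.Kw_nonneg hε hw α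
  refine ⟨fun k j => ?_, fun k j => ?_, fun k hk hk' => ⟨?_, ?_⟩, fun i k hk => ?_,
    fun k => ?_, fun k => ?_, fun k hk hk' => ?_⟩
  · have : (candidate C b D yt t Ξ U α).u ((k : ℤ) - S.dmax) = U k := by
      simp [candidate]
    rw [this]
    simp only [candidate, Matrix.mulVec, dotProduct, hankel]
    ring
  · simp only [candidate, Matrix.mulVec, dotProduct, hankel]
    ring
  · have h1 := hu (k + S.dmax).toNat (by omega)
    simp only [candidate]
    rw [h1]
    congr 1
    omega
  · simp only [candidate, if_pos hk']
  · simp only [candidate]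
    rw [if_neg (by omega), if_neg (by omega), Pi.zero_apply]
  · refine (pi_norm_le_iff_of_nonneg hslack0).2 fun j => ?_
    obtain ⟨v, hv, hvj⟩ := hαΨ k k.2 j
    have hsk := hstack k k.2.le
    set ξ := S.stack (candidate C b D yt t Ξ U α).y ((k : ℤ) - S.dmax) with hξ
    have hmem : (U k, ξ) ∈ Ω := by
      refine hΩρ ⟨hU k k.2, mem_closedBall_zero_iff.2 ?_⟩
      have h1 : ‖ξ‖ ≤ ‖Ξ k‖ + ‖ξ - Ξ k‖ := norm_le_norm_add_norm_sub' ξ (Ξ k)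
      linarith [hball k k.2.le]
    have h1 := (norm_le_pi_norm _ j).trans (hb.KPsi_lip _ _ _ (hΩk k k.2) hmem)
    rw [norm_sub_rev] at hsk
    have h2 := h1.trans (mul_le_mul_of_nonneg_left hsk hKPsi)
    have h3 : ‖b.err (U k) (Ξ k) - v‖ ≤ (εs + b.Kw * ws) * (1 + ∑ l, |α l|) := by
      refine (norm_sub_le _ _).trans ?_
      have h4 := hb.err_le _ _ (hΩk k k.2)
      have h5 := mul_nonneg hb.Kw_nonneg hw
      linarith
    have h4 := (norm_le_pi_norm _ j).trans
      (norm_mulVec_le_of_le (le_refl (matNormInf (rightInv b.G))) h3)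
    have h5 : (candidate C b D yt t Ξ U α).σΨ k j = (b.Psi (U k, Ξ k) - b.Psi (U k, ξ)) j
        + (rightInv b.G *ᵥ (b.err (U k) (Ξ k) - v)) j := by
      have : (candidate C b D yt t Ξ U α).σΨ k j =
        ∑ l : Fin (C.N + 1 - (C.L + S.dmax)), D.psi b (k + l) j * α l - b.Psi (U k, ξ) j := rfl
      rw [this, hvj, Pi.sub_apply]
      ring
    rw [h5]
    refine (norm_add_le _ _).trans ((add_le_add h2 h4).trans (le_of_eq ?_))
    simp only [Problem.slackBound]
    ring
  · refine (pi_norm_le_iff_of_nonneg hslack0).2 fun p => ?_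
    have hk : (k : ℕ) ≤ C.L + S.dmax := Nat.lt_succ_iff.1 k.2
    have h1 := hαΞ k hk p
    have h0 := hstack k hk
    rw [norm_sub_rev] at h0
    have h2 := (norm_le_pi_norm _ p).trans h0
    rw [Pi.sub_apply] at h2
    have h5 : (candidate C b D yt t Ξ U α).σΞ k p =
        (∑ l : Fin (C.N + 1 - (C.L + S.dmax)), D.xiNoisy S (k + l) p * α l - Ξ k p)
        + (Ξ k p - S.stack (candidate C b D yt t Ξ U α).y ((k : ℤ) - S.dmax) p) := by
      simp only [candidate]
      ring
    rw [h5]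
    refine (norm_add_le _ _).trans ((add_le_add h1 h2).trans ?_)
    simp only [Problem.slackBound]
    -- `1 ≤ Kw * ‖G†‖` leaves room for the output noise in the slack bound.
    have h6 : 1 * (ws * (1 + ∑ l, |α l|)) ≤
        (b.Kw * matNormInf (rightInv b.G)) * (ws * (1 + ∑ l, |α l|)) :=
      mul_le_mul_of_nonneg_right hb.Kw_large (by positivity)
    have h7 : 0 ≤ εs * matNormInf (rightInv b.G) * (1 + ∑ l, |α l|) := by positivity
    have h8 : 0 ≤ b.KPsi * ws := by positivity
    linarith
  · exact hU _ (by simp only at hk'; omega)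

/-- The slack bound makes the cost of the slack variables comparable to that of `α`. -/
lemma cost_le_of_slack (hb : b.Admissible Ω B εs) (hε : 0 ≤ εs) (hw : 0 ≤ ws) (hμ1 : max εs ws ≤ 1)
    (lamA : ℝ) {lamS : ℝ} (hlamS : 0 ≤ lamS) {z : Decision S r C}
    (hΨ : ∀ k, ‖z.σΨ k‖ ≤ (⟨C, b, D, εs, ws, lamA, lamS⟩ : Problem S r).slackBound z.α)
    (hΞ : ∀ k, ‖z.σΞ k‖ ≤ (⟨C, b, D, εs, ws, lamA, lamS⟩ : Problem S r).slackBound z.α) {K2 : ℝ}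
    (hK2 : K2 = ((C.L + S.dmax : ℕ) * r + (C.L + S.dmax + 1 : ℕ) * n) * (B * (2 + B)) ^ 2) :
    (⟨C, b, D, εs, ws, lamA, lamS⟩ : Problem S r).cost z ≤
      ∑ k ∈ Finset.range C.L, (wsq C.R (z.u k) + wsq C.Q (z.y k)) +
      (lamA + lamS * K2 * (2 * Fintype.card (Fin (C.N + 1 - (C.L + S.dmax))))) *
        (max εs ws * ∑ j, z.α j ^ 2) + lamS * K2 * 2 * max εs ws ^ 2 := by
  have hB : (0 : ℝ) ≤ B := B.2
  set sb := (⟨C, b, D, εs, ws, lamA, lamS⟩ : Problem S r).slackBound z.α with hsb0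
  have hσΨ : ∑ k, ∑ j, z.σΨ k j ^ 2 ≤ (C.L + S.dmax : ℕ) * (r * sb ^ 2) := by
    refine (Finset.sum_le_card_nsmul _ _ _ fun k _ => (sum_sq_le_card_mul _).trans
      (mul_le_mul_of_nonneg_left (pow_le_pow_left₀ (norm_nonneg _) (hΨ k) 2)
        (by positivity))).trans (le_of_eq ?_)
    rw [Finset.card_univ, nsmul_eq_mul, Fintype.card_fin, Fintype.card_fin]
  have hσΞ : ∑ k, ∑ j, z.σΞ k j ^ 2 ≤ (C.L + S.dmax + 1 : ℕ) * (n * sb ^ 2) := by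
    refine (Finset.sum_le_card_nsmul _ _ _ fun k _ => (sum_sq_le_card_mul _).trans
      (mul_le_mul_of_nonneg_left (pow_le_pow_left₀ (norm_nonneg _) (hΞ k) 2)
        (by positivity))).trans (le_of_eq ?_)
    rw [Finset.card_univ, nsmul_eq_mul, Fintype.card_fin, S.card_Idx]
  have hsb := pow_le_pow_left₀ ((norm_nonneg _).trans (hΞ 0))
    (slackBound_le (C := C) (D := D) hb hε hw lamA lamS z.α) 2
  have hμ0 : 0 ≤ max εs ws := le_max_of_le_left hε
  have hμA : max εs ws * (max εs ws * ∑ j, z.α j ^ 2) ≤ max εs ws * ∑ j, z.α j ^ 2 :=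
    mul_le_of_le_one_left (mul_nonneg hμ0 (Finset.sum_nonneg fun _ _ => sq_nonneg _)) hμ1
  have hse := (sq_error_le (max εs ws) z.α).trans (add_le_add le_rfl
    (mul_le_mul_of_nonneg_left hμA (by positivity)))
  rw [mul_pow] at hsb
  set μ := max εs ws
  set q : ℝ := (Fintype.card (Fin (C.N + 1 - (C.L + S.dmax))) : ℝ)
  set A := ∑ l, z.α l ^ 2 with hA
  have hσ : ∑ k, ∑ j, z.σΨ k j ^ 2 + ∑ k, ∑ j, z.σΞ k j ^ 2
      ≤ K2 * (2 * μ ^ 2 + 2 * q * (μ * A)) := by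
    calc _ ≤ ((C.L + S.dmax : ℕ) * r + (C.L + S.dmax + 1 : ℕ) * n) * sb ^ 2 :=
          (add_le_add hσΨ hσΞ).trans (le_of_eq (by ring))
      _ ≤ ((C.L + S.dmax : ℕ) * r + (C.L + S.dmax + 1 : ℕ) * n) *
            ((B * (2 + B)) ^ 2 * (2 * μ ^ 2 + 2 * q * (μ * A))) :=
        mul_le_mul_of_nonneg_left (hsb.trans (mul_le_mul_of_nonneg_left hse (sq_nonneg _)))
          (by positivity)
      _ = _ := by rw [hK2]; ring
  have hcost : (⟨C, b, D, εs, ws, lamA, lamS⟩ : Problem S r).cost z =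
      ∑ k ∈ Finset.range C.L, (wsq C.R (z.u k) + wsq C.Q (z.y k)) + lamA * μ * A
      + lamS * (∑ k, ∑ j, z.σΨ k j ^ 2 + ∑ k, ∑ j, z.σΞ k j ^ 2) := rfl
  rw [hcost]
  have := mul_le_mul_of_nonneg_left hσ hlamS
  linarith

lemma sum_sq_target_le (hb : b.Admissible Ω B εs) (hε : 0 ≤ εs)
    (h0 : ((0, 0) : (Fin m → ℝ) × (S.Idx → ℝ)) ∈ Ω) {Ξ : ℕ → S.Idx → ℝ} {U : ℕ → Fin m → ℝ} {W : ℕ}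
    (hΩ : ∀ k < W, (U k, Ξ k) ∈ Ω) (hW : 0 < W) :
    ∑ p : Fin (W + n) × Fin r, target b Ξ U p.1 p.2 ^ 2 ≤
      Fintype.card (Fin (W + n)) * r * (2 * B ^ 2) *
        (∑ k ∈ Finset.range W, (‖U k‖ ^ 2 + ‖Ξ k‖ ^ 2) + max εs ws ^ 2) := by
  rw [Fintype.sum_prod_type]
  refine (Finset.sum_le_card_nsmul _ _ (r * (2 * B ^ 2 *
    (∑ k ∈ Finset.range W, (‖U k‖ ^ 2 + ‖Ξ k‖ ^ 2) + max εs ws ^ 2))) fun k _ =>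
    (sum_sq_le_card_mul _).trans ?_).trans (le_of_eq ?_)
  · rw [Fintype.card_fin]
    refine mul_le_mul_of_nonneg_left ((norm_sq_target_le hb h0 hΩ hW k k.2).trans ?_)
      (by positivity)
    have : εs ^ 2 ≤ max εs ws ^ 2 := pow_le_pow_left₀ hε (le_max_left _ _) 2
    gcongr
  · rw [Finset.card_univ, nsmul_eq_mul]
    ring

/-- Elimination of `α` from the cost of a candidate. -/
lemma cost_bound_of_coefficients {Kα K1 Kσ cb T μ A cpe τ st c : ℝ}
    (hcost : c ≤ st + Kα * (μ * A) + Kσ * μ ^ 2) (hα : A ≤ 4 * cpe * τ) (hτ : τ ≤ K1 * (T + μ ^ 2))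
    (hcpe : cpe * μ ≤ cb) (hcb : cb ≤ 1) (hKα : 0 ≤ Kα) (hK1 : 0 ≤ K1) (hKσ : 0 ≤ Kσ)
    (hcpe0 : 0 ≤ cpe) (hcb0 : 0 ≤ cb) (hT : 0 ≤ T) (hμ : 0 ≤ μ) :
    c ≤ st + (Kα * (4 * K1) + Kσ + 1) * cb * T + (Kα * (4 * K1) + Kσ + 1) * μ ^ 2 := by
  have hμA : μ * A ≤ cb * (4 * K1 * (T + μ ^ 2)) := by
    calc μ * A ≤ μ * (4 * cpe * (K1 * (T + μ ^ 2))) :=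
          mul_le_mul_of_nonneg_left (hα.trans (mul_le_mul_of_nonneg_left hτ (by positivity))) hμ
      _ = (cpe * μ) * (4 * K1 * (T + μ ^ 2)) := by ring
      _ ≤ _ := mul_le_mul_of_nonneg_right hcpe (by positivity)
  have h2 : Kα * (μ * A) ≤ Kα * (4 * K1) * cb * T + Kα * (4 * K1) * μ ^ 2 := by
    have h3 := mul_le_mul_of_nonneg_left hμA hKα
    have h4 : Kα * (4 * K1) * μ ^ 2 * cb ≤ Kα * (4 * K1) * μ ^ 2 * 1 :=
      mul_le_mul_of_nonneg_left hcb (by positivity)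
    linarith
  have h5 : 0 ≤ (Kσ + 1) * cb * T := by positivity
  have h6 := sq_nonneg μ
  linarith

/-- A trajectory that contains the past data, respects the constraints and ends at the origin is
matched by a feasible decision, whose cost exceeds the stage costs of the trajectory by a small multiple
of its energy (proportional to `cb`, the bound on `cpe * max εs ws`) and a multiple of the squared error
level. -/
lemma exists_feasible_of_trajectory (C : Controller S) {ρ : ℝ} (hρ : 0 < ρ)
    (hΩρ : C.U ×ˢ Metric.closedBall 0 ρ ⊆ Ω) (B : ℝ≥0) (r : ℕ) {lamA lamS : ℝ} (hlamA : 0 < lamA)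
    (hlamS : 0 < lamS) :
    ∃ K : ℝ, 0 < K ∧ ∃ μ₀ : ℝ, 0 < μ₀ ∧ ∀ (cb : ℝ), cb ≤ 1 → ∀ (b : Basis S r) (D : Data m n)
      (εs ws : ℝ), Regular C Ω B μ₀ cb b D εs ws →
      ∀ (u yt : ℤ → Fin m → ℝ) (t : ℤ) (Ξ : ℕ → S.Idx → ℝ) (U : ℕ → Fin m → ℝ),
      (∀ k < C.L + S.dmax, Ξ (k + 1) = S.step (U k) (Ξ k)) → Ξ (C.L + S.dmax) = 0 →
      (∀ k < C.L + S.dmax, U k ∈ C.U) → (∀ k ≤ C.L + S.dmax, ‖Ξ k‖ + ws ≤ ρ) →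
      (∀ k < S.dmax, U k = u (t - S.dmax + k)) →
      (∀ k < S.dmax, ‖S.out (Ξ k) - yt (t - S.dmax + k)‖ ≤ ws) →
      ∃ z, (⟨C, b, D, εs, ws, lamA, lamS⟩ : Problem S r).Feasible u yt t z ∧
        (⟨C, b, D, εs, ws, lamA, lamS⟩ : Problem S r).cost z ≤
          ∑ k ∈ Finset.range C.L, (wsq C.R (U (k + S.dmax)) + wsq C.Q (S.out (Ξ (k + S.dmax)))) +
          K * cb * ∑ k ∈ Finset.range (C.L + S.dmax), (‖U k‖ ^ 2 + ‖Ξ k‖ ^ 2) +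
          K * max εs ws ^ 2 := by
  have hB : (0 : ℝ) ≤ B := B.2
  set X : ℝ := Fintype.card (Fin (C.L + S.dmax + n) × Fin r)
      * Fintype.card (Fin (C.N + 1 - (C.L + S.dmax + n))) * (B * (1 + B)) ^ 2 with hX
  have hX0 : 0 ≤ X := by positivity
  set K1 : ℝ := Fintype.card (Fin (C.L + S.dmax + n)) * r * (2 * B ^ 2) with hK1
  have hK10 : 0 ≤ K1 := by positivity
  set q : ℝ := (Fintype.card (Fin (C.N + 1 - (C.L + S.dmax))) : ℝ) with hq
  have hq0 : 0 ≤ q := by positivity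
  set K2 : ℝ := ((C.L + S.dmax : ℕ) * r + (C.L + S.dmax + 1 : ℕ) * n) * (B * (2 + B)) ^ 2 with hK2
  have hK20 : 0 ≤ K2 := by positivity
  set Kα : ℝ := (lamA + lamS * K2 * (2 * q)) with hKα
  have hKα0 : 0 ≤ Kα := by positivity
  refine ⟨Kα * (4 * K1) + lamS * K2 * 2 + 1, by positivity, min 1 (1 / (4 * X + 4)), by positivity, ?_⟩
  intro cb hcb b D εs ws hreg u yt t Ξ U hΞ hend hU hball hu hy
  obtain ⟨hε, hw, hμ, hb, cpe, hD, hcpe⟩ := hreg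
  set μ := max εs ws with hμdef
  have hμ0 : 0 < μ := lt_max_of_lt_left hε
  have hμ1 : μ ≤ 1 := hμ.trans (min_le_left _ _)
  have hcpe0 : 0 ≤ cpe := (sq_nonneg _).trans hD.cpe_le
  have hcb0 : 0 ≤ cb := (mul_nonneg hcpe0 hμ0.le).trans hcpe
  have hU0 : (0 : Fin m → ℝ) ∈ C.U := interior_subset C.U_zero
  have h00 : ((0, 0) : (Fin m → ℝ) × (S.Idx → ℝ)) ∈ Ω := hΩρ ⟨hU0, by simp [hρ.le]⟩
  have he0 : 0 ≤ εs + b.Kw * ws := add_nonneg hε.le (mul_nonneg hb.Kw_nonneg hw)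
  have he : εs + b.Kw * ws ≤ (1 + B) * μ := by
    have : b.Kw * ws ≤ B * μ := mul_le_mul hb.bound_Kw (le_max_right _ _) hw hB
    linarith [le_max_left εs ws]
  have hXμ : X * μ ≤ 1 / 4 := by
    have h1 : μ ≤ 1 / (4 * X + 4) := hμ.trans (min_le_right _ _)
    rw [le_div_iff₀ (by positivity)] at h1
    nlinarith
  have hsmall : Fintype.card (Fin (C.L + S.dmax + n) × Fin r)
      * Fintype.card (Fin (C.N + 1 - (C.L + S.dmax + n)))
      * ((B * (εs + b.Kw * ws)) ^ 2 * cpe) ≤ (1 / 4 : ℝ) := by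
    have h1 : (B * (εs + b.Kw * ws)) ^ 2 * cpe ≤ (B * (1 + B)) ^ 2 * μ := by
      calc (B * (εs + b.Kw * ws)) ^ 2 * cpe ≤ (B * ((1 + B) * μ)) ^ 2 * cpe := by gcongr
        _ = (B * (1 + B)) ^ 2 * μ * (cpe * μ) := by ring
        _ ≤ (B * (1 + B)) ^ 2 * μ * 1 :=
          mul_le_mul_of_nonneg_left (hcpe.trans hcb) (by positivity)
        _ = _ := mul_one _
    refine (mul_le_mul_of_nonneg_left h1 (by positivity)).trans ?_
    rw [← mul_assoc]
    exact hXμ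
  have hΩk : ∀ k < C.L + S.dmax, (U k, Ξ k) ∈ Ω := fun k hk =>
    hΩρ ⟨hU k hk, mem_closedBall_zero_iff.2 (by linarith [hball k hk.le])⟩
  obtain ⟨α, hαΨ, hαΞ, hα⟩ := exists_coefficients hb hD hw hsmall hΞ
  have hfeas := candidate_feasible (D := D) hρ hΩρ lamA lamS hε.le hw hb hΞ hend hU hball hu hy hαΨ hαΞ
  have hcost := cost_le_of_slack (D := D) hb hε.le hw hμ1 lamA hlamS.le hfeas.slack_psi
    hfeas.slack_xi hK2
  have hstage : ∑ k ∈ Finset.range C.L, (wsq C.R ((candidate C b D yt t Ξ U α).u k)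
        + wsq C.Q ((candidate C b D yt t Ξ U α).y k)) =
      ∑ k ∈ Finset.range C.L, (wsq C.R (U (k + S.dmax)) + wsq C.Q (S.out (Ξ (k + S.dmax)))) := by
    refine Finset.sum_congr rfl fun k hk => ?_
    have hk' := Finset.mem_range.1 hk
    simp only [candidate]
    rw [if_neg (by omega), if_pos (by omega), show ((k : ℤ) + S.dmax).toNat = k + S.dmax by omega]
  have hzα : ∑ j, (candidate C b D yt t Ξ U α).α j ^ 2 = ∑ l, α l ^ 2 := rfl
  rw [hzα, hstage, ← hq, ← hKα, ← hμdef] at hcost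
  have hτ := sum_sq_target_le (ws := ws) hb hε.le h00 hΩk (by have := S.dmax_pos; omega)
  exact ⟨_, hfeas, cost_bound_of_coefficients hcost hα hτ hcpe hcb hKα0 hK10 (by positivity) hcpe0 hcb0
    (Finset.sum_nonneg fun _ _ => by positivity) hμ0.le⟩

end Candidate

/-! ### Completion of trajectories by deadbeat control -/

section Deadbeat

variable {m n r : ℕ} {S : FLSystem m n} {C : Controller S}
  {Ω : Set ((Fin m → ℝ) × (S.Idx → ℝ))} {B : ℝ≥0}

lemma Regular.cb_nonneg {μ₀ cb εs ws : ℝ} {b : Basis S r} {D : Data m n}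
    (h : Regular C Ω B μ₀ cb b D εs ws) : 0 ≤ cb := by
  obtain ⟨cpe, hD, hcpe⟩ := h.data
  exact (mul_nonneg ((sq_nonneg _).trans hD.cpe_le) (le_max_of_le_left h.eps_pos.le)).trans hcpe

/-- A trajectory segment that ends close to the origin is completed by deadbeat control to one that
ends at the origin, which is then matched by a feasible decision. -/
lemma exists_feasible_deadbeat (C : Controller S) {ρ : ℝ} (hρ : 0 < ρ)
    (hΩρ : C.U ×ˢ Metric.closedBall 0 ρ ⊆ Ω) (B : ℝ≥0) (r : ℕ) {lamA lamS : ℝ} (hlamA : 0 < lamA)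
    (hlamS : 0 < lamS) :
    ∃ K : ℝ, 0 < K ∧ ∃ μ₀ : ℝ, 0 < μ₀ ∧ ∃ r₁ : ℝ, 0 < r₁ ∧ ∀ (cb : ℝ), cb ≤ 1 →
      ∀ (b : Basis S r) (D : Data m n) (εs ws : ℝ), Regular C Ω B μ₀ cb b D εs ws →
      ∀ (u yt : ℤ → Fin m → ℝ) (t : ℤ) (s : ℕ) (Ξ : ℕ → S.Idx → ℝ) (U : ℕ → Fin m → ℝ),
      s + S.dmax ≤ C.L →
      (∀ k < S.dmax + s, Ξ (k + 1) = S.step (U k) (Ξ k)) →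
      (∀ k < S.dmax + s, U k ∈ C.U) → (∀ k ≤ S.dmax + s, ‖Ξ k‖ + ws ≤ ρ) →
      ‖Ξ (S.dmax + s)‖ ≤ r₁ →
      (∀ k < S.dmax, U k = u (t - S.dmax + k)) →
      (∀ k < S.dmax, ‖S.out (Ξ k) - yt (t - S.dmax + k)‖ ≤ ws) →
      ∃ z, (⟨C, b, D, εs, ws, lamA, lamS⟩ : Problem S r).Feasible u yt t z ∧
        (⟨C, b, D, εs, ws, lamA, lamS⟩ : Problem S r).cost z ≤
          ∑ k ∈ Finset.range s, (wsq C.R (U (S.dmax + k)) + wsq C.Q (S.out (Ξ (S.dmax + k)))) +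
          K * ‖Ξ (S.dmax + s)‖ ^ 2 +
          K * cb * ∑ k ∈ Finset.range (S.dmax + s), (‖U k‖ ^ 2 + ‖Ξ k‖ ^ 2) +
          K * max εs ws ^ 2 := by
  obtain ⟨K, hK, μ₀, hμ₀, hmain⟩ := exists_feasible_of_trajectory C hρ hΩρ B r hlamA hlamS
  obtain ⟨F, hF1, hF⟩ := S.exists_bound_fb ρ
  obtain ⟨cQ, hcQ, hQ⟩ := exists_wsq_upper C.Q
  obtain ⟨cR, hcR, hR⟩ := exists_wsq_upper C.R
  obtain ⟨rU, hrU, hball⟩ := Metric.mem_nhds_iff.1 (mem_interior_iff_mem_nhds.1 C.U_zero)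
  have hF0 : 0 < F := lt_of_lt_of_le one_pos hF1
  refine ⟨C.L * (cR * F ^ 2 + cQ) + K * ((C.L + S.dmax : ℕ) * (F ^ 2 + 1)) + K, by positivity,
    min μ₀ (ρ / 2), by positivity, min (ρ / 2) (rU / (2 * F)), by positivity, ?_⟩
  intro cb hcb b D εs ws hreg u yt t s Ξ U hs hΞ hU hbd hend hu hy
  have hcb0 := hreg.cb_nonneg
  have hws : ws ≤ ρ / 2 := (le_max_right εs ws).trans (hreg.small.trans (min_le_right _ _))
  set e := S.dmax + s with he
  set X := ‖Ξ e‖ with hX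
  have hXρ : X ≤ ρ / 2 := hend.trans (min_le_left _ _)
  have hX0 : 0 ≤ X := norm_nonneg _
  set Ξ' : ℕ → S.Idx → ℝ := fun k => if k ≤ e then Ξ k else S.dead^[k - e] (Ξ e) with hΞ'
  set U' : ℕ → Fin m → ℝ := fun k => if k < e then U k else S.fb (Ξ' k) with hU'
  have hΞ1 : ∀ k ≤ e, Ξ' k = Ξ k := fun k hk => if_pos hk
  have hU1 : ∀ k < e, U' k = U k := fun k hk => if_pos hk
  have hΞ2 : ∀ k, e ≤ k → Ξ' k = S.dead^[k - e] (Ξ e) := by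
    intro k hk
    rcases hk.eq_or_lt with rfl | h
    · rw [hΞ1 _ le_rfl, Nat.sub_self, Function.iterate_zero, id]
    · exact if_neg (by omega)
  have hU2 : ∀ k, e ≤ k → U' k = S.fb (Ξ' k) := fun k hk => if_neg (by omega)
  have hn2 : ∀ k, e ≤ k → ‖Ξ' k‖ ≤ X := fun k hk => by
    rw [hΞ2 k hk]
    exact S.norm_dead_iterate_le _ _
  have hnU2 : ∀ k, e ≤ k → ‖U' k‖ ≤ F * X := fun k hk => by
    rw [hU2 k hk]
    exact (hF _ ((hn2 k hk).trans (by linarith))).trans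
      (mul_le_mul_of_nonneg_left (hn2 k hk) hF0.le)
  have hXF : F * X < rU := by
    have h1 : X ≤ rU / (2 * F) := hend.trans (min_le_right _ _)
    rw [le_div_iff₀ (by positivity)] at h1
    linarith
  obtain ⟨z, hz, hcost⟩ := hmain cb hcb b D εs ws (hreg.mono (min_le_left _ _) le_rfl) u yt t Ξ' U'
    (fun k hk => by
      by_cases hke : k < e
      · rw [hΞ1 _ (by omega), hU1 _ hke, hΞ1 _ hke.le, hΞ k hke]
      · rw [hΞ2 (k + 1) (by omega), hU2 k (by omega), ← FLSystem.dead, hΞ2 k (by omega),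
          ← Function.iterate_succ_apply' S.dead, show k + 1 - e = (k - e).succ by omega])
    (by rw [hΞ2 _ (by omega), S.dead_iterate_eq_zero _ _ (by omega)])
    (fun k hk => by
      by_cases hke : k < e
      · rw [hU1 _ hke]
        exact hU k hke
      · exact hball (by simpa using (hnU2 k (by omega)).trans_lt hXF))
    (fun k hk => by
      by_cases hke : k ≤ e
      · rw [hΞ1 _ hke]
        exact hbd k hke
      · linarith [hn2 k (by omega)])
    (fun k hk => by rw [hU1 _ (by omega), hu k hk])
    (fun k hk => by rw [hΞ1 _ (by omega)]; exact hy k hk)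
  refine ⟨z, hz, hcost.trans ?_⟩
  have hst : ∑ k ∈ Finset.range C.L, (wsq C.R (U' (k + S.dmax)) + wsq C.Q (S.out (Ξ' (k + S.dmax)))) ≤
      ∑ k ∈ Finset.range s, (wsq C.R (U (S.dmax + k)) + wsq C.Q (S.out (Ξ (S.dmax + k)))) +
      C.L * ((cR * F ^ 2 + cQ) * X ^ 2) := by
    rw [← Finset.sum_range_add_sum_Ico _ (show s ≤ C.L by omega)]
    refine add_le_add (le_of_eq (Finset.sum_congr rfl fun k hk => ?_)) ?_
    · have := Finset.mem_range.1 hk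
      rw [hU1 _ (by omega), hΞ1 _ (by omega), add_comm k]
    · refine (Finset.sum_le_card_nsmul _ _ ((cR * F ^ 2 + cQ) * X ^ 2) fun k hk => ?_).trans ?_
      · have hk' := Finset.mem_Ico.1 hk
        have h1 := pow_le_pow_left₀ (norm_nonneg _) (hnU2 (k + S.dmax) (by omega)) 2
        have h2 := pow_le_pow_left₀ (norm_nonneg _)
          ((S.norm_out_le _).trans (hn2 (k + S.dmax) (by omega))) 2
        have h3 := (hR (U' (k + S.dmax))).trans (mul_le_mul_of_nonneg_left h1 hcR.le)
        have h4 := (hQ (S.out (Ξ' (k + S.dmax)))).trans (mul_le_mul_of_nonneg_left h2 hcQ.le)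
        refine (add_le_add h3 h4).trans (le_of_eq (by ring))
      · rw [nsmul_eq_mul, Nat.card_Ico]
        have : ((C.L - s : ℕ) : ℝ) ≤ C.L := by exact_mod_cast Nat.sub_le _ _
        gcongr
  have hwin : ∑ k ∈ Finset.range (C.L + S.dmax), (‖U' k‖ ^ 2 + ‖Ξ' k‖ ^ 2) ≤
      ∑ k ∈ Finset.range e, (‖U k‖ ^ 2 + ‖Ξ k‖ ^ 2) +
      (C.L + S.dmax : ℕ) * ((F ^ 2 + 1) * X ^ 2) := by
    rw [← Finset.sum_range_add_sum_Ico _ (show e ≤ C.L + S.dmax by omega)]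
    refine add_le_add (le_of_eq (Finset.sum_congr rfl fun k hk => ?_)) ?_
    · have := Finset.mem_range.1 hk
      rw [hU1 _ (by omega), hΞ1 _ (by omega)]
    · refine (Finset.sum_le_card_nsmul _ _ ((F ^ 2 + 1) * X ^ 2) fun k hk => ?_).trans ?_
      · have hk' := Finset.mem_Ico.1 hk
        have h1 := pow_le_pow_left₀ (norm_nonneg _) (hnU2 k (by omega)) 2
        have h2 := pow_le_pow_left₀ (norm_nonneg _) (hn2 k (by omega)) 2
        refine (add_le_add h1 h2).trans (le_of_eq (by ring))
      · rw [nsmul_eq_mul, Nat.card_Ico]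
        have : ((C.L + S.dmax - e : ℕ) : ℝ) ≤ (C.L + S.dmax : ℕ) := by exact_mod_cast Nat.sub_le _ _
        gcongr
  set W : ℝ := ((C.L + S.dmax : ℕ) : ℝ)
  set T := ∑ k ∈ Finset.range e, (‖U k‖ ^ 2 + ‖Ξ k‖ ^ 2)
  have hT : 0 ≤ T := Finset.sum_nonneg fun _ _ => by positivity
  have hwin' := mul_le_mul_of_nonneg_left hwin (mul_nonneg hK.le hcb0)
  have h1 : K * cb * (W * ((F ^ 2 + 1) * X ^ 2)) ≤ K * 1 * (W * ((F ^ 2 + 1) * X ^ 2)) := by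
    have hW : 0 ≤ W := Nat.cast_nonneg _
    gcongr
  have h2 : 0 ≤ (C.L * (cR * F ^ 2 + cQ) + K * (W * (F ^ 2 + 1))) * cb * T := by positivity
  have h3 : 0 ≤ (C.L * (cR * F ^ 2 + cQ) + K * (W * (F ^ 2 + 1))) * max εs ws ^ 2 := by positivity
  have h4 : 0 ≤ K * X ^ 2 := by positivity
  linarith

end Deadbeat

/-! ### The prediction error -/

section Prediction

variable {m n r : ℕ} {S : FLSystem m n} {C : Controller S}
  {Ω : Set ((Fin m → ℝ) × (S.Idx → ℝ))} {B : ℝ≥0} {εs ws : ℝ} {b : Basis S r} {D : Data m n}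

lemma stage_nonneg (C : Controller S) (u y : Fin m → ℝ) : 0 ≤ wsq C.R u + wsq C.Q y :=
  add_nonneg (wsq_nonneg C.R_posDef u) (wsq_nonneg C.Q_posDef y)

lemma sum_stage_nonneg (C : Controller S) (s : Finset ℕ) (u y : ℕ → Fin m → ℝ) :
    0 ≤ ∑ k ∈ s, (wsq C.R (u k) + wsq C.Q (y k)) :=
  Finset.sum_nonneg fun _ _ => stage_nonneg C _ _

lemma sum_stage_add_le_cost {lamA lamS : ℝ} (hlamS : 0 ≤ lamS) (z : Decision S r C) :
    ∑ k ∈ Finset.range C.L, (wsq C.R (z.u k) + wsq C.Q (z.y k)) +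
      lamA * (max εs ws * ∑ j, z.α j ^ 2) ≤
      (⟨C, b, D, εs, ws, lamA, lamS⟩ : Problem S r).cost z := by
  have h : 0 ≤ lamS * (∑ k, ∑ j, z.σΨ k j ^ 2 + ∑ k, ∑ j, z.σΞ k j ^ 2) :=
    mul_nonneg hlamS (add_nonneg (Finset.sum_nonneg fun _ _ => Finset.sum_nonneg fun _ _ => sq_nonneg _)
      (Finset.sum_nonneg fun _ _ => Finset.sum_nonneg fun _ _ => sq_nonneg _))
  rw [← mul_assoc]
  exact le_add_of_nonneg_right h

lemma sum_stage_le_cost {lamA lamS : ℝ} (hlamA : 0 ≤ lamA) (hlamS : 0 ≤ lamS) (hε : 0 ≤ εs)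
    (z : Decision S r C) :
    ∑ k ∈ Finset.range C.L, (wsq C.R (z.u k) + wsq C.Q (z.y k)) ≤
      (⟨C, b, D, εs, ws, lamA, lamS⟩ : Problem S r).cost z :=
  (le_add_of_nonneg_right (mul_nonneg hlamA (mul_nonneg (le_max_of_le_left hε)
    (Finset.sum_nonneg fun _ _ => sq_nonneg _)))).trans (sum_stage_add_le_cost hlamS z)

lemma stage_le_cost {lamA lamS : ℝ} (hlamA : 0 ≤ lamA) (hlamS : 0 ≤ lamS) (hε : 0 ≤ εs)
    (z : Decision S r C) {k : ℕ} (hk : k < C.L) :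
    wsq C.R (z.u k) + wsq C.Q (z.y k) ≤ (⟨C, b, D, εs, ws, lamA, lamS⟩ : Problem S r).cost z :=
  (Finset.single_le_sum (f := fun k : ℕ => wsq C.R (z.u k) + wsq C.Q (z.y k))
    (fun _ _ => stage_nonneg C _ _) (Finset.mem_range.2 hk)).trans
    (sum_stage_le_cost hlamA hlamS hε z)

lemma hankel_mulVec {ι : Type*} (L q : ℕ) (z : ℕ → ι → ℝ) (α : Fin q → ℝ) (k : Fin L) (j : ι) :
    (hankel L q z *ᵥ α) (k, j) = ∑ l : Fin q, z (k + l) j * α l := rfl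

/-- The predicted outputs satisfy the system equations up to an error that is controlled by `α`. -/
lemma norm_stack_succ_sub_step_le {lamA lamS : ℝ} (hb : b.Admissible Ω B εs) (hε : 0 ≤ εs) (hw : 0 ≤ ws)
    {cpe : ℝ} (hD : D.Admissible C b Ω ws cpe) {u yt : ℤ → Fin m → ℝ} {t : ℤ} {z : Decision S r C}
    (hz : (⟨C, b, D, εs, ws, lamA, lamS⟩ : Problem S r).Feasible u yt t z) (k : ℕ)
    (hk : k < C.L + S.dmax)
    (hΩ : (z.u ((k : ℤ) - S.dmax), S.stack z.y ((k : ℤ) - S.dmax)) ∈ Ω) :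
    ‖S.stack z.y (((k + 1 : ℕ) : ℤ) - S.dmax)
      - S.step (z.u ((k : ℤ) - S.dmax)) (S.stack z.y ((k : ℤ) - S.dmax))‖ ≤
      ((B + 1) * B + 1) * (2 + B) * (max εs ws * (1 + ∑ l, |z.α l|)) := by
  have hB : (0 : ℝ) ≤ B := B.2
  have ha0 : 0 ≤ ∑ l, |z.α l| := Finset.sum_nonneg fun _ _ => abs_nonneg _
  have hμ0 : 0 ≤ max εs ws := le_max_of_le_left hε
  have hsb := slackBound_le (C := C) (D := D) hb hε hw lamA lamS z.α
  have hE0 : 0 ≤ ((B + 1) * B + 1) * (2 + B) * (max εs ws * (1 + ∑ l, |z.α l|)) := by positivity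
  refine (pi_norm_le_iff_of_nonneg hE0).2 ?_
  rintro ⟨i, j, hj⟩
  rw [Pi.sub_apply]
  by_cases hj' : j + 1 < S.d i
  · rw [S.step_of_lt _ _ i j hj']
    have : S.stack z.y (((k + 1 : ℕ) : ℤ) - S.dmax) ⟨i, ⟨j, hj⟩⟩ =
        S.stack z.y ((k : ℤ) - S.dmax) ⟨i, ⟨j + 1, hj'⟩⟩ := by
      simp only [FLSystem.stack]
      congr 1
      push_cast
      ring
    rw [this, sub_self, norm_zero]
    exact hE0
  · have hjd : j + 1 = S.d i := by omega
    rw [S.step_of_eq _ _ i j hjd]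
    set ξ := S.stack z.y ((k : ℤ) - S.dmax) with hξ
    set v := z.u ((k : ℤ) - S.dmax) with hv
    have hrowΞ := hz.hankel_xi ⟨k + 1, Nat.succ_lt_succ hk⟩ ⟨i, ⟨j, hj⟩⟩
    have hrowΨ : b.Psi (v, ξ) + z.σΨ ⟨k, hk⟩ =
        ∑ l : Fin (C.N + 1 - (C.L + S.dmax)), z.α l • D.psi b (k + l) := by
      funext i'
      have h := hz.hankel_psi ⟨k, hk⟩ i'
      rw [hankel_mulVec] at h
      rw [Finset.sum_apply]
      refine Eq.trans h (Finset.sum_congr rfl fun l _ => ?_)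
      rw [Pi.smul_apply, smul_eq_mul, mul_comm]
    have hdata : ∀ l : Fin (C.N + 1 - (C.L + S.dmax)),
        D.xiNoisy S (k + 1 + l) ⟨i, ⟨j, hj⟩⟩ * z.α l = (b.G *ᵥ (z.α l • D.psi b (k + l))) i
          + (D.resid b (k + l) i + S.stack D.wd (k + 1 + l) ⟨i, ⟨j, hj⟩⟩) * z.α l := by
      intro l
      rw [Data.xiNoisy, Pi.add_apply, hD.T_eq (k + 1 + l) (k + l) (by have := l.2; omega) i j hj
        (by omega), Matrix.mulVec_smul, Pi.smul_apply, Pi.add_apply, smul_eq_mul]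
      ring
    have hsum : (hankel (C.L + S.dmax + 1) (C.N + 1 - (C.L + S.dmax)) (D.xiNoisy S) *ᵥ z.α)
        (⟨k + 1, Nat.succ_lt_succ hk⟩, ⟨i, ⟨j, hj⟩⟩) = (b.G *ᵥ (b.Psi (v, ξ) + z.σΨ ⟨k, hk⟩)) i +
        ∑ l : Fin (C.N + 1 - (C.L + S.dmax)), (D.resid b (k + l) i
          + S.stack D.wd (k + 1 + l) ⟨i, ⟨j, hj⟩⟩) * z.α l := by
      rw [hankel_mulVec, hrowΨ, Matrix.mulVec_sum, Finset.sum_apply, ← Finset.sum_add_distrib]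
      exact Finset.sum_congr rfl fun l _ => hdata l
    have hbig : |∑ l : Fin (C.N + 1 - (C.L + S.dmax)), (D.resid b (k + l) i
          + S.stack D.wd (k + 1 + l) ⟨i, ⟨j, hj⟩⟩) * z.α l| ≤ (εs + b.Kw * ws + ws) * ∑ l, |z.α l| := by
      refine abs_sum_mul_le (g := fun l : Fin (C.N + 1 - (C.L + S.dmax)) => D.resid b (k + l) i
          + S.stack D.wd (k + 1 + l) ⟨i, ⟨j, hj⟩⟩) (fun l => ?_) z.α
      refine (abs_add_le _ _).trans (add_le_add ?_ ?_)
      · exact (norm_le_pi_norm (D.resid b (k + l)) i).trans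
          (Data.Admissible.norm_resid_le hb hD hw (by have := l.2; omega))
      · exact (norm_le_pi_norm (S.stack D.wd (k + 1 + l)) _).trans (hD.norm_stack_le hw _)
    have hPhi : S.Phi v ξ = b.G *ᵥ b.Psi (v, ξ) + b.err v ξ := by
      rw [Basis.err, add_sub_cancel]
    have hGσ := (norm_le_pi_norm (b.G *ᵥ z.σΨ ⟨k, hk⟩) i).trans
      (norm_mulVec_le_of_le hb.bound_G ((hz.slack_psi ⟨k, hk⟩).trans hsb))
    have hσ := (norm_le_pi_norm (z.σΞ ⟨k + 1, Nat.succ_lt_succ hk⟩) ⟨i, ⟨j, hj⟩⟩).trans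
      ((hz.slack_xi ⟨k + 1, Nat.succ_lt_succ hk⟩).trans hsb)
    have herr := (norm_le_pi_norm (b.err v ξ) i).trans (hb.err_le _ _ hΩ)
    have heq : S.stack z.y (((k + 1 : ℕ) : ℤ) - S.dmax) ⟨i, ⟨j, hj⟩⟩ - S.Phi v ξ i =
        (b.G *ᵥ z.σΨ ⟨k, hk⟩) i - b.err v ξ i + ∑ l : Fin (C.N + 1 - (C.L + S.dmax)),
          (D.resid b (k + l) i + S.stack D.wd (k + 1 + l) ⟨i, ⟨j, hj⟩⟩) * z.α l
        - z.σΞ ⟨k + 1, Nat.succ_lt_succ hk⟩ ⟨i, ⟨j, hj⟩⟩ := by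
      have h := hrowΞ.trans hsum
      rw [Matrix.mulVec_add, Pi.add_apply] at h
      rw [hPhi, Pi.add_apply]
      simp only at h
      linarith
    rw [heq]
    refine (norm_sub_le _ _).trans ((add_le_add ((norm_add_le _ _).trans (add_le_add
      ((norm_sub_le _ _).trans (add_le_add hGσ herr)) hbig)) hσ).trans ?_)
    set a := ∑ l, |z.α l|
    set μ := max εs ws
    have h1 : εs + b.Kw * ws + ws ≤ (2 + B) * μ := by
      have h2 : b.Kw * ws ≤ B * μ := mul_le_mul hb.bound_Kw (le_max_right _ _) hw hB
      linarith [le_max_left εs ws, le_max_right εs ws]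
    have h3 := mul_le_mul_of_nonneg_right h1 ha0
    have h4 : εs ≤ (2 + B) * μ := by nlinarith [le_max_left εs ws]
    linarith

/-- The state under the predicted inputs stays close to the predicted state. -/
lemma norm_traj_sub_le {U : Set (Fin m → ℝ)} {ρ K η : ℝ} (hK : 1 ≤ K)
    (hLip : ∀ u ∈ U, ∀ u' ∈ U, ∀ ξ ξ' : S.Idx → ℝ, ‖ξ‖ ≤ ρ + 1 → ‖ξ'‖ ≤ ρ + 1 →
      ‖S.Phi u ξ - S.Phi u' ξ'‖ ≤ K * max ‖u - u'‖ ‖ξ - ξ'‖)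
    {W : ℕ} {v : ℕ → Fin m → ℝ} {X ξ : ℕ → S.Idx → ℝ} (hη : (K + 1) ^ W * η ≤ 1) (hη0 : 0 ≤ η)
    (hv : ∀ k < W, v k ∈ U) (hξ : ∀ k < W, ‖ξ k‖ ≤ ρ)
    (hstep : ∀ k < W, ‖ξ (k + 1) - S.step (v k) (ξ k)‖ ≤ η)
    (h0 : ‖X 0 - ξ 0‖ ≤ η) (hX : ∀ k < W, X (k + 1) = S.step (v k) (X k)) (k : ℕ) (hk : k ≤ W) :
    ‖X k - ξ k‖ ≤ (K + 1) ^ k * η := by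
  induction k with
  | zero => simpa using h0
  | succ k ih =>
    have hk' : k < W := hk
    have h1 := ih hk'.le
    have h2 : (K + 1) ^ k * η ≤ 1 :=
      (mul_le_mul_of_nonneg_right (pow_le_pow_right₀ (by linarith) hk'.le) hη0).trans hη
    have h3 : ‖X k‖ ≤ ρ + 1 := by
      have := norm_le_norm_add_norm_sub' (X k) (ξ k)
      linarith [hξ k hk']
    have h4 := hLip _ (hv k hk') _ (hv k hk') _ _ h3 ((hξ k hk').trans (by linarith))
    rw [sub_self, norm_zero, max_eq_right (norm_nonneg _)] at h4
    have hKn : ‖X k - ξ k‖ ≤ K * ‖X k - ξ k‖ := le_mul_of_one_le_left (norm_nonneg _) hK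
    have h5 := S.norm_step_sub_le hKn h4
    have h6 : X (k + 1) - ξ (k + 1) = (S.step (v k) (X k) - S.step (v k) (ξ k))
        - (ξ (k + 1) - S.step (v k) (ξ k)) := by
      rw [hX k hk']
      abel
    rw [h6]
    refine (norm_sub_le _ _).trans ((add_le_add h5 (hstep k hk')).trans ?_)
    have h7 : 1 ≤ (K + 1) ^ k := one_le_pow₀ (by linarith)
    have h8 : K * ‖X k - ξ k‖ ≤ K * ((K + 1) ^ k * η) := mul_le_mul_of_nonneg_left h1 (by linarith)
    have h9 : 1 * η ≤ (K + 1) ^ k * η := mul_le_mul_of_nonneg_right h7 hη0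
    rw [pow_succ]
    linarith

/-- Norm bound for the predicted states, from the past measurements, the predicted outputs and the
terminal constraint. -/
lemma norm_stack_le_of_feasible {p : Problem S r} {u yt : ℤ → Fin m → ℝ} {t : ℤ}
    {z : Decision S r p.C} (hz : p.Feasible u yt t z) {c : ℝ} (hc : 0 ≤ c) {k₀ : ℕ}
    (hpast : ∀ k < S.dmax, k₀ ≤ k → ‖yt (t - S.dmax + k)‖ ≤ c) (hy : ∀ k < p.C.L, ‖z.y k‖ ≤ c)
    (k : ℕ) (hk₀ : k₀ ≤ k) (hk : k ≤ p.C.L + S.dmax) :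
    ‖S.stack z.y ((k : ℤ) - S.dmax)‖ ≤ c := by
  refine (pi_norm_le_iff_of_nonneg hc).2 ?_
  rintro ⟨i, j, hj⟩
  have hd := S.d_le_dmax i
  simp only [FLSystem.stack]
  rcases lt_or_ge (k + j) S.dmax with h | h
  · rw [(hz.init _ (by omega) (by omega)).2]
    refine (norm_le_pi_norm _ i).trans ?_
    have := hpast (k + j) h (by omega)
    rw [show t + ((k : ℤ) - S.dmax + (j : ℕ)) = t - S.dmax + (k + j : ℕ) by push_cast; ring]
    exact this
  · obtain ⟨l, hl⟩ : ∃ l : ℕ, k + j = S.dmax + l := ⟨k + j - S.dmax, by omega⟩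
    rw [show (k : ℤ) - S.dmax + (j : ℕ) = (l : ℤ) by omega]
    rcases lt_or_ge l p.C.L with h' | h'
    · exact (norm_le_pi_norm _ i).trans (hy l h')
    · obtain ⟨j', rfl⟩ : ∃ j', l = p.C.L + j' := ⟨l - p.C.L, by omega⟩
      have := hz.terminal i j' (by omega)
      push_cast
      rw [this]
      simpa using hc

lemma sq_error_bounds {Ke lamA q μ J A V d a K : ℝ} (hKe : 0 < Ke) (hlamA : 0 < lamA) (hq : 0 ≤ q)
    (hμ0 : 0 ≤ μ) (hJ0 : 0 ≤ J) (hJV : J ≤ V) (hK : K = Ke ^ 2 * (2 + 2 * q / lamA))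
    (hse : (μ * a) ^ 2 ≤ 2 * μ ^ 2 + 2 * q * (μ * (μ * A))) (hA : lamA * (μ * A) ≤ J)
    (hμ1 : μ ≤ 1) (hμ : μ ≤ d ^ 2 / (K * (1 + V))) :
    (Ke * (μ * a)) ^ 2 ≤ K * (μ ^ 2 + μ * J) ∧ (Ke * (μ * a)) ^ 2 ≤ d ^ 2 := by
  have hK0 : 0 < K := by rw [hK]; positivity
  have hfst : (Ke * (μ * a)) ^ 2 ≤ K * (μ ^ 2 + μ * J) := by
    have h1 : μ * A ≤ J / lamA := by
      rw [le_div_iff₀ hlamA]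
      linarith
    have h2 : (μ * a) ^ 2 ≤ 2 * μ ^ 2 + 2 * q * (μ * (J / lamA)) :=
      hse.trans (add_le_add le_rfl (mul_le_mul_of_nonneg_left
        (mul_le_mul_of_nonneg_left h1 hμ0) (by positivity)))
    have h3 : 2 * μ ^ 2 + 2 * q * (μ * (J / lamA)) ≤ (2 + 2 * q / lamA) * (μ ^ 2 + μ * J) := by
      have h4 : 0 ≤ 2 * q / lamA * μ ^ 2 + 2 * (μ * J) := by positivity
      have h5 : 2 * q * (μ * (J / lamA)) = 2 * q / lamA * (μ * J) := by ring
      linarith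
    calc (Ke * (μ * a)) ^ 2 = Ke ^ 2 * (μ * a) ^ 2 := by ring
      _ ≤ Ke ^ 2 * ((2 + 2 * q / lamA) * (μ ^ 2 + μ * J)) :=
        mul_le_mul_of_nonneg_left (h2.trans h3) (sq_nonneg _)
      _ = _ := by rw [hK]; ring
  refine ⟨hfst, hfst.trans ?_⟩
  have hV : 0 ≤ V := hJ0.trans hJV
  rw [le_div_iff₀ (by positivity)] at hμ
  have h3 : μ ^ 2 + μ * J ≤ μ * (1 + V) := by nlinarith
  have h4 := mul_le_mul_of_nonneg_left h3 hK0.le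
  linarith

/-- The prediction error `e` of a feasible decision with cost `J ≤ V` is small, and its square is at
most a multiple of `μ² + μ J`, where `μ = max εs ws`: the slack bound `μ (1 + ‖α‖₁)` is controlled
because the cost contains `μ ‖α‖₂²`. -/
lemma exists_prediction_error (C : Controller S) {V ρ : ℝ} (hV : 0 < V) (hρ : 0 < ρ)
    (hQρ : ∀ y : Fin m → ℝ, wsq C.Q y ≤ V → ‖y‖ ≤ ρ)
    (hΩρ : C.U ×ˢ Metric.closedBall 0 ρ ⊆ Ω) (B : ℝ≥0) (r : ℕ) {lamA lamS : ℝ} (hlamA : 0 < lamA)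
    (hlamS : 0 < lamS) {Δ : ℝ} (hΔ : 0 < Δ) :
    ∃ K : ℝ, 0 < K ∧ ∃ μ₀ : ℝ, 0 < μ₀ ∧ ∀ (cb : ℝ) (b : Basis S r) (D : Data m n) (εs ws : ℝ),
      Regular C Ω B μ₀ cb b D εs ws →
      ∀ (u yt : ℤ → Fin m → ℝ) (t : ℤ) (z : Decision S r C),
      (⟨C, b, D, εs, ws, lamA, lamS⟩ : Problem S r).Feasible u yt t z →
      (⟨C, b, D, εs, ws, lamA, lamS⟩ : Problem S r).cost z ≤ V →
      (∀ k < S.dmax, ‖yt (t - S.dmax + k)‖ ≤ ρ) →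
      ∀ X : ℕ → S.Idx → ℝ, ‖X 0 - S.stack yt (t - S.dmax)‖ ≤ ws →
      (∀ k < C.L + S.dmax, X (k + 1) = S.step (z.u ((k : ℤ) - S.dmax)) (X k)) →
      ∃ e, 0 ≤ e ∧ e ≤ Δ ∧ e ^ 2 ≤ K * (max εs ws ^ 2 + max εs ws *
        (⟨C, b, D, εs, ws, lamA, lamS⟩ : Problem S r).cost z) ∧
        ∀ k ≤ C.L + S.dmax, ‖X k - S.stack z.y ((k : ℤ) - S.dmax)‖ ≤ e := by
  have hB : (0 : ℝ) ≤ B := B.2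
  obtain ⟨F, hF, hLip⟩ := S.exists_lipschitz_Phi C.U_compact (ρ + 1)
  set q : ℝ := (Fintype.card (Fin (C.N + 1 - (C.L + S.dmax))) : ℝ) with hq
  have hq0 : 0 ≤ q := Nat.cast_nonneg _
  set Ke : ℝ := (F + 1) ^ (C.L + S.dmax) * (((B + 1) * B + 1) * (2 + B)) with hKe
  have hKe0 : 0 < Ke := by positivity
  set K : ℝ := Ke ^ 2 * (2 + 2 * q / lamA) with hK
  have hK0 : 0 < K := by positivity
  set d := min Δ 1
  have hd0 : 0 < d := by positivity
  refine ⟨K, hK0, min 1 (d ^ 2 / (K * (1 + V))), by positivity, ?_⟩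
  intro cb b D εs ws hreg u yt t z hz hcost hpast X hX0 hX
  obtain ⟨hε, hw, hμ, hb, cpe, hD, -⟩ := hreg
  have hA := sum_stage_add_le_cost (b := b) (D := D) (εs := εs) (ws := ws) (lamA := lamA) hlamS.le z
  have hstage := sum_stage_nonneg C (Finset.range C.L) (fun k => z.u k) (fun k => z.y k)
  have hyn : ∀ k < C.L, ‖z.y k‖ ≤ ρ := fun k hk => hQρ _ (by
    have h1 := stage_le_cost (b := b) (D := D) (ws := ws) hlamA.le hlamS.le hε.le z hk
    linarith [wsq_nonneg C.R_posDef (z.u k)])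
  have hse := sq_error_le (max εs ws) z.α
  have hμ0 : 0 < max εs ws := lt_max_of_lt_left hε
  have hwμ : ws ≤ max εs ws := le_max_right _ _
  have ha0 : 0 ≤ ∑ l, |z.α l| := Finset.sum_nonneg fun _ _ => abs_nonneg _
  set J := (⟨C, b, D, εs, ws, lamA, lamS⟩ : Problem S r).cost z with hJ
  set μ := max εs ws with hμdef
  set A := ∑ j, z.α j ^ 2
  set η := ((B + 1) * B + 1) * (2 + B) * (μ * (1 + ∑ l, |z.α l|)) with hη
  have hη0 : 0 ≤ η := by positivity
  have hμη : ws ≤ η := by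
    have h1 : 1 ≤ ((B + 1) * B + 1) * (2 + (B : ℝ)) := by nlinarith [mul_nonneg hB hB]
    have h2 : μ ≤ μ * (1 + ∑ l, |z.α l|) := by nlinarith
    exact hwμ.trans (h2.trans (le_mul_of_one_le_left (by positivity) h1))
  set e := (F + 1) ^ (C.L + S.dmax) * η with he
  have he0 : 0 ≤ e := by positivity
  have hJ0 : 0 ≤ J := by
    have : 0 ≤ lamA * (μ * A) :=
      mul_nonneg hlamA.le (mul_nonneg hμ0.le (Finset.sum_nonneg fun _ _ => sq_nonneg _))
    linarith
  have heq : e = Ke * (μ * (1 + ∑ l, |z.α l|)) := by rw [he, hη, hKe]; ring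
  obtain ⟨he2, hed2⟩ := sq_error_bounds hKe0 hlamA hq0 hμ0.le hJ0 hcost hK hse (by linarith)
    (hμ.trans (min_le_left _ _)) (hμ.trans (min_le_right _ _))
  rw [← heq] at he2 hed2
  have hed : e ≤ d := le_of_sq_le_sq hed2 hd0.le
  refine ⟨e, he0, hed.trans (min_le_left _ _), he2, fun k hk => ?_⟩
  have hξ : ∀ k < C.L + S.dmax, ‖S.stack z.y ((k : ℤ) - S.dmax)‖ ≤ ρ := fun k hk =>
    norm_stack_le_of_feasible (k₀ := 0) hz hρ.le (fun k hk _ => hpast k hk) hyn k k.zero_le hk.le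
  have hu : ∀ k < C.L + S.dmax, z.u ((k : ℤ) - S.dmax) ∈ C.U := fun k hk =>
    hz.input _ (by omega) (by simp only; omega)
  have h0 : S.stack z.y (((0 : ℕ) : ℤ) - S.dmax) = S.stack yt (t - S.dmax) := by
    funext ⟨i, j, hj⟩
    have := S.d_le_dmax i
    simp only [FLSystem.stack]
    rw [(hz.init _ (by omega) (by omega)).2]
    congr 1
    push_cast
    ring
  refine (norm_traj_sub_le (ξ := fun k => S.stack z.y ((k : ℤ) - S.dmax)) hF hLip
    (hed.trans (min_le_right _ _)) hη0 hu hξ (fun k hk => ?_) ?_ hX k hk).trans ?_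
  · exact norm_stack_succ_sub_step_le hb hε.le hw hD hz k hk (hΩρ ⟨hu k hk, by simpa using hξ k hk⟩)
  · rw [h0]
    exact hX0.trans hμη
  · exact mul_le_mul_of_nonneg_right (pow_le_pow_right₀ (by linarith) hk) hη0

end Prediction

/-! ### Existence of minimizers -/

section Existence

variable {m n r : ℕ} {S : FLSystem m n}

/-- The space of decision variables as a product, which carries the product topology. -/
abbrev DecisionTuple (S : FLSystem m n) (r : ℕ) (C : Controller S) : Type :=
  (ℤ → Fin m → ℝ) × (ℤ → Fin m → ℝ) × (Fin (C.N + 1 - (C.L + S.dmax)) → ℝ) ×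
    (Fin (C.L + S.dmax) → Fin r → ℝ) × (Fin (C.L + S.dmax + 1) → S.Idx → ℝ)

/-- The decision with given components. -/
def Decision.ofTuple {C : Controller S} (v : DecisionTuple S r C) : Decision S r C :=
  ⟨v.1, v.2.1, v.2.2.1, v.2.2.2.1, v.2.2.2.2⟩

/-- Set the inputs and outputs outside `-dmax ≤ k < L` to zero. On feasible decisions this changes
neither the constraints nor the cost, and it makes sublevel sets of the cost compact. -/
def Decision.trunc {C : Controller S} (z : Decision S r C) : Decision S r C :=
  { z with
    u := fun k => if -(S.dmax : ℤ) ≤ k ∧ k < C.L then z.u k else 0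
    y := fun k => if -(S.dmax : ℤ) ≤ k ∧ k < C.L then z.y k else 0 }

variable (p : Problem S r)

lemma continuous_cost_ofTuple : Continuous fun v : DecisionTuple S r p.C => p.cost (.ofTuple v) := by
  have hu : ∀ k : ℤ, Continuous fun v : DecisionTuple S r p.C => wsq p.C.R (v.1 k) := fun k =>
    continuous_wsq.comp ((continuous_apply k).comp continuous_fst)
  have hy : ∀ k : ℤ, Continuous fun v : DecisionTuple S r p.C => wsq p.C.Q (v.2.1 k) := fun k =>
    continuous_wsq.comp ((continuous_apply k).comp (continuous_fst.comp continuous_snd))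
  unfold Problem.cost Decision.ofTuple
  fun_prop

variable {p} {u yt : ℤ → Fin m → ℝ} {t : ℤ}

lemma isClosed_feasible (hΨ : Continuous p.b.Psi) :
    IsClosed {v : DecisionTuple S r p.C | p.Feasible u yt t (.ofTuple v)} := by
  have hstack : ∀ k : ℤ, Continuous fun v : DecisionTuple S r p.C => S.stack v.2.1 k := fun k => by
    unfold FLSystem.stack
    fun_prop
  have hu : ∀ k : ℤ, Continuous fun v : DecisionTuple S r p.C => v.1 k := fun k => by fun_prop
  have hsb : Continuous fun v : DecisionTuple S r p.C => p.slackBound v.2.2.1 := by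
    unfold Problem.slackBound
    fun_prop
  have hmul : ∀ {ι : Type} (L : ℕ) (y : ℕ → ι → ℝ) (k : Fin L) (j : ι),
      Continuous fun v : DecisionTuple S r p.C =>
        (hankel L (p.C.N + 1 - (p.C.L + S.dmax)) y *ᵥ v.2.2.1) (k, j) := fun L y k j => by
    simp only [hankel_mulVec]
    fun_prop
  have h1 : IsClosed {v : DecisionTuple S r p.C | ∀ (k : Fin (p.C.L + S.dmax)) (j : Fin r),
      p.b.Psi (v.1 ((k : ℤ) - S.dmax), S.stack v.2.1 ((k : ℤ) - S.dmax)) j + v.2.2.2.1 k j =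
      (hankel (p.C.L + S.dmax) (p.C.N + 1 - (p.C.L + S.dmax)) (p.D.psi p.b) *ᵥ v.2.2.1) (k, j)} := by
    simp only [ofPred_forall]
    refine isClosed_iInter fun k => isClosed_iInter fun j => isClosed_eq ?_ (hmul _ _ _ _)
    have h2 : Continuous fun v : DecisionTuple S r p.C =>
        p.b.Psi (v.1 ((k : ℤ) - S.dmax), S.stack v.2.1 ((k : ℤ) - S.dmax)) :=
      hΨ.comp ((hu _).prodMk (hstack _))
    exact ((continuous_apply j).comp h2).add (by fun_prop)
  have h2 : IsClosed {v : DecisionTuple S r p.C | ∀ (k : Fin (p.C.L + S.dmax + 1)) (j : S.Idx),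
      S.stack v.2.1 ((k : ℤ) - S.dmax) j + v.2.2.2.2 k j =
      (hankel (p.C.L + S.dmax + 1) (p.C.N + 1 - (p.C.L + S.dmax)) (p.D.xiNoisy S) *ᵥ v.2.2.1)
        (k, j)} := by
    simp only [ofPred_forall]
    refine isClosed_iInter fun k => isClosed_iInter fun j => isClosed_eq ?_ (hmul _ _ _ _)
    exact ((continuous_apply j).comp (hstack _)).add (by fun_prop)
  have h3 : IsClosed {v : DecisionTuple S r p.C | ∀ k : ℤ, -S.dmax ≤ k → k < 0 →
      v.1 k = u (t + k) ∧ v.2.1 k = yt (t + k)} := by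
    simp only [ofPred_forall, ofPred_and]
    exact isClosed_iInter fun k => isClosed_iInter fun _ => isClosed_iInter fun _ =>
      (isClosed_eq (by fun_prop) continuous_const).inter (isClosed_eq (by fun_prop) continuous_const)
  have h4 : IsClosed {v : DecisionTuple S r p.C | ∀ i, ∀ k : ℕ, k < S.d i →
      v.2.1 (p.C.L + k) i = 0} := by
    simp only [ofPred_forall]
    exact isClosed_iInter fun i => isClosed_iInter fun k => isClosed_iInter fun _ =>
      isClosed_eq (by fun_prop) continuous_const
  have h5 : IsClosed {v : DecisionTuple S r p.C | ∀ k, ‖v.2.2.2.1 k‖ ≤ p.slackBound v.2.2.1} := by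
    simp only [ofPred_forall]
    exact isClosed_iInter fun k => isClosed_le (by fun_prop) hsb
  have h6 : IsClosed {v : DecisionTuple S r p.C | ∀ k, ‖v.2.2.2.2 k‖ ≤ p.slackBound v.2.2.1} := by
    simp only [ofPred_forall]
    exact isClosed_iInter fun k => isClosed_le (by fun_prop) hsb
  have h7 : IsClosed {v : DecisionTuple S r p.C | ∀ k : ℤ, -S.dmax ≤ k → k < p.C.L →
      v.1 k ∈ p.C.U} := by
    simp only [ofPred_forall]
    exact isClosed_iInter fun k => isClosed_iInter fun _ => isClosed_iInter fun _ =>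
      p.C.U_compact.isClosed.preimage (hu k)
  convert ((((((h1.inter h2).inter h3).inter h4).inter h5).inter h6).inter h7) using 1
  ext v
  constructor
  · intro h
    exact ⟨⟨⟨⟨⟨⟨h.hankel_psi, h.hankel_xi⟩, h.init⟩, h.terminal⟩, h.slack_psi⟩, h.slack_xi⟩, h.input⟩
  · rintro ⟨⟨⟨⟨⟨⟨h1, h2⟩, h3⟩, h4⟩, h5⟩, h6⟩, h7⟩
    exact ⟨h1, h2, h3, h4, h5, h6, h7⟩

lemma stack_trunc {z : Decision S r p.C} (hz : p.Feasible u yt t z) (k : ℕ)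
    (hk : k ≤ p.C.L + S.dmax) :
    S.stack z.trunc.y ((k : ℤ) - S.dmax) = S.stack z.y ((k : ℤ) - S.dmax) := by
  funext ⟨i, j, hj⟩
  simp only [FLSystem.stack, Decision.trunc]
  rcases lt_or_ge (k + j) (p.C.L + S.dmax) with h | h
  · rw [if_pos (by omega)]
  · obtain ⟨l, hl⟩ : ∃ l : ℕ, k + j = p.C.L + S.dmax + l := ⟨k + j - (p.C.L + S.dmax), by omega⟩
    rw [if_neg (by omega), show (k : ℤ) - S.dmax + (j : ℕ) = p.C.L + (l : ℕ) by omega,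
      hz.terminal i l (by omega), Pi.zero_apply]

lemma feasible_trunc {z : Decision S r p.C} (hz : p.Feasible u yt t z) : p.Feasible u yt t z.trunc := by
  have hu : ∀ k : ℤ, -(S.dmax : ℤ) ≤ k → k < p.C.L → z.trunc.u k = z.u k := fun k h h' =>
    if_pos ⟨h, h'⟩
  have hy : ∀ k : ℤ, -(S.dmax : ℤ) ≤ k → k < p.C.L → z.trunc.y k = z.y k := fun k h h' =>
    if_pos ⟨h, h'⟩
  refine ⟨fun k j => ?_, fun k j => ?_, fun k h h' => ?_, fun i k hk => ?_, hz.slack_psi, hz.slack_xi,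
    fun k h h' => ?_⟩
  · rw [hu _ (by omega) (by omega), stack_trunc hz k k.2.le]
    exact hz.hankel_psi k j
  · rw [stack_trunc hz k (Nat.lt_succ_iff.1 k.2)]
    exact hz.hankel_xi k j
  · rw [hu _ h (by omega), hy _ h (by omega)]
    exact hz.init k h h'
  · have : z.trunc.y (p.C.L + k) = 0 := if_neg (by omega)
    rw [this, Pi.zero_apply]
  · rw [hu _ h h']
    exact hz.input k h h'

lemma cost_trunc (z : Decision S r p.C) : p.cost z.trunc = p.cost z := by
  have h : ∑ k ∈ Finset.range p.C.L, (wsq p.C.R (z.trunc.u k) + wsq p.C.Q (z.trunc.y k)) =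
      ∑ k ∈ Finset.range p.C.L, (wsq p.C.R (z.u k) + wsq p.C.Q (z.y k)) := by
    refine Finset.sum_congr rfl fun k hk => ?_
    have hk' := Finset.mem_range.1 hk
    simp only [Decision.trunc]
    rw [if_pos (by omega), if_pos (by omega)]
  unfold Problem.cost
  rw [h]
  rfl

lemma cost_parts_nonneg (hA : 0 ≤ p.lamA * max p.εs p.ws) (hS : 0 ≤ p.lamS) (z : Decision S r p.C) :
    0 ≤ ∑ k ∈ Finset.range p.C.L, (wsq p.C.R (z.u k) + wsq p.C.Q (z.y k)) ∧
    0 ≤ p.lamA * max p.εs p.ws * ∑ j, z.α j ^ 2 ∧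
    0 ≤ p.lamS * (∑ k, ∑ j, z.σΨ k j ^ 2 + ∑ k, ∑ j, z.σΞ k j ^ 2) :=
  ⟨sum_stage_nonneg p.C _ (fun k => z.u k) fun k => z.y k,
    mul_nonneg hA (Finset.sum_nonneg fun _ _ => sq_nonneg _),
    mul_nonneg hS (add_nonneg (Finset.sum_nonneg fun _ _ => Finset.sum_nonneg fun _ _ => sq_nonneg _)
      (Finset.sum_nonneg fun _ _ => Finset.sum_nonneg fun _ _ => sq_nonneg _))⟩

lemma cost_nonneg (hA : 0 ≤ p.lamA * max p.εs p.ws) (hS : 0 ≤ p.lamS) (z : Decision S r p.C) :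
    0 ≤ p.cost z := by
  obtain ⟨h1, h2, h3⟩ := cost_parts_nonneg hA hS z
  unfold Problem.cost
  linarith

/-- A feasible problem has a minimizer: truncated decisions that are no worse than a given one lie in a
product of balls, since inputs are constrained, outputs are weighted by the positive definite `Q` or
measured, and `α` and the slack variables are penalized. -/
lemma exists_isOptimal (hA : 0 < p.lamA * max p.εs p.ws) (hS : 0 < p.lamS)
    (hΨ : Continuous p.b.Psi) (h : ∃ z, p.Feasible u yt t z) : ∃ z, p.IsOptimal u yt t z := by
  obtain ⟨z₀, hz₀⟩ := h
  set c₀ := p.cost z₀ with hc₀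
  have hc₀0 : 0 ≤ c₀ := cost_nonneg hA.le hS.le z₀
  obtain ⟨RU, hRU⟩ := p.C.U_compact.isBounded.exists_norm_le
  obtain ⟨cQ, hcQ, hQ⟩ := exists_wsq_lower p.C.Q_posDef
  -- The bound on the outputs at negative times depends on the measurements.
  set Ry : ℤ → ℝ := fun k => max √(c₀ / cQ) ‖yt (t + k)‖ with hRy
  set Rα := √(c₀ / (p.lamA * max p.εs p.ws)) with hRα
  set Rσ := √(c₀ / p.lamS) with hRσ
  set K : Set (DecisionTuple S r p.C) :=
    (univ.pi fun _ => Metric.closedBall 0 (max RU 0)) ×ˢ (univ.pi fun k => Metric.closedBall 0 (Ry k)) ×ˢ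
      (Metric.closedBall 0 Rα ×ˢ (Metric.closedBall 0 Rσ ×ˢ Metric.closedBall 0 Rσ)) with hK
  have hKc : IsCompact K :=
    (isCompact_univ_pi fun _ => isCompact_closedBall _ _).prod
      ((isCompact_univ_pi fun _ => isCompact_closedBall _ _).prod
        ((isCompact_closedBall _ _).prod ((isCompact_closedBall _ _).prod (isCompact_closedBall _ _))))
  have hmem : ∀ z, p.Feasible u yt t z → p.cost z ≤ c₀ →
      ∃ v ∈ K, Decision.ofTuple v = z.trunc := by
    intro z hz hzc
    refine ⟨(z.trunc.u, z.trunc.y, z.α, z.σΨ, z.σΞ), ?_, rfl⟩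
    obtain ⟨hp1, hp2, hp3⟩ := cost_parts_nonneg hA.le hS.le z
    have hsum : ∑ k ∈ Finset.range p.C.L, (wsq p.C.R (z.u k) + wsq p.C.Q (z.y k)) +
      p.lamA * max p.εs p.ws * ∑ j, z.α j ^ 2 +
      p.lamS * (∑ k, ∑ j, z.σΨ k j ^ 2 + ∑ k, ∑ j, z.σΞ k j ^ 2) ≤ c₀ := hzc
    have hσΨ0 : 0 ≤ ∑ k, ∑ j, z.σΨ k j ^ 2 :=
      Finset.sum_nonneg fun _ _ => Finset.sum_nonneg fun _ _ => sq_nonneg _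
    have hσΞ0 : 0 ≤ ∑ k, ∑ j, z.σΞ k j ^ 2 :=
      Finset.sum_nonneg fun _ _ => Finset.sum_nonneg fun _ _ => sq_nonneg _
    refine ⟨fun k _ => ?_, fun k _ => ?_, ?_, ?_, ?_⟩
    · rw [mem_closedBall_zero_iff]
      simp only [Decision.trunc]
      split_ifs with hk
      · exact (hRU _ (hz.input k hk.1 hk.2)).trans (le_max_left _ _)
      · simp
    · rw [mem_closedBall_zero_iff]
      simp only [Decision.trunc]
      split_ifs with hk
      · rcases lt_or_ge k 0 with h0 | h0
        · rw [(hz.init k hk.1 h0).2]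
          exact le_max_right _ _
        · obtain ⟨l, rfl⟩ := Int.eq_ofNat_of_zero_le h0
          refine le_max_of_le_left (Real.le_sqrt_of_sq_le ?_)
          rw [le_div_iff₀ hcQ, mul_comm]
          have h1 : wsq p.C.R (z.u l) + wsq p.C.Q (z.y l) ≤
              ∑ k ∈ Finset.range p.C.L, (wsq p.C.R (z.u k) + wsq p.C.Q (z.y k)) :=
            Finset.single_le_sum (f := fun k : ℕ => wsq p.C.R (z.u k) + wsq p.C.Q (z.y k))
              (fun _ _ => stage_nonneg p.C _ _) (Finset.mem_range.2 (by omega))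
          linarith [hQ (z.y l), wsq_nonneg p.C.R_posDef (z.u l)]
      · rw [norm_zero]
        exact le_max_of_le_right (norm_nonneg _)
    · rw [mem_closedBall_zero_iff]
      refine Real.le_sqrt_of_sq_le ((norm_sq_le_sum_sq _).trans ?_)
      rw [le_div_iff₀ hA, mul_comm]
      linarith
    · rw [mem_closedBall_zero_iff]
      refine (pi_norm_le_iff_of_nonneg (Real.sqrt_nonneg _)).2 fun k => ?_
      refine Real.le_sqrt_of_sq_le ((norm_sq_le_sum_sq _).trans ?_)
      have h1 : ∑ j, z.σΨ k j ^ 2 ≤ ∑ k, ∑ j, z.σΨ k j ^ 2 :=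
        Finset.single_le_sum (f := fun k => ∑ j, z.σΨ k j ^ 2)
          (fun _ _ => Finset.sum_nonneg fun _ _ => sq_nonneg _) (Finset.mem_univ k)
      rw [le_div_iff₀ hS, mul_comm]
      nlinarith
    · rw [mem_closedBall_zero_iff]
      refine (pi_norm_le_iff_of_nonneg (Real.sqrt_nonneg _)).2 fun k => ?_
      refine Real.le_sqrt_of_sq_le ((norm_sq_le_sum_sq _).trans ?_)
      have h1 : ∑ j, z.σΞ k j ^ 2 ≤ ∑ k, ∑ j, z.σΞ k j ^ 2 :=
        Finset.single_le_sum (f := fun k => ∑ j, z.σΞ k j ^ 2)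
          (fun _ _ => Finset.sum_nonneg fun _ _ => sq_nonneg _) (Finset.mem_univ k)
      rw [le_div_iff₀ hS, mul_comm]
      nlinarith
  obtain ⟨v₀, hv₀, hv₀'⟩ := hmem z₀ hz₀ le_rfl
  obtain ⟨v, ⟨-, hv⟩, hmin⟩ :=
    (hKc.inter_right (isClosed_feasible (u := u) (yt := yt) (t := t) hΨ)).exists_isMinOn
    ⟨v₀, hv₀, by rw [mem_ofPred_eq, hv₀']; exact feasible_trunc hz₀⟩
    (continuous_cost_ofTuple p).continuousOn
  have hle : ∀ z, p.Feasible u yt t z → p.cost z ≤ c₀ → p.cost (.ofTuple v) ≤ p.cost z := by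
    intro z hz hzc
    obtain ⟨w, hw, hw'⟩ := hmem z hz hzc
    have : p.cost (.ofTuple v) ≤ p.cost (.ofTuple w) :=
      hmin ⟨hw, by rw [mem_ofPred_eq, hw']; exact feasible_trunc hz⟩
    simp only [hw', cost_trunc] at this
    exact this
  refine ⟨.ofTuple v, hv, fun z hz => ?_⟩
  rcases le_total (p.cost z) c₀ with h | h
  · exact hle z hz h
  · exact (hle z₀ hz₀ le_rfl).trans h

lemma J_eq_of_isOptimal {z : Decision S r p.C} (hz : p.IsOptimal u yt t z) :
    p.J u yt t = ENNReal.ofReal (p.cost z) :=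
  le_antisymm (iInf₂_le z hz.1) (le_iInf₂ fun z' hz' => ENNReal.ofReal_le_ofReal (hz.2 z' hz'))

lemma exists_feasible_of_J_ne_top (h : p.J u yt t ≠ ⊤) : ∃ z, p.Feasible u yt t z := by
  by_contra hne
  push Not at hne
  exact h (by simp [Problem.J, hne])

end Existence

/-! ### One period of the closed loop -/

section OneStep

variable {m n r : ℕ} {S : FLSystem m n} {C : Controller S}
  {Ω : Set ((Fin m → ℝ) × (S.Idx → ℝ))} {B : ℝ≥0}

/-- The outputs and inputs over `dmax` steps bound the states (observability and Lipschitz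
continuity). -/
lemma norm_traj_le {U : Set (Fin m → ℝ)} (hU : 0 ∈ U) {ρ F g : ℝ} (hρ : 0 ≤ ρ) (hF : 1 ≤ F) (hg : 0 ≤ g)
    (hLip : ∀ u ∈ U, ∀ u' ∈ U, ∀ ξ ξ' : S.Idx → ℝ, ‖ξ‖ ≤ ρ → ‖ξ'‖ ≤ ρ →
      ‖S.Phi u ξ - S.Phi u' ξ'‖ ≤ F * max ‖u - u'‖ ‖ξ - ξ'‖)
    {v : ℕ → Fin m → ℝ} {Ξ : ℕ → S.Idx → ℝ} (hΞ : ∀ k < S.dmax, Ξ (k + 1) = S.step (v k) (Ξ k))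
    (hv : ∀ k < S.dmax, v k ∈ U) (hball : ∀ k < S.dmax, ‖Ξ k‖ ≤ ρ)
    (hy : ∀ k < S.dmax, ‖S.out (Ξ k)‖ ≤ g) (hvg : ∀ k < S.dmax, ‖v k‖ ≤ g) (k : ℕ) (hk : k ≤ S.dmax) :
    ‖Ξ k‖ ≤ F ^ S.dmax * g := by
  suffices h : ∀ k ≤ S.dmax, ‖Ξ k‖ ≤ F ^ k * g from
    (h k hk).trans (mul_le_mul_of_nonneg_right (pow_le_pow_right₀ hF hk) hg)
  intro k
  induction k with
  | zero =>
    intro _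
    rw [pow_zero, one_mul]
    refine (pi_norm_le_iff_of_nonneg hg).2 ?_
    rintro ⟨i, j, hj⟩
    have hd := S.d_le_dmax i
    have h1 := FLSystem.traj_shift hΞ 0 j (by omega) i 0 (by omega)
    simp only [Nat.zero_add] at h1
    rw [← h1]
    exact (norm_le_pi_norm (S.out (Ξ j)) i).trans (hy j (by omega))
  | succ k ih =>
    intro hk
    have h1 := ih (by omega)
    have h2 := hLip _ (hv k hk) _ hU _ _ (hball k hk) (show ‖(0 : S.Idx → ℝ)‖ ≤ ρ by simpa using hρ)
    have hFk : g ≤ F ^ k * g := le_mul_of_one_le_left hg (one_le_pow₀ hF)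
    have h3 : max ‖v k - 0‖ ‖Ξ k - 0‖ ≤ F ^ k * g := by
      rw [sub_zero, sub_zero]
      exact max_le ((hvg k hk).trans hFk) h1
    have h4 := h2.trans (mul_le_mul_of_nonneg_left h3 (by linarith))
    have h5 : ‖Ξ k - 0‖ ≤ F * (F ^ k * g) := by
      rw [sub_zero]
      exact h1.trans (le_mul_of_one_le_left (by positivity) hF)
    have h6 := S.norm_step_sub_le h5 h4
    rw [S.step_zero, sub_zero] at h6
    rw [hΞ k hk, pow_succ]
    linarith

lemma add_three_sq_le (a b c : ℝ) : (a + b + c) ^ 2 ≤ 3 * (a ^ 2 + b ^ 2 + c ^ 2) := by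
  nlinarith [sq_nonneg (a - b), sq_nonneg (b - c), sq_nonneg (a - c)]

/-- The cost of the shifted candidate: all terms that are proportional to `J` and come from the errors
add up to at most `θ J`. -/
lemma shifted_cost_bound {c J s e E μ θ Kd cb KT Kp T Q1 L' : ℝ} {cQ : ℝ}
    (hc : c ≤ (1 + θ / 3) * (J - s) + L' * ((1 + 1 / (θ / 3)) * cQ * E) + Kd * e + Kd * cb * T + Kd * μ ^ 2)
    (hQ1 : Q1 = L' * ((1 + 1 / (θ / 3)) * cQ) + Kd + Kd * KT)
    (heE : e ≤ E) (hT : T ≤ KT * (J + E)) (hE : E ≤ Kp * (μ ^ 2 + μ * J)) (hJ : 0 ≤ J) (hs : 0 ≤ s)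
    (hθ : 0 < θ) (hKd : 0 < Kd) (hcb : cb ≤ 1) (hcb0 : 0 ≤ cb) (hKT : 0 ≤ KT) (hE0 : 0 ≤ E)
    (hcbθ : Kd * (KT + 1) * cb ≤ θ / 3) (hμθ : Q1 * Kp * μ ≤ θ / 3) (hQ10 : 0 ≤ Q1) :
    c ≤ (1 + θ) * J - s + (Q1 * Kp + Kd) * μ ^ 2 := by
  have h1 : Kd * cb * T ≤ Kd * cb * (KT * (J + E)) := mul_le_mul_of_nonneg_left hT (by positivity)
  have h2 : Kd * cb * KT * J ≤ θ / 3 * J := by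
    have : Kd * cb * KT ≤ θ / 3 := by nlinarith [mul_nonneg hKd.le hcb0]
    exact mul_le_mul_of_nonneg_right this hJ
  have h3 : Kd * cb * KT * E ≤ Kd * KT * E := by
    have : Kd * cb * KT ≤ Kd * KT := by nlinarith [mul_nonneg hKd.le hKT]
    exact mul_le_mul_of_nonneg_right this hE0
  have h4 : Q1 * E ≤ Q1 * (Kp * (μ ^ 2 + μ * J)) := mul_le_mul_of_nonneg_left hE hQ10
  have h5 : Q1 * Kp * μ * J ≤ θ / 3 * J := mul_le_mul_of_nonneg_right hμθ hJ
  have h6 : Kd * e ≤ Kd * E := mul_le_mul_of_nonneg_left heE hKd.le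
  have h7 : 0 ≤ θ / 3 * s := by positivity
  rw [hQ1] at h4 h5 ⊢
  linarith

set_option maxHeartbeats 2000000 in
/-- One period of the closed loop from time `t`, at which the first `dmax` inputs of a feasible decision
`z` are applied; `s` is the sum of its first `dmax` stage costs. Index `0` of `Ξ` is the time `t - dmax`.
There are two candidates at time `t + dmax`. Shifting `z` and appending deadbeat control gives a
cost close to `J - s`; starting deadbeat control at once, which is possible near the origin, gives a
cost bounded by a multiple of `s`. -/
lemma exists_one_step (C : Controller S) {V ρ₁ ρ : ℝ} (hV : 0 < V) (hρ₁ : 0 ≤ ρ₁) (hρ : ρ₁ < ρ)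
    (hQρ : ∀ y : Fin m → ℝ, wsq C.Q y ≤ V → ‖y‖ ≤ ρ₁)
    (hΩρ : C.U ×ˢ Metric.closedBall 0 ρ ⊆ Ω) (B : ℝ≥0) (r : ℕ) {lamA lamS : ℝ} (hlamA : 0 < lamA)
    (hlamS : 0 < lamS) :
    ∃ K : ℝ, 0 < K ∧ ∃ r₁ : ℝ, 0 < r₁ ∧ ∀ θ : ℝ, 0 < θ → ∃ Kθ : ℝ, 0 < Kθ ∧
      ∃ μ₀ : ℝ, 0 < μ₀ ∧ ∃ cb : ℝ, 0 < cb ∧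
      ∀ (b : Basis S r) (D : Data m n) (εs ws : ℝ), Regular C Ω B μ₀ cb b D εs ws →
      ∀ (u yt : ℤ → Fin m → ℝ) (t : ℤ) (z : Decision S r C) (J s : ℝ),
      (⟨C, b, D, εs, ws, lamA, lamS⟩ : Problem S r).Feasible u yt t z →
      J = (⟨C, b, D, εs, ws, lamA, lamS⟩ : Problem S r).cost z → J ≤ V →
      s = ∑ k ∈ Finset.range S.dmax, (wsq C.R (z.u k) + wsq C.Q (z.y k)) →
      (∀ k < S.dmax, ‖yt (t - S.dmax + k)‖ ≤ ρ) →
      (∀ k < S.dmax, u (t + k) = z.u k) →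
      ∀ Ξ : ℕ → S.Idx → ℝ, (∀ k < 2 * S.dmax, Ξ (k + 1) = S.step (u (t - S.dmax + k)) (Ξ k)) →
      (∀ k < 2 * S.dmax, ‖S.out (Ξ k) - yt (t - S.dmax + k)‖ ≤ ws) →
      (∀ k ≤ S.dmax, ‖Ξ (S.dmax + k)‖ ≤ (ρ₁ + ρ) / 2) ∧
      (∀ k ≤ S.dmax, ‖Ξ (S.dmax + k)‖ ^ 2 ≤ K * (s + max εs ws * J + max εs ws ^ 2)) ∧
      (∃ z', (⟨C, b, D, εs, ws, lamA, lamS⟩ : Problem S r).Feasible u yt (t + S.dmax) z' ∧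
        (⟨C, b, D, εs, ws, lamA, lamS⟩ : Problem S r).cost z' ≤
          (1 + θ) * J - s + Kθ * max εs ws ^ 2) ∧
      (‖Ξ (2 * S.dmax)‖ ≤ r₁ →
        ∃ z', (⟨C, b, D, εs, ws, lamA, lamS⟩ : Problem S r).Feasible u yt (t + S.dmax) z' ∧
        (⟨C, b, D, εs, ws, lamA, lamS⟩ : Problem S r).cost z' ≤
          K * (s + max εs ws * J + max εs ws ^ 2)) := by
  have hρ0 : 0 < ρ := by linarith
  obtain ⟨Kd, hKd, μd, hμd, r₁, hr₁, hdead⟩ := exists_feasible_deadbeat C hρ0 hΩρ B r hlamA hlamS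
  set Δ := min ((ρ - ρ₁) / 2) r₁ with hΔ
  have hΔ0 : 0 < Δ := lt_min (by linarith) hr₁
  obtain ⟨Kp, hKp, μp, hμp, hpred⟩ := exists_prediction_error C hV hρ0
    (fun y hy => (hQρ y hy).trans hρ.le) hΩρ B r hlamA hlamS hΔ0
  obtain ⟨F, hF, hLip⟩ := S.exists_lipschitz_Phi C.U_compact ρ
  obtain ⟨cQ, hcQ, hQup⟩ := exists_wsq_upper C.Q
  obtain ⟨qQ, hqQ, hQlo⟩ := exists_wsq_lower C.Q_posDef
  obtain ⟨qR, hqR, hRlo⟩ := exists_wsq_lower C.R_posDef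
  have hF0 : 0 < F := lt_of_lt_of_le one_pos hF
  have hU0 : (0 : Fin m → ℝ) ∈ C.U := interior_subset C.U_zero
  -- The states over one period satisfy `‖Ξ‖² ≤ Kg * (s + e²)` with the prediction error `e`.
  set Kg : ℝ := (F ^ S.dmax) ^ 2 * (3 * (1 / qQ + 1 / qR + 1)) with hKg
  have hKg0 : 0 < Kg := by positivity
  set Kc : ℝ := Kd * Kg + Kd * (S.dmax * (1 / qR + Kg)) + Kd with hKc
  have hKc0 : 0 < Kc := by positivity
  set KT : ℝ := C.L * (1 / qR + 2 / qQ + 2) with hKT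
  have hKT0 : 0 ≤ KT := by positivity
  refine ⟨(Kg + Kc) * (1 + Kp), by positivity, r₁, hr₁, fun θ hθ => ?_⟩
  set Ce : ℝ := C.L * ((1 + 1 / (θ / 3)) * cQ) + Kd + Kd * KT with hCe
  have hCe0 : 0 < Ce := by positivity
  refine ⟨Ce * Kp + Kd, by positivity,
    min (min (min μd μp) ((ρ - ρ₁) / 2)) (θ / (3 * (Ce * Kp))),
    lt_min (lt_min (lt_min hμd hμp) (by linarith)) (by positivity),
    min 1 (θ / (3 * (Kd * (KT + 1)))), by positivity, ?_⟩
  intro b D εs ws hreg u yt t z J s hz hJ hJV hs hpast hu Ξ hΞ hy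
  have hμ := hreg.small
  have hμ3 := hμ.trans ((min_le_left _ _).trans (min_le_right _ _))
  have hμ4 := hμ.trans (min_le_right _ _)
  have hε := hreg.eps_pos
  have hw := hreg.ws_nonneg
  have hμ0 : 0 < max εs ws := lt_max_of_lt_left hε
  have hws : ws ≤ (ρ - ρ₁) / 2 := (le_max_right _ _).trans hμ3
  set cb := min 1 (θ / (3 * (Kd * (KT + 1)))) with hcb
  have hcb1 : cb ≤ 1 := min_le_left _ _
  have hcb0 : 0 ≤ cb := hreg.cb_nonneg
  have hL := C.horizon
  have hdpos := S.dmax_pos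
  -- The trajectory under the predicted inputs extends the closed loop.
  set X : ℕ → S.Idx → ℝ := fun k =>
    Nat.rec (Ξ 0) (fun k ξ => S.step (z.u ((k : ℤ) - S.dmax)) ξ) k with hX
  have hX1 : ∀ k, X (k + 1) = S.step (z.u ((k : ℤ) - S.dmax)) (X k) := fun k => rfl
  have huz : ∀ k < 2 * S.dmax, u (t - S.dmax + k) = z.u ((k : ℤ) - S.dmax) := by
    intro k hk
    rcases lt_or_ge k S.dmax with h | h
    · rw [(hz.init _ (by omega) (by omega)).1]
      congr 1
      ring
    · obtain ⟨l, rfl⟩ : ∃ l, k = S.dmax + l := ⟨k - S.dmax, by omega⟩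
      have := hu l (by omega)
      rw [show t - S.dmax + ((S.dmax + l : ℕ) : ℤ) = t + l by push_cast; ring, this]
      congr 1
      push_cast
      ring
  have hXΞ : ∀ k ≤ 2 * S.dmax, X k = Ξ k := by
    intro k
    induction k with
    | zero => exact fun _ => rfl
    | succ k ih =>
      intro hk
      rw [hX1, ih (by omega), hΞ k (by omega), huz k (by omega)]
  have hX0 : ‖X 0 - S.stack yt (t - S.dmax)‖ ≤ ws := by
    refine (pi_norm_le_iff_of_nonneg hw).2 ?_
    rintro ⟨i, j, hj⟩
    have hd := S.d_le_dmax i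
    have h1 := FLSystem.traj_shift hΞ 0 j (by omega) i 0 (by omega)
    simp only [Nat.zero_add] at h1
    rw [Pi.sub_apply, hXΞ 0 (by omega), ← h1]
    exact (norm_le_pi_norm (S.out (Ξ j) - yt (t - S.dmax + j)) i).trans (hy j (by omega))
  obtain ⟨e, he0, heΔ, he2, heX⟩ := hpred _ b D εs ws
    (hreg.mono ((min_le_left _ _).trans ((min_le_left _ _).trans (min_le_right _ _))) le_rfl)
    u yt t z hz (hJ ▸ hJV) hpast X hX0 (fun k _ => hX1 k)
  -- Bounds in terms of the cost `J` and of the first `dmax` stage costs `s`.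
  have hstL : ∑ k ∈ Finset.range C.L, (wsq C.R (z.u k) + wsq C.Q (z.y k)) ≤ J :=
    hJ ▸ sum_stage_le_cost hlamA.le hlamS.le hε.le z
  have hst : ∀ k < C.L, wsq C.R (z.u k) + wsq C.Q (z.y k) ≤ J := fun k hk =>
    hJ ▸ stage_le_cost hlamA.le hlamS.le hε.le z hk
  have hsts : ∀ k < S.dmax, wsq C.R (z.u k) + wsq C.Q (z.y k) ≤ s := fun k hk =>
    hs ▸ Finset.single_le_sum (f := fun k : ℕ => wsq C.R (z.u k) + wsq C.Q (z.y k))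
      (fun _ _ => stage_nonneg C _ _) (Finset.mem_range.2 hk)
  have hs0 : 0 ≤ s := hs ▸ sum_stage_nonneg C _ (fun k => z.u k) fun k => z.y k
  have hy2 : ∀ (k : ℕ) (c : ℝ), wsq C.R (z.u k) + wsq C.Q (z.y k) ≤ c → ‖z.y k‖ ^ 2 ≤ c / qQ := by
    intro k c hc
    rw [le_div_iff₀ hqQ]
    linarith [hQlo (z.y k), wsq_nonneg C.R_posDef (z.u k)]
  have hu2 : ∀ (k : ℕ) (c : ℝ), wsq C.R (z.u k) + wsq C.Q (z.y k) ≤ c → ‖z.u k‖ ^ 2 ≤ c / qR := by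
    intro k c hc
    rw [le_div_iff₀ hqR]
    linarith [hRlo (z.u k), wsq_nonneg C.Q_posDef (z.y k)]
  have hJ0 : 0 ≤ J := (sum_stage_nonneg C _ (fun k => z.u k) fun k => z.y k).trans hstL
  have huU : ∀ k < C.L, z.u k ∈ C.U := fun k hk => hz.input k (by omega) (by simp only; omega)
  have hnoPast : ∀ c : ℝ, ∀ k < S.dmax, S.dmax ≤ k → ‖yt (t - S.dmax + k)‖ ≤ c := fun c k h h' => by
    omega
  have hξ1 : ∀ k ≤ C.L, ‖S.stack z.y k‖ ≤ ρ₁ := fun k hk => by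
    have := norm_stack_le_of_feasible hz hρ₁ (hnoPast _) (fun k hk => hQρ _ (by
      linarith [hst k hk, wsq_nonneg C.R_posDef (z.u k)])) (k + S.dmax) (by omega)
      (Nat.add_le_add_right hk _)
    simpa using this
  have hξ2 : ∀ k ≤ C.L, ‖S.stack z.y k‖ ^ 2 ≤ J / qQ := fun k hk => by
    have h1 := norm_stack_le_of_feasible hz (Real.sqrt_nonneg (J / qQ)) (hnoPast _)
      (fun k hk => Real.le_sqrt_of_sq_le (hy2 k J (hst k hk))) (k + S.dmax) (by omega)
      (Nat.add_le_add_right hk _)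
    have h2 := pow_le_pow_left₀ (norm_nonneg _) h1 2
    rw [Real.sq_sqrt (by positivity)] at h2
    simpa using h2
  have heXd : ∀ k ≤ C.L, ‖X (S.dmax + k) - S.stack z.y k‖ ≤ e := fun k hk => by
    have := heX (S.dmax + k) (by omega)
    rwa [show ((S.dmax + k : ℕ) : ℤ) - S.dmax = k by push_cast; ring] at this
  have hXb : ∀ k ≤ C.L, ‖X (S.dmax + k)‖ ≤ (ρ₁ + ρ) / 2 := fun k hk => by
    have h1 := norm_le_norm_add_norm_sub' (X (S.dmax + k)) (S.stack z.y k)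
    have h2 : Δ ≤ (ρ - ρ₁) / 2 := min_le_left _ _
    linarith [heXd k hk, hξ1 k hk]
  have hX2 : ∀ k ≤ C.L, ‖X (S.dmax + k)‖ ^ 2 ≤ 2 * (J / qQ) + 2 * e ^ 2 := fun k hk => by
    have h1 := norm_le_norm_add_norm_sub' (X (S.dmax + k)) (S.stack z.y k)
    have h2 := pow_le_pow_left₀ (norm_nonneg _) (h1.trans (add_le_add_right (heXd k hk) _)) 2
    nlinarith [hξ2 k hk, sq_nonneg (‖S.stack z.y k‖ - e)]
  have hout : ∀ k ≤ C.L, ‖S.out (X (S.dmax + k)) - z.y k‖ ≤ e := fun k hk => by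
    have h1 : S.out (X (S.dmax + k)) - z.y k = S.out (X (S.dmax + k) - S.stack z.y k) := by
      funext i
      simp [FLSystem.out, FLSystem.stack]
    rw [h1]
    exact (S.norm_out_le _).trans (heXd k hk)
  have hΞd : ∀ k ≤ S.dmax, Ξ (S.dmax + k) = X (S.dmax + k) := fun k hk => (hXΞ _ (by omega)).symm
  have hΞg : ∀ k ≤ S.dmax, ‖Ξ (S.dmax + k)‖ ^ 2 ≤ Kg * (s + e ^ 2) := by
    intro k hk
    set g := √(s / qQ) + √(s / qR) + e with hg
    have hg0 : 0 ≤ g := by positivity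
    have h1 := norm_traj_le hU0 hρ0.le hF hg0 hLip (v := fun k => z.u k) (Ξ := fun k => Ξ (S.dmax + k))
      (fun k hk => by
        have := hΞ (S.dmax + k) (by omega)
        rw [huz _ (by omega), show ((S.dmax + k : ℕ) : ℤ) - S.dmax = k by push_cast; ring] at this
        exact this)
      (fun k hk => huU k (by omega))
      (fun k hk => by
        rw [hΞd k hk.le]
        linarith [hXb k (by omega)])
      (fun k hk => by
        rw [hΞd k hk.le]
        have h1 := norm_le_norm_add_norm_sub' (S.out (X (S.dmax + k))) (z.y k)
        have h2 := Real.le_sqrt_of_sq_le (hy2 k s (hsts k hk))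
        have h3 := Real.sqrt_nonneg (s / qR)
        linarith [hout k (by omega)])
      (fun k hk => by
        have h2 := Real.le_sqrt_of_sq_le (hu2 k s (hsts k hk))
        have h3 := Real.sqrt_nonneg (s / qQ)
        linarith) k hk
    have h2 := pow_le_pow_left₀ (norm_nonneg _) h1 2
    have h3 := add_three_sq_le (√(s / qQ)) (√(s / qR)) e
    rw [Real.sq_sqrt (by positivity), Real.sq_sqrt (by positivity), ← hg] at h3
    have h4 : 3 * (s / qQ + s / qR + e ^ 2) ≤ 3 * (1 / qQ + 1 / qR + 1) * (s + e ^ 2) := by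
      have h5 : 0 ≤ s + (1 / qQ + 1 / qR) * e ^ 2 := by positivity
      have h6 : s / qQ + s / qR = (1 / qQ + 1 / qR) * s := by ring
      linarith
    rw [mul_pow] at h2
    refine h2.trans ((mul_le_mul_of_nonneg_left (h3.trans h4) (sq_nonneg _)).trans (le_of_eq ?_))
    rw [hKg]
    ring
  have heJ : s + e ^ 2 ≤ (1 + Kp) * (s + max εs ws * J + max εs ws ^ 2) := by
    rw [← hJ] at he2
    have : 0 ≤ Kp * s + (max εs ws ^ 2 + max εs ws * J) := by positivity
    linarith
  have hfut : ∀ k < S.dmax, (z.u k : Fin m → ℝ) = u (t + S.dmax - S.dmax + k) := fun k hk => by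
    rw [← hu k hk]
    congr 1
    ring
  have hyfut : ∀ k < S.dmax, ‖S.out (X (S.dmax + k)) - yt (t + S.dmax - S.dmax + k)‖ ≤ ws :=
    fun k hk => by
      have := hy (S.dmax + k) (by omega)
      rw [← hXΞ _ (by omega), show t - S.dmax + ((S.dmax + k : ℕ) : ℤ) = t + S.dmax - S.dmax + k by
        push_cast; ring] at this
      exact this
  have hregd : Regular C Ω B μd cb b D εs ws :=
    hreg.mono ((min_le_left _ _).trans ((min_le_left _ _).trans (min_le_left _ _))) le_rfl
  have hXstep : ∀ k : ℕ, X (S.dmax + (k + 1)) = S.step (z.u k) (X (S.dmax + k)) := fun k => by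
    rw [← add_assoc, hX1, show ((S.dmax + k : ℕ) : ℤ) - S.dmax = k by push_cast; ring]
  have hXbw : ∀ k ≤ C.L, ‖X (S.dmax + k)‖ + ws ≤ ρ := fun k hk => by linarith [hXb k hk]
  refine ⟨fun k hk => ?_, fun k hk => (hΞg k hk).trans ?_, ?_, fun hr => ?_⟩
  · rw [hΞd k hk]
    exact hXb k (by omega)
  · have h1 := mul_le_mul_of_nonneg_left heJ hKg0.le
    have h2 : 0 ≤ Kc * (1 + Kp) * (s + max εs ws * J + max εs ws ^ 2) := by positivity
    linarith
  · have hend : ‖X (S.dmax + (S.dmax + (C.L - S.dmax)))‖ ≤ e := by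
      have h1 := heXd C.L le_rfl
      have h2 : S.stack z.y (C.L : ℤ) = 0 := by
        funext ⟨i, j, hj⟩
        exact hz.terminal i j hj
      rw [h2, sub_zero] at h1
      rwa [show S.dmax + (C.L - S.dmax) = C.L by omega]
    obtain ⟨z', hz', hcost⟩ := hdead cb hcb1 b D εs ws hregd u yt (t + S.dmax) (C.L - S.dmax)
      (fun k => X (S.dmax + k)) (fun k => z.u k) (by omega) (fun k _ => hXstep k)
      (fun k hk => huU k (by omega)) (fun k hk => hXbw k (by omega))
      (hend.trans (heΔ.trans (min_le_right _ _))) hfut hyfut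
    refine ⟨z', hz', ?_⟩
    have hsplit : s + ∑ k ∈ Finset.range (C.L - S.dmax), (wsq C.R (z.u (S.dmax + k : ℕ))
        + wsq C.Q (z.y (S.dmax + k : ℕ))) ≤ J := by
      rw [hs, ← Finset.sum_range_add (fun k : ℕ => wsq C.R (z.u k) + wsq C.Q (z.y k)),
        show S.dmax + (C.L - S.dmax) = C.L by omega]
      exact hstL
    have hstage : ∑ k ∈ Finset.range (C.L - S.dmax), (wsq C.R (z.u (S.dmax + k : ℕ))
        + wsq C.Q (S.out (X (S.dmax + (S.dmax + k))))) ≤ (1 + θ / 3) * (J - s)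
        + C.L * ((1 + 1 / (θ / 3)) * cQ * e ^ 2) := by
      have h1 : ∀ k ∈ Finset.range (C.L - S.dmax), wsq C.R (z.u (S.dmax + k : ℕ))
          + wsq C.Q (S.out (X (S.dmax + (S.dmax + k)))) ≤ (1 + θ / 3) * (wsq C.R (z.u (S.dmax + k : ℕ))
          + wsq C.Q (z.y (S.dmax + k : ℕ))) + (1 + 1 / (θ / 3)) * cQ * e ^ 2 := by
        intro k hk
        have hk' := Finset.mem_range.1 hk
        have h2 := wsq_add_le C.Q_posDef (show 0 < θ / 3 by positivity) (z.y (S.dmax + k : ℕ))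
          (S.out (X (S.dmax + (S.dmax + k))) - z.y (S.dmax + k : ℕ))
        rw [add_sub_cancel] at h2
        have h3 := (hQup (S.out (X (S.dmax + (S.dmax + k))) - z.y (S.dmax + k : ℕ))).trans
          (mul_le_mul_of_nonneg_left (pow_le_pow_left₀ (norm_nonneg _) (hout (S.dmax + k) (by omega)) 2)
            hcQ.le)
        have h4 := mul_le_mul_of_nonneg_left h3 (show 0 ≤ 1 + 1 / (θ / 3) by positivity)
        have h5 : 0 ≤ θ / 3 * wsq C.R (z.u (S.dmax + k : ℕ)) :=
          mul_nonneg (by positivity) (wsq_nonneg C.R_posDef _)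
        linarith
      refine (Finset.sum_le_sum h1).trans ?_
      rw [Finset.sum_add_distrib, ← Finset.mul_sum, Finset.sum_const, Finset.card_range, nsmul_eq_mul]
      have h6 : ((C.L - S.dmax : ℕ) : ℝ) ≤ C.L := by exact_mod_cast Nat.sub_le _ _
      refine add_le_add (mul_le_mul_of_nonneg_left (by linarith) (by positivity))
        (mul_le_mul_of_nonneg_right h6 (by positivity))
    have hT : ∑ k ∈ Finset.range (S.dmax + (C.L - S.dmax)), (‖z.u k‖ ^ 2 + ‖X (S.dmax + k)‖ ^ 2)
        ≤ KT * (J + e ^ 2) := by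
      refine (Finset.sum_le_card_nsmul _ _ (J / qR + (2 * (J / qQ) + 2 * e ^ 2)) fun k hk => ?_).trans ?_
      · have hk' := Finset.mem_range.1 hk
        exact add_le_add (hu2 k J (hst k (by omega))) (hX2 k (by omega))
      · rw [Finset.card_range, nsmul_eq_mul, show S.dmax + (C.L - S.dmax) = C.L by omega, hKT, mul_assoc]
        refine mul_le_mul_of_nonneg_left ?_ (Nat.cast_nonneg _)
        have h1 : 0 ≤ 2 * J + (1 / qR + 2 / qQ) * e ^ 2 := by positivity
        have h2 : J / qR + 2 * (J / qQ) = (1 / qR + 2 / qQ) * J := by ring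
        linarith
    have hcbθ : Kd * (KT + 1) * cb ≤ θ / 3 := by
      have h1 : cb ≤ θ / (3 * (Kd * (KT + 1))) := min_le_right _ _
      rw [le_div_iff₀ (by positivity)] at h1
      linarith
    have hμθ : Ce * Kp * max εs ws ≤ θ / 3 := by
      rw [le_div_iff₀ (by positivity)] at hμ4
      linarith
    rw [← hJ] at he2
    exact shifted_cost_bound (hcost.trans (add_le_add_left (add_le_add_left (add_le_add_left hstage _) _) _))
      hCe (pow_le_pow_left₀ (norm_nonneg _) hend 2) hT he2 hJ0 hs0 hθ hKd hcb1 hcb0 hKT0 (sq_nonneg _)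
      hcbθ hμθ hCe0.le
  · obtain ⟨z', hz', hcost⟩ := hdead cb hcb1 b D εs ws hregd u yt (t + S.dmax) 0
      (fun k => X (S.dmax + k)) (fun k => z.u k) (by omega) (fun k _ => hXstep k)
      (fun k hk => huU k (by omega)) (fun k hk => hXbw k (by omega))
      (by
        simp only [add_zero]
        rw [← hΞd _ le_rfl, ← two_mul]
        exact hr) hfut hyfut
    refine ⟨z', hz', hcost.trans ?_⟩
    simp only [add_zero, Finset.range_zero, Finset.sum_empty, zero_add]
    have hXg := hΞg S.dmax le_rfl
    rw [hΞd _ le_rfl] at hXg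
    have hT : ∑ k ∈ Finset.range S.dmax, (‖z.u k‖ ^ 2 + ‖X (S.dmax + k)‖ ^ 2)
        ≤ S.dmax * ((1 / qR + Kg) * (s + e ^ 2)) := by
      refine (Finset.sum_le_card_nsmul _ _ ((1 / qR + Kg) * (s + e ^ 2)) fun k hk => ?_).trans ?_
      · have hk' := Finset.mem_range.1 hk
        have h1 := hu2 k s (hsts k hk')
        have h2 := hΞg k hk'.le
        rw [hΞd k hk'.le] at h2
        have h3 : 0 ≤ 1 / qR * e ^ 2 := by positivity
        have h4 : s / qR = 1 / qR * s := by ring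
        linarith
      · rw [Finset.card_range, nsmul_eq_mul]
    have h1 : Kd * cb * ∑ k ∈ Finset.range S.dmax, (‖z.u k‖ ^ 2 + ‖X (S.dmax + k)‖ ^ 2) ≤
        Kd * (S.dmax * ((1 / qR + Kg) * (s + e ^ 2))) := by
      have h2 : Kd * cb ≤ Kd := mul_le_of_le_one_right hKd.le hcb1
      exact mul_le_mul h2 hT (Finset.sum_nonneg fun _ _ => by positivity) hKd.le
    have h2 := mul_le_mul_of_nonneg_left hXg hKd.le
    have h3 : Kd * max εs ws ^ 2 ≤ Kd * (s + max εs ws * J + max εs ws ^ 2) :=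
      mul_le_mul_of_nonneg_left (by have := mul_nonneg hμ0.le hJ0; linarith) hKd.le
    have h4 := mul_le_mul_of_nonneg_left heJ (show 0 ≤ Kd * Kg + Kd * (S.dmax * (1 / qR + Kg)) by positivity)
    have h5 : 0 ≤ (Kg + Kd) * (1 + Kp) * (s + max εs ws * J + max εs ws ^ 2) := by positivity
    have h6 : 0 ≤ Kp * Kd * (s + max εs ws * J + max εs ws ^ 2) := by positivity
    rw [hKc]
    have h7 : 0 ≤ Kg * (1 + Kp) * (s + max εs ws * J + max εs ws ^ 2) := by positivity
    linarith

end OneStep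

/-! ### Contraction of the Lyapunov function -/

section ClosedLoop

variable {m n r : ℕ} {S : FLSystem m n} {C : Controller S}
  {Ω : Set ((Fin m → ℝ) × (S.Idx → ℝ))} {B : ℝ≥0}

/-- The convex combination of the bounds for the two candidates with weights `1 - a` and `a`, where
`a C₁ = 1/2 - a`: the term `-(1 - a) s` then also pays for the state term `X`. -/
lemma contraction_bound {J' J s μ C₁ a Kθ X : ℝ} (h1 : J' ≤ (1 + a / 4) * J - s + Kθ * μ ^ 2)
    (h2 : J' ≤ C₁ * (s + μ * J + μ ^ 2)) (h3 : X ≤ 1 / 2 * (s + μ * J + μ ^ 2)) (hC₁ : 0 < C₁)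
    (ha : a = 1 / (2 * (C₁ + 1))) (hμa : μ ≤ a / 4) (hJ : 0 ≤ J) (hKθ : 0 < Kθ) :
    J' + X ≤ (1 - a / 2) * J + (Kθ + 1) * μ ^ 2 := by
  have haC : a * C₁ = 1 / 2 - a := by
    rw [ha]
    field_simp
    ring
  have ha0 : 0 < a := by rw [ha]; positivity
  have ha1 : a ≤ 1 / 2 := by nlinarith
  have h4 := mul_le_mul_of_nonneg_left h1 (show 0 ≤ 1 - a by linarith)
  have h5 := mul_le_mul_of_nonneg_left h2 ha0.le
  have h6 : a * (C₁ * (s + μ * J + μ ^ 2)) = (1 / 2 - a) * (s + μ * J + μ ^ 2) := by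
    rw [← mul_assoc, haC]
  have h7 : μ * J ≤ a / 4 * J := mul_le_mul_of_nonneg_right hμa hJ
  have h8 : 0 ≤ a * (μ * J) + a / 4 * J - μ * J + a ^ 2 / 4 * J := by
    by_cases hμ : 0 ≤ μ
    · have := mul_nonneg ha0.le (mul_nonneg hμ hJ)
      have := mul_nonneg (sq_nonneg a) hJ
      linarith
    · nlinarith [mul_nonneg (sq_nonneg a) hJ, mul_nonneg (show 0 ≤ -μ by linarith) hJ]
  have h9 : 0 ≤ a * (1 + Kθ) * μ ^ 2 := by positivity
  nlinarith

/-- By compactness of the sublevel set the bound `‖y‖ < ρ` holds with a margin, which absorbs noise and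
prediction errors. -/
lemma exists_output_bound (C : Controller S) {V ρ : ℝ} (hV : 0 ≤ V)
    (hQρ : ∀ y : Fin m → ℝ, wsq C.Q y ≤ V → ‖y‖ < ρ) :
    ∃ ρ₁, 0 ≤ ρ₁ ∧ ρ₁ < ρ ∧ ∀ y : Fin m → ℝ, wsq C.Q y ≤ V → ‖y‖ ≤ ρ₁ := by
  have hcl : IsClosed {y : Fin m → ℝ | wsq C.Q y ≤ V} := isClosed_le continuous_wsq continuous_const
  have hc : IsCompact {y : Fin m → ℝ | wsq C.Q y ≤ V} :=
    (isCompact_closedBall (0 : Fin m → ℝ) ρ).of_isClosed_subset hcl fun y hy =>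
      mem_closedBall_zero_iff.2 (hQρ y hy).le
  obtain ⟨y, hy, hmax⟩ := hc.exists_isMaxOn ⟨0, by simpa [wsq] using hV⟩ continuous_norm.continuousOn
  exact ⟨‖y‖, norm_nonneg _, hQρ y hy, fun y' hy' => hmax hy'⟩

lemma V_eq_of_isOptimal {p : Problem S r} {c : ℝ} {P : Matrix S.Idx S.Idx ℝ} {x : ℤ → Fin n → ℝ}
    {u w : ℤ → Fin m → ℝ} {t : ℤ} {z : Decision S r p.C} (hz : p.IsOptimal u (Problem.meas S x w) t z)
    (hcost : 0 ≤ p.cost z) (hP : 0 ≤ c * wsq P (S.T (x t))) :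
    p.V c P x u w t = ENNReal.ofReal (p.cost z + c * wsq P (S.T (x t))) := by
  rw [Problem.V, J_eq_of_isOptimal hz, ENNReal.ofReal_add hcost hP]

set_option maxHeartbeats 1000000 in
/-- The Lyapunov function, with `P = 1` and a small weight `c`, contracts over one period of `dmax` steps
up to the squared error level, and it bounds the states of the period. -/
lemma exists_contraction (C : Controller S) {V ρ₁ ρ : ℝ} (hV : 0 < V) (hρ₁ : 0 ≤ ρ₁) (hρ : ρ₁ < ρ)
    (hQρ : ∀ y : Fin m → ℝ, wsq C.Q y ≤ V → ‖y‖ ≤ ρ₁)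
    (hΩρ : C.U ×ˢ Metric.closedBall 0 ρ ⊆ Ω) (B : ℝ≥0) (r : ℕ) {lamA lamS : ℝ} (hlamA : 0 < lamA)
    (hlamS : 0 < lamS) :
    ∃ c : ℝ, 0 < c ∧ ∃ K : ℝ, 0 < K ∧ ∃ a : ℝ, 0 < a ∧ a < 1 ∧ ∃ Kβ : ℝ, 0 < Kβ ∧
      ∃ μ₀ : ℝ, 0 < μ₀ ∧ ∃ cb : ℝ, 0 < cb ∧
      ∀ (b : Basis S r) (D : Data m n) (εs ws : ℝ), Regular C Ω B μ₀ cb b D εs ws →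
      ∀ p : Problem S r, p = ⟨C, b, D, εs, ws, lamA, lamS⟩ →
      ∀ (x : ℤ → Fin n → ℝ) (u w : ℤ → Fin m → ℝ), p.ClosedLoop x u w →
      ∀ j : ℕ, p.V c 1 x u w (j * S.dmax) ≤ ENNReal.ofReal V →
      (∀ k < S.dmax, ‖S.h (x (j * S.dmax - S.dmax + k))‖ + ws ≤ ρ) →
      (∃ z, p.IsOptimal u (Problem.meas S x w) (j * S.dmax) z) ∧
      (∀ k < S.dmax, u (j * S.dmax - S.dmax + k) ∈ C.U ∧ u (j * S.dmax + k) ∈ C.U) ∧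
      (∀ k ≤ S.dmax, ‖S.T (x (j * S.dmax + k))‖ ≤ (ρ₁ + ρ) / 2) ∧
      ∃ Vr : ℝ, 0 ≤ Vr ∧ p.V c 1 x u w (j * S.dmax) = ENNReal.ofReal Vr ∧
      (∀ k ≤ S.dmax, ‖S.T (x (j * S.dmax + k))‖ ^ 2 ≤ K * (2 * Vr + max εs ws ^ 2)) ∧
      p.V c 1 x u w ((j + 1 : ℕ) * S.dmax) ≤ ENNReal.ofReal ((1 - a) * Vr + Kβ * max εs ws ^ 2) := by
  obtain ⟨K, hK, r₁, hr₁, hstep⟩ := exists_one_step C hV hρ₁ hρ hQρ hΩρ B r hlamA hlamS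
  have hn : (0 : ℝ) < n := by
    have h1 := S.d_le_n ⟨0, S.m_pos⟩
    have h2 := S.d_pos ⟨0, S.m_pos⟩
    exact_mod_cast lt_of_lt_of_le h2 h1
  set C₁ : ℝ := K + 3 * V * K / r₁ ^ 2 with hC₁
  have hC₁0 : 0 < C₁ := by positivity
  set a : ℝ := 1 / (2 * (C₁ + 1)) with ha
  have ha0 : 0 < a := by positivity
  have ha1 : a ≤ 1 / 2 := by
    rw [ha, div_le_div_iff₀ (by positivity) (by norm_num)]
    linarith
  obtain ⟨Kθ, hKθ, μ₀, hμ₀, cb, hcb, hstep⟩ := hstep (a / 4) (by positivity)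
  set c : ℝ := 1 / (2 * n * K) with hc
  have hc0 : 0 < c := by positivity
  refine ⟨c, hc0, K, hK, a / 2, by positivity, by linarith, Kθ + 1, by positivity,
    min (min μ₀ 1) (min (a / 4) (V / Kθ)), by positivity, cb, hcb, ?_⟩
  intro b D εs ws hreg p hp x u w hcl j hVt hpast
  subst hp
  have hμ := hreg.small
  have hμ1 : max εs ws ≤ 1 := hμ.trans ((min_le_left _ _).trans (min_le_right _ _))
  have hμa : max εs ws ≤ a / 4 := hμ.trans ((min_le_right _ _).trans (min_le_left _ _))
  have hμV : max εs ws ≤ V / Kθ := hμ.trans ((min_le_right _ _).trans (min_le_right _ _))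
  have hε := hreg.eps_pos
  have hw := hreg.ws_nonneg
  have hμ0 : 0 < max εs ws := lt_max_of_lt_left hε
  have hA : 0 < lamA * max εs ws := mul_pos hlamA hμ0
  have hΨ := hreg.basis.loc_lipschitz.continuous
  set p : Problem S r := ⟨C, b, D, εs, ws, lamA, lamS⟩ with hp
  set t : ℤ := j * S.dmax with ht
  have ht0 : 0 ≤ t := by positivity
  have hJtop : p.J u (Problem.meas S x w) t ≠ ⊤ := by
    intro h
    rw [Problem.V, h, top_add] at hVt
    exact ENNReal.ofReal_ne_top (top_le_iff.1 hVt)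
  have hopt := exists_isOptimal (p := p) hA hlamS hΨ (exists_feasible_of_J_ne_top hJtop)
  obtain ⟨z, hz, hzu⟩ := hcl.control j hopt
  have hP : ∀ τ, 0 ≤ c * wsq (1 : Matrix S.Idx S.Idx ℝ) (S.T (x τ)) := fun τ =>
    mul_nonneg hc0.le (wsq_nonneg Matrix.PosDef.one _)
  have hJ0 : 0 ≤ p.cost z := cost_nonneg (p := p) hA.le hlamS.le z
  have hVeq := V_eq_of_isOptimal hz hJ0 (hP t)
  have hVle : p.cost z + c * wsq 1 (S.T (x t)) ≤ V := by
    rw [hVeq] at hVt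
    exact (ENNReal.ofReal_le_ofReal_iff hV.le).1 hVt
  have hy : ∀ k : ℕ, k < 2 * S.dmax →
      ‖S.out (S.T (x (t - S.dmax + k))) - Problem.meas S x w (t - S.dmax + k)‖ ≤ ws := fun k hk => by
    have h1 : S.out (S.T (x (t - S.dmax + k))) - Problem.meas S x w (t - S.dmax + k)
        = - w (t - S.dmax + k) := by
      rw [S.out_T, Problem.meas]
      abel
    rw [h1, norm_neg]
    exact hcl.noise _ (by omega)
  obtain ⟨h1, h2, ⟨z₁, hz₁, hc₁⟩, h4⟩ := hstep b D εs ws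
    (hreg.mono ((min_le_left _ _).trans (min_le_left _ _)) le_rfl) u (Problem.meas S x w) t z
    (p.cost z) _ hz.1 rfl (by linarith [hP t]) rfl
    (fun k hk => by
      have := hcl.noise (t - S.dmax + k) (by omega)
      exact (norm_add_le _ _).trans ((add_le_add_right this _).trans (hpast k hk)))
    hzu (fun k => S.T (x (t - S.dmax + k)))
    (fun k hk => by
      rw [← S.T_f, ← hcl.dyn _ (by omega)]
      congr 2
      push_cast
      ring) hy
  simp only [show ∀ k : ℕ, t - S.dmax + ((S.dmax + k : ℕ) : ℤ) = t + k from fun k => by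
    push_cast; ring] at h1 h2
  rw [show t - S.dmax + ((2 * S.dmax : ℕ) : ℤ) = t + S.dmax by push_cast; ring] at h4
  change p.cost z₁ ≤ _ at hc₁
  set s := ∑ k ∈ Finset.range S.dmax, (wsq C.R (z.u k) + wsq C.Q (z.y k)) with hs
  have hs0 : 0 ≤ s := sum_stage_nonneg C _ (fun k => z.u k) fun k => z.y k
  have hsJ : s ≤ p.cost z := by
    refine le_trans ?_ (sum_stage_le_cost (b := b) (D := D) (ws := ws) hlamA.le hlamS.le hε.le z)
    exact Finset.sum_le_sum_of_subset_of_nonneg (Finset.range_subset_range.2 C.horizon)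
      fun _ _ _ => stage_nonneg C _ _
  have hμ2 : max εs ws ^ 2 ≤ max εs ws := by nlinarith
  refine ⟨hopt, fun k hk => ⟨?_, ?_⟩, h1, p.cost z + c * wsq 1 (S.T (x t)), add_nonneg hJ0 (hP t), hVeq,
    fun k hk => (h2 k hk).trans (mul_le_mul_of_nonneg_left ?_ hK.le), ?_⟩
  · have h := (hz.1.init ((k : ℤ) - S.dmax) (by omega) (by omega)).1
    rw [show t - S.dmax + (k : ℤ) = t + ((k : ℤ) - S.dmax) by ring, ← h]
    exact hz.1.input _ (by omega) (by omega)
  · rw [hzu k hk]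
    have := C.horizon
    exact hz.1.input _ (by omega) (by simp only [hp]; omega)
  · have : max εs ws * p.cost z ≤ p.cost z := mul_le_of_le_one_left hJ0 hμ1
    linarith [hP t]
  · have ht' : ((j + 1 : ℕ) : ℤ) * S.dmax = t + S.dmax := by
      rw [ht]
      push_cast
      ring
    rw [ht']
    obtain ⟨z', hz'⟩ := exists_isOptimal (p := p) hA hlamS hΨ ⟨z₁, hz₁⟩
    have hJ'0 : 0 ≤ p.cost z' := cost_nonneg (p := p) hA.le hlamS.le z'
    rw [V_eq_of_isOptimal hz' hJ'0 (hP _)]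
    refine ENNReal.ofReal_le_ofReal ?_
    have hX := h2 S.dmax le_rfl
    have hb1 := (hz'.2 z₁ hz₁).trans hc₁
    have hb2 : p.cost z' ≤ C₁ * (s + max εs ws * p.cost z + max εs ws ^ 2) := by
      have hE0 : 0 ≤ s + max εs ws * p.cost z + max εs ws ^ 2 := by positivity
      rcases le_or_gt ‖S.T (x (t + S.dmax))‖ r₁ with hr | hr
      · obtain ⟨z₂, hz₂, hc₂⟩ := h4 hr
        refine ((hz'.2 z₂ hz₂).trans hc₂).trans (mul_le_mul_of_nonneg_right ?_ hE0)
        have : 0 ≤ 3 * V * K / r₁ ^ 2 := by positivity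
        linarith
      -- Far from the origin deadbeat control may be infeasible, but there the trivial bound `3 V`
      -- on the cost is a multiple of the squared state.
      · have h5 : r₁ ^ 2 ≤ K * (s + max εs ws * p.cost z + max εs ws ^ 2) :=
          (pow_le_pow_left₀ hr₁.le hr.le 2).trans hX
        have h6 : p.cost z' ≤ 3 * V := by
          rw [le_div_iff₀ hKθ] at hμV
          have h7 : Kθ * max εs ws ^ 2 ≤ V := by nlinarith
          have h8 : (1 + a / 4) * p.cost z ≤ 2 * V := by
            have h9 : p.cost z ≤ V := by linarith [hP t]
            exact mul_le_mul (by linarith) h9 hJ0 (by norm_num)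
          linarith
        have h7 : 3 * V * r₁ ^ 2 ≤ 3 * V * (K * (s + max εs ws * p.cost z + max εs ws ^ 2)) :=
          mul_le_mul_of_nonneg_left h5 (by positivity)
        have h8 : 3 * V ≤ 3 * V * K / r₁ ^ 2 * (s + max εs ws * p.cost z + max εs ws ^ 2) := by
          rw [div_mul_eq_mul_div, le_div_iff₀ (by positivity)]
          linarith
        have h9 : 0 ≤ K * (s + max εs ws * p.cost z + max εs ws ^ 2) := by positivity
        rw [hC₁, add_mul]
        linarith
    have hb3 : c * wsq 1 (S.T (x (t + S.dmax))) ≤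
        1 / 2 * (s + max εs ws * p.cost z + max εs ws ^ 2) := by
      rw [wsq_one]
      have h5 := sum_sq_le_card_mul (S.T (x (t + S.dmax)))
      rw [S.card_Idx] at h5
      calc c * ∑ i, S.T (x (t + S.dmax)) i ^ 2
          ≤ c * (n * (K * (s + max εs ws * p.cost z + max εs ws ^ 2))) :=
            mul_le_mul_of_nonneg_left (h5.trans (mul_le_mul_of_nonneg_left hX hn.le)) hc0.le
        _ = _ := by
          rw [hc]
          field_simp
    have h6 := contraction_bound hb1 hb2 hb3 hC₁0 ha hμa hJ0 hKθ
    have h7 : 0 ≤ (1 - a / 2) * (c * wsq 1 (S.T (x t))) := mul_nonneg (by linarith) (hP t)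
    linarith

end ClosedLoop

/-! ### Bounds from the initial condition, and the theorem -/

section Main

variable {m n r : ℕ} {S : FLSystem m n} {C : Controller S}
  {Ω : Set ((Fin m → ℝ) × (S.Idx → ℝ))} {B : ℝ≥0}

/-- Outputs over a time span and the state at its end bound the states: every entry of a state is a later
output or an entry of the final state. -/
lemma norm_traj_le_of_end {Ξ : ℕ → S.Idx → ℝ} {U : ℕ → Fin m → ℝ} {W : ℕ}
    (hΞ : ∀ k < W, Ξ (k + 1) = S.step (U k) (Ξ k)) {c : ℝ} (hc : 0 ≤ c)
    (hy : ∀ k < W, ‖S.out (Ξ k)‖ ≤ c) (hend : ‖Ξ W‖ ≤ c) (k : ℕ) (hk : k ≤ W) : ‖Ξ k‖ ≤ c := by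
  refine (pi_norm_le_iff_of_nonneg hc).2 ?_
  rintro ⟨i, j, hj⟩
  rcases lt_or_ge (k + j) W with h | h
  · have h1 := FLSystem.traj_shift hΞ k j h.le i 0 (by omega)
    simp only [Nat.zero_add] at h1
    rw [← h1]
    exact (norm_le_pi_norm (S.out (Ξ (k + j))) i).trans (hy _ h)
  · obtain ⟨l, hl⟩ : ∃ l, k + l = W := ⟨W - k, by omega⟩
    have h1 := FLSystem.traj_shift hΞ k l hl.le i (j - l) (by omega)
    simp only [show j - l + l = j by omega] at h1
    rw [← h1, hl]
    exact (norm_le_pi_norm _ _).trans hend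

lemma sum_Ico_neg_eq (d : ℕ) (f : ℤ → ℝ) :
    ∑ k ∈ Finset.Ico (-(d : ℤ)) 0, f k = ∑ k ∈ Finset.range d, f ((k : ℤ) - d) := by
  refine Finset.sum_nbij' (fun k => (k + d).toNat) (fun k => (k : ℤ) - d) ?_ ?_ ?_ ?_ ?_
  · intro k hk
    rw [Finset.mem_Ico] at hk
    rw [Finset.mem_range]
    omega
  · intro k hk
    rw [Finset.mem_range] at hk
    rw [Finset.mem_Ico]
    omega
  · intro k hk
    rw [Finset.mem_Ico] at hk
    omega
  · intro k hk
    omega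
  · intro k hk
    rw [Finset.mem_Ico] at hk
    congr 1
    omega

lemma Problem.ClosedLoop.step_eq {p : Problem S r} {x : ℤ → Fin n → ℝ} {u w : ℤ → Fin m → ℝ}
    (h : p.ClosedLoop x u w) (k : ℕ) :
    S.T (x (((k + 1 : ℕ) : ℤ) - S.dmax)) =
      S.step (u ((k : ℤ) - S.dmax)) (S.T (x ((k : ℤ) - S.dmax))) := by
  rw [← S.T_f, ← h.dyn _ (by omega)]
  congr 2
  push_cast
  ring

set_option maxHeartbeats 1000000 in
/-- The initial value of the Lyapunov function is bounded by the initial state and the past: close to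
the origin by the cost of deadbeat control, elsewhere since it is at most `V`. -/
lemma exists_initial_bound (C : Controller S) {V ρ ρ₀ c : ℝ} (hV : 0 < V) (hρ : 0 < ρ) (hρ₀ : ρ₀ < ρ)
    (hc : 0 < c) (hΩρ : C.U ×ˢ Metric.closedBall 0 ρ ⊆ Ω) (B : ℝ≥0) (r : ℕ) {lamA lamS : ℝ}
    (hlamA : 0 < lamA) (hlamS : 0 < lamS) :
    ∃ K : ℝ, 0 < K ∧ ∃ μ₀ : ℝ, 0 < μ₀ ∧ ∀ cb ≤ 1,
      ∀ (b : Basis S r) (D : Data m n) (εs ws : ℝ), Regular C Ω B μ₀ cb b D εs ws →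
      ∀ p : Problem S r, p = ⟨C, b, D, εs, ws, lamA, lamS⟩ →
      ∀ (x : ℤ → Fin n → ℝ) (u w : ℤ → Fin m → ℝ), p.ClosedLoop x u w →
      p.V c 1 x u w 0 ≤ ENNReal.ofReal V →
      (∀ k : ℤ, -S.dmax ≤ k → k < 0 → ‖S.h (x k)‖ ≤ ρ₀) →
      (∀ k < S.dmax, u ((k : ℤ) - S.dmax) ∈ C.U) →
      p.V c 1 x u w 0 ≤ ENNReal.ofReal (K * (‖S.T (x 0)‖ ^ 2 +
        ∑ k ∈ Finset.Ico (-(S.dmax : ℤ)) 0, (‖u k‖ ^ 2 + ‖S.h (x k)‖ ^ 2) + max εs ws ^ 2)) := by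
  obtain ⟨Kd, hKd, μd, hμd, rd, hrd, hdead⟩ := exists_feasible_deadbeat C hρ hΩρ B r hlamA hlamS
  set r₀ := min rd (ρ / 2) with hr₀
  have hr₀0 : 0 < r₀ := by positivity
  refine ⟨Kd * (S.dmax + 2) + c * n + V / r₀ ^ 2, by positivity,
    min μd (min (ρ / 2) (ρ - ρ₀)), lt_min hμd (lt_min (by positivity) (by linarith)), ?_⟩
  intro cb hcb1 b D εs ws hreg p hp x u w hcl hV0 hpast hu
  subst hp
  have hwμ : ws ≤ max εs ws := le_max_right _ _
  have hμ1 : max εs ws ≤ ρ / 2 := hreg.small.trans ((min_le_right _ _).trans (min_le_left _ _))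
  have hμ2 : max εs ws ≤ ρ - ρ₀ := hreg.small.trans ((min_le_right _ _).trans (min_le_right _ _))
  rw [sum_Ico_neg_eq]
  set Y := ∑ k ∈ Finset.range S.dmax,
    (‖u ((k : ℤ) - S.dmax)‖ ^ 2 + ‖S.h (x ((k : ℤ) - S.dmax))‖ ^ 2) with hY
  have hY0 : 0 ≤ Y := Finset.sum_nonneg fun _ _ => by positivity
  set Z := ‖S.T (x 0)‖ ^ 2 + Y with hZ
  have hZ0 : 0 ≤ Z := by positivity
  have hYk : ∀ k < S.dmax, ‖u ((k : ℤ) - S.dmax)‖ ^ 2 + ‖S.h (x ((k : ℤ) - S.dmax))‖ ^ 2 ≤ Y :=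
    fun k hk => Finset.single_le_sum
      (f := fun k : ℕ => ‖u ((k : ℤ) - S.dmax)‖ ^ 2 + ‖S.h (x ((k : ℤ) - S.dmax))‖ ^ 2)
      (fun _ _ => by positivity) (Finset.mem_range.2 hk)
  have hstep := fun (k : ℕ) (_ : k < S.dmax) => hcl.step_eq k
  have hx0 : (((S.dmax : ℕ) : ℤ) - S.dmax) = 0 := sub_self _
  rcases le_or_gt ‖S.T (x 0)‖ r₀ with hr | hr
  · have hball : ∀ k ≤ S.dmax, ‖S.T (x ((k : ℤ) - S.dmax))‖ ≤ max ρ₀ (ρ / 2) := fun k hk =>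
      norm_traj_le_of_end (Ξ := fun k => S.T (x ((k : ℤ) - S.dmax))) hstep
        (le_max_of_le_right (by positivity))
        (fun k hk => (hpast _ (by omega) (by omega)).trans (le_max_left _ _))
        (by
          simp only [hx0]
          exact hr.trans ((min_le_right _ _).trans (le_max_right _ _))) k hk
    have hZk : ∀ k ≤ S.dmax, ‖S.T (x ((k : ℤ) - S.dmax))‖ ^ 2 ≤ Z := fun k hk => by
      have h1 := norm_traj_le_of_end (Ξ := fun k => S.T (x ((k : ℤ) - S.dmax))) hstep
        (Real.sqrt_nonneg Z)
        (fun k hk => Real.le_sqrt_of_sq_le (by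
          have := hYk k hk
          have h2 := sq_nonneg ‖u ((k : ℤ) - S.dmax)‖
          have h3 := sq_nonneg ‖S.T (x 0)‖
          rw [S.out_T]
          linarith))
        (by
          simp only [hx0]
          exact Real.le_sqrt_of_sq_le (by linarith)) k hk
      have h2 := pow_le_pow_left₀ (norm_nonneg _) h1 2
      rwa [Real.sq_sqrt hZ0] at h2
    obtain ⟨z, hz, hcost⟩ := hdead cb hcb1 b D εs ws (hreg.mono (min_le_left _ _) le_rfl) u
      (Problem.meas S x w) 0 0 (fun k => S.T (x ((k : ℤ) - S.dmax))) (fun k => u ((k : ℤ) - S.dmax))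
      (by have := C.horizon; omega) hstep hu
      (fun k hk => by
        have h1 := hball k hk
        rcases max_cases ρ₀ (ρ / 2) with h | h <;> rw [h.1] at h1 <;> linarith)
      (by
        simp only [add_zero, hx0]
        exact hr.trans (min_le_left _ _))
      (fun k hk => by
        congr 1
        ring)
      (fun k hk => by
        have h1 : S.out (S.T (x ((k : ℤ) - S.dmax))) - Problem.meas S x w (0 - S.dmax + k)
            = - w ((k : ℤ) - S.dmax) := by
          rw [show (0 : ℤ) - S.dmax + k = k - S.dmax by ring, S.out_T, Problem.meas]
          abel
        rw [h1, norm_neg]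
        exact hcl.noise _ (by omega))
    simp only [add_zero, Finset.range_zero, Finset.sum_empty, zero_add, hx0] at hcost
    have hT : ∑ k ∈ Finset.range S.dmax,
        (‖u ((k : ℤ) - S.dmax)‖ ^ 2 + ‖S.T (x ((k : ℤ) - S.dmax))‖ ^ 2) ≤ (S.dmax + 1) * Z := by
      rw [Finset.sum_add_distrib]
      have h1 : ∑ k ∈ Finset.range S.dmax, ‖u ((k : ℤ) - S.dmax)‖ ^ 2 ≤ Y :=
        Finset.sum_le_sum fun k _ => le_add_of_nonneg_right (sq_nonneg _)
      have h2 : ∑ k ∈ Finset.range S.dmax, ‖S.T (x ((k : ℤ) - S.dmax))‖ ^ 2 ≤ S.dmax * Z := by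
        refine (Finset.sum_le_card_nsmul _ _ Z fun k hk => hZk k (Finset.mem_range.1 hk).le).trans ?_
        rw [Finset.card_range, nsmul_eq_mul]
      have h3 : Y ≤ Z := by
        rw [hZ]
        exact le_add_of_nonneg_left (sq_nonneg _)
      linarith
    have hT0 : 0 ≤ ∑ k ∈ Finset.range S.dmax,
        (‖u ((k : ℤ) - S.dmax)‖ ^ 2 + ‖S.T (x ((k : ℤ) - S.dmax))‖ ^ 2) :=
      Finset.sum_nonneg fun _ _ => by positivity
    have hP : c * wsq 1 (S.T (x 0)) ≤ c * n * Z := by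
      rw [wsq_one, mul_assoc]
      have h5 := sum_sq_le_card_mul (S.T (x 0))
      rw [S.card_Idx] at h5
      refine mul_le_mul_of_nonneg_left (h5.trans (mul_le_mul_of_nonneg_left ?_ (Nat.cast_nonneg _))) hc.le
      rw [hZ]
      linarith
    have hJ := iInf₂_le (f := fun (z : Decision S r C)
      (_ : (⟨C, b, D, εs, ws, lamA, lamS⟩ : Problem S r).Feasible u (Problem.meas S x w) 0 z) =>
      ENNReal.ofReal ((⟨C, b, D, εs, ws, lamA, lamS⟩ : Problem S r).cost z)) z hz
    have hP0 : 0 ≤ c * wsq (1 : Matrix S.Idx S.Idx ℝ) (S.T (x 0)) :=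
      mul_nonneg hc.le (wsq_nonneg Matrix.PosDef.one _)
    have hcost0 : 0 ≤ (⟨C, b, D, εs, ws, lamA, lamS⟩ : Problem S r).cost z :=
      cost_nonneg (p := (⟨C, b, D, εs, ws, lamA, lamS⟩ : Problem S r))
        (mul_nonneg hlamA.le (le_max_of_le_left hreg.eps_pos.le)) hlamS.le z
    refine (add_le_add_left hJ _).trans ?_
    rw [← ENNReal.ofReal_add hcost0 hP0]
    refine ENNReal.ofReal_le_ofReal ((add_le_add hcost hP).trans ?_)
    have h1 := mul_le_mul (mul_le_of_le_one_right hKd.le hcb1) hT hT0 hKd.le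
    have h2 : Kd * ‖S.T (x 0)‖ ^ 2 ≤ Kd * Z := mul_le_mul_of_nonneg_left (by linarith) hKd.le
    have h3 : 0 ≤ (Kd * (S.dmax + 1) + c * n) * max εs ws ^ 2 := by positivity
    have h4 : 0 ≤ V / r₀ ^ 2 * (Z + max εs ws ^ 2) := by positivity
    linarith
  · refine hV0.trans (ENNReal.ofReal_le_ofReal ?_)
    have h1 : r₀ ^ 2 ≤ Z := by
      have := pow_le_pow_left₀ hr₀0.le hr.le 2
      linarith
    have h2 : V ≤ V / r₀ ^ 2 * Z := by
      rw [div_mul_eq_mul_div, le_div_iff₀ (by positivity)]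
      exact mul_le_mul_of_nonneg_left h1 hV.le
    have h3 : 0 ≤ V / r₀ ^ 2 * max εs ws ^ 2 := by positivity
    have h4 : 0 ≤ (Kd * (S.dmax + 2) + c * n) * (Z + max εs ws ^ 2) := by positivity
    linarith

end Main

set_option maxHeartbeats 2000000 in
theorem theorem4 {m n r : ℕ} (S : FLSystem m n) (C : Controller S)
    (V_ROA : ℝ) (hV : 0 < V_ROA)
    (ρ₀ ρ : ℝ) (hρ : ρ₀ < ρ) (hQρ : ∀ y : Fin m → ℝ, wsq C.Q y ≤ V_ROA → ‖y‖ < ρ)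
    (Ω : Set ((Fin m → ℝ) × (S.Idx → ℝ))) (hΩ : IsCompact Ω)
    (hΩρ : C.U ×ˢ Metric.closedBall 0 ρ ⊆ Ω) (B : ℝ≥0) :
    ∃ lamA₁ lamA₂ lamS₁ lamS₂ : ℝ, 0 < lamA₁ ∧ lamA₁ < lamA₂ ∧ 0 < lamS₁ ∧ lamS₁ < lamS₂ ∧
    ∀ lamA ∈ Icc lamA₁ lamA₂, ∀ lamS ∈ Icc lamS₁ lamS₂,
    ∃ εbar wbar cbar : ℝ, 0 < εbar ∧ 0 < wbar ∧ 0 < cbar ∧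
    ∃ β : ℝ × ℝ → ℝ,
      ContinuousOn β (Icc 0 εbar ×ˢ Icc 0 wbar) ∧
      StrictMonoOn β (Icc 0 εbar ×ˢ Icc 0 wbar) ∧
      MapsTo β (Icc 0 εbar ×ˢ Icc 0 wbar) (Icc 0 V_ROA) ∧
      β (0, 0) = 0 ∧
    ∃ M κ : ℝ, 0 < M ∧ 0 < κ ∧ κ < 1 ∧
    ∀ εs ws cpe : ℝ, 0 < εs → εs ≤ εbar → 0 ≤ ws → ws ≤ wbar → cpe * max εs ws ≤ cbar →
    ∃ c : ℝ, 0 < c ∧ ∃ P : Matrix S.Idx S.Idx ℝ, P.PosDef ∧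
    ∀ b : Basis S r, b.Admissible Ω B εs →
    ∀ D : Data m n, D.Admissible C b Ω ws cpe →
    ∀ p : Problem S r, p = ⟨C, b, D, εs, ws, lamA, lamS⟩ →
    ∀ (x : ℤ → Fin n → ℝ) (u w : ℤ → Fin m → ℝ), p.ClosedLoop x u w →
      (∀ k : ℤ, -S.dmax ≤ k → k < 0 → ‖S.h (x k)‖ ≤ ρ₀) →
      p.V c P x u w 0 ≤ ENNReal.ofReal V_ROA →
      -- recursive feasibility
      (∀ j : ℕ, ∃ z, p.IsOptimal u (Problem.meas S x w) (j * S.dmax) z) ∧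
      -- invariance of the sublevel set
      (∀ j : ℕ, p.V c P x u w (j * S.dmax) ≤ ENNReal.ofReal V_ROA) ∧
      -- the closed loop evolves in the compact set
      (∀ k : ℤ, -S.dmax ≤ k → (u k, S.T (x k)) ∈ Ω) ∧
      -- exponential convergence
      (∀ j : ℕ, p.V c P x u w (j * S.dmax) ≤
        ENNReal.ofReal (M * κ ^ (j * S.dmax)) * p.V c P x u w 0 + ENNReal.ofReal (β (εs, ws))) ∧
      -- practical exponential stability
      (∀ t : ℕ, ‖S.T (x t)‖ ^ 2 ≤ M * (κ ^ t * (‖S.T (x 0)‖ ^ 2 +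
        ∑ k ∈ Finset.Ico (-(S.dmax : ℤ)) 0, (‖u k‖ ^ 2 + ‖S.h (x k)‖ ^ 2)) + β (εs, ws))) := by
  obtain ⟨ρ₁, hρ₁, hρ₁ρ, hQρ₁⟩ := exists_output_bound C hV.le hQρ
  refine ⟨1, 2, 1, 2, one_pos, one_lt_two, one_pos, one_lt_two, fun lamA hlamA lamS hlamS => ?_⟩
  have hlamA0 : 0 < lamA := lt_of_lt_of_le one_pos hlamA.1
  have hlamS0 : 0 < lamS := lt_of_lt_of_le one_pos hlamS.1
  obtain ⟨c, hc, K, hK, a, ha0, ha1, Kβ, hKβ, μ₁, hμ₁, cb, hcb, hcontr⟩ :=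
    exists_contraction C hV hρ₁ hρ₁ρ hQρ₁ hΩρ B r hlamA0 hlamS0
  obtain ⟨Ki, hKi, μ₂, hμ₂, hinit⟩ :=
    exists_initial_bound C hV (hρ₁.trans_lt hρ₁ρ) hρ hc hΩρ B r hlamA0 hlamS0
  -- Bound for the true outputs at all times; the noisy ones must stay below `ρ`.
  set ρ₂ := max ρ₀ ((ρ₁ + ρ) / 2) with hρ₂
  have hρ₂ρ : ρ₂ < ρ := max_lt hρ (by linarith)
  have hρ₂0 : 0 ≤ ρ₂ := le_max_of_le_right (by linarith)
  set Cβ := Kβ / a with hCβ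
  have hCβ0 : 0 < Cβ := by positivity
  set μb := min (min μ₁ μ₂) (min (min 1 (ρ - ρ₂)) (min (a * V_ROA / Kβ) (V_ROA / (2 * Cβ)))) with hμb
  have hμb0 : 0 < μb := lt_min (lt_min hμ₁ hμ₂) (lt_min (lt_min one_pos (by linarith))
    (lt_min (by positivity) (by positivity)))
  have hdpos := S.dmax_pos
  -- `κ` is the contraction rate per step, whereas `1 - a` is the rate per period of `dmax` steps.
  obtain ⟨κ, hκ0, hκ1, hκ⟩ : ∃ κ : ℝ, 0 < κ ∧ κ < 1 ∧ κ ^ S.dmax = 1 - a := by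
    have h1 : 0 < 1 - a := by linarith
    refine ⟨(1 - a) ^ ((S.dmax : ℝ)⁻¹), Real.rpow_pos_of_pos h1 _,
      Real.rpow_lt_one h1.le (by linarith) (by positivity), Real.rpow_inv_natCast_pow h1.le hdpos.ne'⟩
  set M := 1 + 2 * K * Ki / (1 - a) + (2 * K * Ki + 2 * K * Cβ + K) / Cβ with hM
  have h1a : 0 < 1 - a := by linarith
  have hM1 : 2 * K * Ki / (1 - a) ≤ M := by
    have : 0 ≤ (2 * K * Ki + 2 * K * Cβ + K) / Cβ := by positivity
    linarith
  have hM2 : (2 * K * Ki + 2 * K * Cβ + K) / Cβ ≤ M := by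
    have : 0 ≤ 2 * K * Ki / (1 - a) := by positivity
    linarith
  have hM3 : 1 ≤ M := by
    have h1 : 0 ≤ (2 * K * Ki + 2 * K * Cβ + K) / Cβ := by positivity
    have h2 : 0 ≤ 2 * K * Ki / (1 - a) := by positivity
    linarith
  refine ⟨μb, μb, min cb 1, hμb0, hμb0, lt_min hcb one_pos, fun q => Cβ * (q.1 + q.2), ?_, ?_, ?_, ?_,
    M, κ, by linarith, hκ0, hκ1, ?_⟩
  · fun_prop
  · rintro ⟨e, v⟩ - ⟨e', v'⟩ - h
    have h' : e + v < e' + v' := by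
      rcases Prod.mk_lt_mk.1 h with ⟨h1, h2⟩ | ⟨h1, h2⟩ <;> linarith
    exact mul_lt_mul_of_pos_left h' hCβ0
  · rintro ⟨e, v⟩ ⟨⟨he0, he⟩, hv0, hv⟩
    simp only at he0 he hv0 hv
    refine ⟨mul_nonneg hCβ0.le (add_nonneg he0 hv0), ?_⟩
    have h1 : μb ≤ V_ROA / (2 * Cβ) :=
      (min_le_right _ _).trans ((min_le_right _ _).trans (min_le_right _ _))
    rw [le_div_iff₀ (by positivity)] at h1
    simp only
    nlinarith
  · simp
  intro εs ws cpe hε hεb hw hwb hcpe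
  refine ⟨c, hc, 1, Matrix.PosDef.one, ?_⟩
  intro b hb D hD p hp x u w hcl hpast hV0
  have hμ : max εs ws ≤ μb := max_le hεb hwb
  have hμ0 : 0 < max εs ws := lt_max_of_lt_left hε
  have hμ1 : max εs ws ≤ 1 := hμ.trans ((min_le_right _ _).trans ((min_le_left _ _).trans (min_le_left _ _)))
  have hμρ : max εs ws ≤ ρ - ρ₂ :=
    hμ.trans ((min_le_right _ _).trans ((min_le_left _ _).trans (min_le_right _ _)))
  have hμV : max εs ws ≤ a * V_ROA / Kβ :=
    hμ.trans ((min_le_right _ _).trans ((min_le_right _ _).trans (min_le_left _ _)))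
  have hμsq : max εs ws ^ 2 ≤ max εs ws := by nlinarith
  have hμβ : max εs ws ^ 2 ≤ εs + ws := hμsq.trans (max_le (by linarith) (by linarith))
  set E := Kβ * max εs ws ^ 2 with hE
  have hE0 : 0 ≤ E := by positivity
  have hEV : E ≤ a * V_ROA := by
    rw [le_div_iff₀ hKβ] at hμV
    nlinarith
  have hEβ : E / a ≤ Cβ * (εs + ws) := by
    have h1 : E / a = Cβ * max εs ws ^ 2 := by rw [hE, hCβ]; ring
    rw [h1]
    exact mul_le_mul_of_nonneg_left hμβ hCβ0.le
  have hws : ρ₂ + ws ≤ ρ := by linarith [le_max_right εs ws]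
  have hper := hcontr b D εs ws ⟨hε, hw, hμ.trans ((min_le_left _ _).trans (min_le_left _ _)), hb, cpe, hD,
    hcpe.trans (min_le_left _ _)⟩ p hp x u w hcl
  have hV0' : p.V c 1 x u w ((0 : ℕ) * S.dmax) ≤ ENNReal.ofReal V_ROA := by simpa using hV0
  have hpast0 : ∀ k < S.dmax, ‖S.h (x ((0 : ℕ) * S.dmax - S.dmax + k))‖ ≤ ρ₂ := fun k hk =>
    (hpast _ (by push_cast; omega) (by push_cast; omega)).trans (le_max_left _ _)
  obtain ⟨-, hu0, hT0, V0, hV0nn, hV0eq, -, -⟩ := hper 0 hV0' fun k hk => by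
    linarith [hpast0 k hk]
  have hgeom : ∀ j : ℕ, p.V c 1 x u w (j * S.dmax) ≤ ENNReal.ofReal V_ROA ∧
      (∀ k < S.dmax, ‖S.h (x (j * S.dmax - S.dmax + k))‖ ≤ ρ₂) ∧
      p.V c 1 x u w (j * S.dmax) ≤ ENNReal.ofReal ((1 - a) ^ j * V0 + E / a) := by
    intro j
    induction j with
    | zero =>
      refine ⟨hV0', hpast0, hV0eq.le.trans (ENNReal.ofReal_le_ofReal ?_)⟩
      rw [pow_zero, one_mul]
      exact le_add_of_nonneg_right (by positivity)
    | succ j ih =>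
      obtain ⟨ih1, ih2, ih3⟩ := ih
      obtain ⟨-, -, hT, Vr, hVr0, hVr, -, hnext⟩ := hper j ih1 fun k hk => by linarith [ih2 k hk]
      rw [hVr] at ih1 ih3
      have hVr1 := (ENNReal.ofReal_le_ofReal_iff hV.le).1 ih1
      have hVr2 := (ENNReal.ofReal_le_ofReal_iff (by positivity)).1 ih3
      refine ⟨hnext.trans (ENNReal.ofReal_le_ofReal ?_), fun k hk => ?_,
        hnext.trans (ENNReal.ofReal_le_ofReal ?_)⟩
      · have := mul_le_mul_of_nonneg_left hVr1 h1a.le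
        linarith
      · have h1 := (S.norm_out_le _).trans (hT k hk.le)
        rw [S.out_T] at h1
        rw [show ((j + 1 : ℕ) : ℤ) * S.dmax - S.dmax + k = j * S.dmax + k by push_cast; ring]
        exact h1.trans (le_max_right _ _)
      · have h1 := mul_le_mul_of_nonneg_left hVr2 h1a.le
        have h2 : (1 - a) * ((1 - a) ^ j * V0 + E / a) + E = (1 - a) ^ (j + 1) * V0 + E / a := by
          rw [pow_succ]
          field_simp
          ring
        linarith
  have hall := fun j => hper j (hgeom j).1 fun k hk => by linarith [(hgeom j).2.1 k hk]
  have hsplit : ∀ t : ℕ, ∃ j k : ℕ, k < S.dmax ∧ t = j * S.dmax + k := fun t =>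
    ⟨t / S.dmax, t % S.dmax, Nat.mod_lt _ hdpos, (Nat.div_add_mod' t S.dmax).symm⟩
  have hupast : ∀ k < S.dmax, u ((k : ℤ) - S.dmax) ∈ C.U := fun k hk => by
    have := (hu0 k hk).1
    rwa [show ((0 : ℕ) : ℤ) * S.dmax - S.dmax + k = k - S.dmax by push_cast; ring] at this
  refine ⟨fun j => (hall j).1, fun j => (hgeom j).1, fun k hk => ?_, fun j => ?_, fun t => ?_⟩
  · rcases lt_or_ge k 0 with hk0 | hk0
    · obtain ⟨l, hl⟩ : ∃ l : ℕ, k = (l : ℤ) - S.dmax := ⟨(k + S.dmax).toNat, by omega⟩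
      subst hl
      refine hΩρ ⟨hupast l (by omega), mem_closedBall_zero_iff.2 ?_⟩
      refine (norm_traj_le_of_end (Ξ := fun k => S.T (x ((k : ℤ) - S.dmax)))
        (fun (k : ℕ) (_ : k < S.dmax) => hcl.step_eq k) hρ₂0
        (fun k hk => (hpast _ (by omega) (by omega)).trans (le_max_left _ _)) ?_ l (by omega)).trans
        hρ₂ρ.le
      have := hT0 0 (Nat.zero_le _)
      simp only [sub_self]
      simp only [Nat.cast_zero, zero_mul, add_zero] at this
      exact this.trans (le_max_right _ _)
    · obtain ⟨l, rfl⟩ := Int.eq_ofNat_of_zero_le hk0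
      obtain ⟨j, i, hi, rfl⟩ := hsplit l
      obtain ⟨-, hu, hT, -⟩ := hall j
      push_cast
      exact hΩρ ⟨(hu i hi).2, mem_closedBall_zero_iff.2 ((hT i hi.le).trans (by linarith))⟩
  · refine (hgeom j).2.2.trans ?_
    have h0 : p.V c 1 x u w 0 = ENNReal.ofReal V0 := by simpa using hV0eq
    rw [h0, ← ENNReal.ofReal_mul (by positivity), ← ENNReal.ofReal_add (by positivity) (by positivity)]
    refine ENNReal.ofReal_le_ofReal (add_le_add ?_ hEβ)
    rw [mul_comm j, pow_mul, hκ]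
    exact mul_le_mul_of_nonneg_right (le_mul_of_one_le_left (by positivity) hM3) hV0nn
  · obtain ⟨j, k, hk, rfl⟩ := hsplit t
    obtain ⟨-, -, -, Vr, hVr0, hVr, hTsq, -⟩ := hall j
    have hj := (hgeom j).2.2
    rw [hVr] at hj
    have hVr2 := (ENNReal.ofReal_le_ofReal_iff (by positivity)).1 hj
    have hVi := hinit (min cb 1) (min_le_right _ _) b D εs ws
      ⟨hε, hw, hμ.trans ((min_le_left _ _).trans (min_le_right _ _)), hb, cpe, hD, hcpe⟩
      p hp x u w hcl hV0 hpast hupast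
    set Z := ‖S.T (x 0)‖ ^ 2 + ∑ k ∈ Finset.Ico (-(S.dmax : ℤ)) 0, (‖u k‖ ^ 2 + ‖S.h (x k)‖ ^ 2) with hZ
    have hZ0 : 0 ≤ Z := add_nonneg (sq_nonneg _) (Finset.sum_nonneg fun _ _ => by positivity)
    have h0 : p.V c 1 x u w 0 = ENNReal.ofReal V0 := by simpa using hV0eq
    rw [h0] at hVi
    have hV0Z := (ENNReal.ofReal_le_ofReal_iff (by positivity)).1 hVi
    have hx := hTsq k hk.le
    push_cast
    refine hx.trans ?_
    have hpow1 : (1 - a) ^ j ≤ 1 := pow_le_one₀ h1a.le (by linarith)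
    have hpow0 : 0 ≤ (1 - a) ^ j := by positivity
    -- Within a period the rate per step is lost, at the price of a factor `1 / (1 - a)` in `M`.
    have hκk : (1 - a) ^ j * (1 - a) ≤ κ ^ (j * S.dmax + k) := by
      rw [pow_add, mul_comm j, pow_mul, hκ]
      refine mul_le_mul_of_nonneg_left ?_ hpow0
      rw [← hκ]
      exact pow_le_pow_of_le_one hκ0.le hκ1.le hk.le
    have hEa : E / a = Cβ * max εs ws ^ 2 := by rw [hE, hCβ]; ring
    have h3 : (1 - a) ^ j * V0 ≤ Ki * ((1 - a) ^ j * Z) + Ki * max εs ws ^ 2 := by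
      have h4 := mul_le_mul_of_nonneg_left hV0Z hpow0
      have h5 : (1 - a) ^ j * (Ki * max εs ws ^ 2) ≤ Ki * max εs ws ^ 2 :=
        mul_le_of_le_one_left (by positivity) hpow1
      linarith
    have h6 : K * (2 * Vr + max εs ws ^ 2) ≤ 2 * K * Ki * ((1 - a) ^ j * Z)
        + (2 * K * Ki + 2 * K * Cβ + K) * max εs ws ^ 2 := by
      have h7 : 2 * Vr + max εs ws ^ 2 ≤ 2 * (Ki * ((1 - a) ^ j * Z) + Ki * max εs ws ^ 2
          + Cβ * max εs ws ^ 2) + max εs ws ^ 2 := by linarith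
      have := mul_le_mul_of_nonneg_left h7 hK.le
      linarith
    have h8 : 2 * K * Ki * ((1 - a) ^ j * Z) ≤ M * (κ ^ (j * S.dmax + k) * Z) := by
      calc 2 * K * Ki * ((1 - a) ^ j * Z) = 2 * K * Ki / (1 - a) * (((1 - a) ^ j * (1 - a)) * Z) := by
            field_simp
        _ ≤ M * (κ ^ (j * S.dmax + k) * Z) :=
          mul_le_mul hM1 (mul_le_mul_of_nonneg_right hκk hZ0) (by positivity) (by linarith)
    have h9 : (2 * K * Ki + 2 * K * Cβ + K) * max εs ws ^ 2 ≤ M * (Cβ * (εs + ws)) := by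
      calc (2 * K * Ki + 2 * K * Cβ + K) * max εs ws ^ 2
          = (2 * K * Ki + 2 * K * Cβ + K) / Cβ * (Cβ * max εs ws ^ 2) := by field_simp
        _ ≤ M * (Cβ * (εs + ws)) :=
          mul_le_mul hM2 (mul_le_mul_of_nonneg_left hμβ hCβ0.le) (by positivity) (by linarith)
    linarith
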